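/- Fix integers $m\ge 2$, $\ell\ge 2$, $s\ge 0$ and $t_1,\dots,t_s\ge 1$, and put $t=\sum_{i=1}^s t_i$. The uniform attachment graph $G^m_n$ is the random multigraph on $\{1,\dots,n\}$ in which every vertex $j\in\{2,\dots,n\}$ has $m$ edges labelled $1,\dots,m$ to vertices of $\{1,\dots,j-1\}$, the older endpoint of each of these edges being chosen uniformly at random, all choices being independent. Let $\mathcal C_\ell$ be a cycle with $\ell$ edges (a pair of parallel edges if $\ell=2$), let $\mathcal T_i$, $i=1,\dots,s$, be a rooted tree with $t_i$ edges, and let $\Lambda$ be a unicyclic multigraph obtained by attaching each $\mathcal T_i$ to $\mathcal C_\ell$, using a vertex of $\mathcal C_\ell$ as the root of $\mathcal T_i$. Let $W_n$ be the number of copies of $\Lambda$ in $G^m_n$, i.e. the number of subgraphs of $G^m_n$ (with labelled edges) that are isomorphic, as undirected multigraphs, to $\Lambda$. Let $\mu_n=\mathbb E W_n$, $\sigma_n^2=\operatorname{Var}(W_n)$ and, when $\sigma_n>0$, $Y_n=(W_n-\mu_n)/\sigma_n$. Then, as $n\to\infty$, $$\mu_n=\Theta\big(\log^{t+1} n\big),\qquad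 \sigma_n^2=\Theta\big(\log^{2t+1} n\big),$$ and there is a constant $C=C(m,\ell,t)>0$, depending only on $m$, $\ell$ and $t$, such that for every $n\ge 2$ with $\sigma_n>0$ $$d_{\mathrm W}\big(\mathcal L(Y_n),\mathcal N(0,1)\big)\le C\log^{-1/2} n ,$$ where $d_{\mathrm W}(\mu,\nu)=\sup_f\big|\int f\,d\mu-\int f\,d\nu\big|$, the supremum being over all $f:\mathbb R\to\mathbb R$ with $|f(x)-f(y)|\le|x-y|$ for all $x,y\in\mathbb{R}$. -/

import Mathlib

open MeasureTheory ProbabilityTheory Filter Asymptotics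
open scoped ENNReal

noncomputable section

namespace UniformAttachment

/-! Vertices of graphs of size `n` are the elements of `Fin n`, so the vertex `j : Fin n` stands for
the vertex with label `j + 1` in `{1, …, n}`.  Possible edges are triples `(j, i, a)` with `i < j`:
the edge with label `a` from the younger vertex `j` to the older vertex `i`. -/

/-- Triples `(j, i, a)`: younger endpoint, older endpoint, edge label. -/
abbrev EdgeName (m n : ℕ) : Type := Fin n × Fin n × Fin m

/-- The pairs (vertex different from the first one, label): each such pair is an edge that has to
choose its older endpoint. -/
abbrev Slot (m n : ℕ) : Type := {j : Fin n // 0 < (j : ℕ)} × Fin m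

/-- Sample space of the uniform attachment graph: the edge with label `a` born with the vertex `j`
chooses an endpoint among the vertices `i < j`. -/
abbrev Sample (m n : ℕ) : Type := (e : Slot m n) → {i : Fin n // i < e.1.1}

/-- All choices are independent and uniform on the set of older vertices. -/
def law (m n : ℕ) : Measure (Sample m n) :=
  Measure.pi fun _ => uniformOn Set.univ

/-- The `m`-fold complete multigraph on `n` vertices. -/
def completeMultigraph (m n : ℕ) : Graph (Fin n) (EdgeName m n) where
  vertexSet := Set.univ
  IsLink e x y := e.2.1 < e.1 ∧ s(x, y) = s(e.1, e.2.1)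
  isLink_symm := fun _ _ => ⟨fun _ _ h => ⟨h.1, Sym2.eq_swap.trans h.2⟩⟩
  eq_or_eq_of_isLink_of_isLink := by
    intro e x y v w h h'
    have := h.2.trans h'.2.symm
    rw [Sym2.eq_iff] at this
    tauto
  left_mem_of_isLink := fun _ _ _ _ => Set.mem_univ _

/-- The uniform attachment graph determined by the choices `ω`: it contains the edge `(j, i, a)` if
and only if the edge of `j` with label `a` has chosen the vertex `i`. -/
def attachmentGraph {m n : ℕ} (ω : Sample m n) : Graph (Fin n) (EdgeName m n) where
  vertexSet := Set.univ
  IsLink e x y :=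
    (∃ h : 0 < (e.1 : ℕ), (ω (⟨e.1, h⟩, e.2.2) : Fin n) = e.2.1) ∧ s(x, y) = s(e.1, e.2.1)
  isLink_symm := fun _ _ => ⟨fun _ _ h => ⟨h.1, Sym2.eq_swap.trans h.2⟩⟩
  eq_or_eq_of_isLink_of_isLink := by
    intro e x y v w h h'
    have := h.2.trans h'.2.symm
    rw [Sym2.eq_iff] at this
    tauto
  left_mem_of_isLink := fun _ _ _ _ => Set.mem_univ _

/-- Isomorphism of (undirected) multigraphs. -/
def Isomorphic {V E V' E' : Type*} (G : Graph V E) (H : Graph V' E') : Prop :=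
  ∃ (f : G.vertexSet ≃ H.vertexSet) (g : G.edgeSet ≃ H.edgeSet),
    ∀ (e : G.edgeSet) (x y : G.vertexSet),
      G.IsLink (e : E) (x : V) (y : V) ↔ H.IsLink (g e : E') (f x : V') (f y : V')

/-- The potential copies of `H`: the subgraphs of the `m`-fold complete multigraph which are
isomorphic to `H` and do not contain two different edges with the same younger endpoint and the
same label. -/
def potentialCopies {V E : Type*} (m n : ℕ) (H : Graph V E) :
    Set (Graph (Fin n) (EdgeName m n)) :=
  {α | α ≤ completeMultigraph m n ∧ Isomorphic α H ∧
    ∀ e ∈ α.edgeSet, ∀ e' ∈ α.edgeSet, e.1 = e'.1 → e.2.2 = e'.2.2 → e = e'}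

/-- The number of copies of `H` in the uniform attachment graph. -/
def copyCount {V E : Type*} (m n : ℕ) (H : Graph V E) (ω : Sample m n) : ℝ :=
  ({α ∈ potentialCopies m n H | α ≤ attachmentGraph ω}.ncard : ℝ)

/-- The expected number of copies of `H`. -/
def copyMean {V E : Type*} (m n : ℕ) (H : Graph V E) : ℝ :=
  ∫ ω, copyCount m n H ω ∂(law m n)

/-- The variance of the number of copies of `H`. -/
def copyVar {V E : Type*} (m n : ℕ) (H : Graph V E) : ℝ :=
  variance (copyCount m n H) (law m n)

/-- The distribution of the standardized number of copies of `H`. -/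
def standardizedLaw {V E : Type*} (m n : ℕ) (H : Graph V E) : Measure ℝ :=
  (law m n).map fun ω => (copyCount m n H ω - copyMean m n H) / √(copyVar m n H)

/-- The Wasserstein distance between two probability measures on the real line. -/
def wassersteinDist (μ ν : Measure ℝ) : ℝ≥0∞ :=
  ⨆ (f : ℝ → ℝ) (_ : ∀ x y, |f x - f y| ≤ |x - y|),
    ENNReal.ofReal |(∫ x, f x ∂μ) - ∫ x, f x ∂ν|

/-- A tree with `k` edges (hence `k + 1` vertices) and a distinguished root. -/
structure RootedTree (k : ℕ) where
  graph : SimpleGraph (Fin (k + 1))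
  isTree : graph.IsTree
  root : Fin (k + 1)

variable {ℓ s : ℕ} {τ : Fin s → ℕ}

/-- Vertices of the unicyclic graph: the vertices of the cycle and the non-root vertices of the
attached trees. -/
abbrev UVertex (ℓ : ℕ) (T : ∀ i, RootedTree (τ i)) : Type :=
  Fin ℓ ⊕ (Σ i, {v : Fin (τ i + 1) // v ≠ (T i).root})

/-- Edges of the unicyclic graph: the edges of the cycle and the edges of the attached trees. -/
abbrev UEdge (ℓ : ℕ) (T : ∀ i, RootedTree (τ i)) : Type :=
  Fin ℓ ⊕ (Σ i, (T i).graph.edgeSet)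

/-- The position of a vertex of the `i`th tree in the unicyclic graph: the root is identified with
the vertex `a i` of the cycle. -/
def place (T : ∀ i, RootedTree (τ i)) (a : Fin s → Fin ℓ) (i : Fin s) (v : Fin (τ i + 1)) :
    UVertex ℓ T :=
  if h : v = (T i).root then Sum.inl (a i) else Sum.inr ⟨i, v, h⟩

/-- The pair of endpoints of an edge of the unicyclic graph; the `k`th edge of the cycle joins `k`
and `k + 1` modulo `ℓ`. -/
def ends (T : ∀ i, RootedTree (τ i)) (a : Fin s → Fin ℓ) : UEdge ℓ T → Sym2 (UVertex ℓ T)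
  | Sum.inl k => s(Sum.inl k, Sum.inl (finRotate ℓ k))
  | Sum.inr ⟨i, e⟩ => Sym2.map (place T a i) e

/-- The multigraph obtained from an `ℓ`-cycle (a pair of parallel edges if `ℓ = 2`) by attaching,
for every `i`, the rooted tree `T i`, with the vertex `a i` of the cycle as its root. -/
def unicyclicGraph (T : ∀ i, RootedTree (τ i)) (a : Fin s → Fin ℓ) :
    Graph (UVertex ℓ T) (UEdge ℓ T) where
  vertexSet := Set.univ
  IsLink e x y := s(x, y) = ends T a e
  isLink_symm := fun _ _ => ⟨fun _ _ h => Sym2.eq_swap.trans h⟩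
  eq_or_eq_of_isLink_of_isLink := by
    intro e x y v w h h'
    have := h.trans h'.symm
    rw [Sym2.eq_iff] at this
    tauto
  left_mem_of_isLink := fun _ _ _ _ => Set.mem_univ _

end UniformAttachment

end

namespace UniformAttachment

/-! ### The Stein equation for Lipschitz test functions -/

/-! A copy, seen as a set of edges with distinct slots, occurs with probability equal to its weight:
the product over its edges of `1/x`, where `x` is the value in `Fin n` of the younger endpoint, a
vertex with exactly `x` older ones. Occurrences of copies without a common slot are independent. The
theorem thus reduces to estimates for the total weight of copies, of dependent pairs and of
dependent triples, followed by Stein's method for locally dependent sums.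

Upper bounds. Summed over positions, an edge becomes the kernel `1 / max x y`. A tree edge has row
sums of order `log n`. The cycle costs one logarithm whatever its length: with the weight `x^(-1/2)`
the kernel passes the Schur test with a bounded constant, and only `∑ 1/x` remains. So the mean is
`O(log^(t+1) n)` (`iterSum_shapeProd_le`, `mean_le`). Forcing a copy to meet a given vertex set of
bounded size removes one logarithm (`iterSum_hit_le`, `sum_meeting_le`), so dependent pairs weigh
`O(log^(2t+1) n)` and dependent triples `O(log^(3t+1) n)` (`sum_pairs_le`, `sum_triples_le`).

Lower bounds. The cycle can be placed at about `log n` geometric scales, each of the same constant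
weight, and a tree vertex in a window `[R^i, R^(i+1))` contributes `log R`; this gives the mean
(`le_mean`). For the variance, pairs with a common cycle and disjoint sets of tree vertices have
total covariance of order `log^(2t+1) n`. A covariance is negative only if the two copies need
different edges in one slot; such pairs have a common vertex and contribute `O(log^(2t) n)`
(`sum_conflict_le`, `le_var`).

Distance. Stein's bound (`abs_integral_stein_le`) is the triple sum divided by the cube of the
standard deviation, of order `log^(3t+1) n / log^(3t+3/2) n`. Every estimate is uniform over the
parent functions `S : Shape j t`, so the constant does not see the individual trees. -/

theorem integrable_exp_neg_half_sq : Integrable fun y : ℝ => Real.exp (-y ^ 2 / 2) := by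
  have := integrable_exp_neg_mul_sq (b := 1 / 2) (by norm_num)
  refine this.congr (ae_of_all _ fun y => ?_)
  simp only; congr 1; ring

theorem integrable_mul_exp_neg_half_sq : Integrable fun y : ℝ => y * Real.exp (-y ^ 2 / 2) := by
  have := integrable_mul_exp_neg_mul_sq (b := 1 / 2) (by norm_num)
  refine this.congr (ae_of_all _ fun y => ?_)
  simp only; congr 2; ring

theorem integrable_sq_mul_exp_neg_half_sq :
    Integrable fun y : ℝ => y ^ 2 * Real.exp (-y ^ 2 / 2) := by
  have := integrable_rpow_mul_exp_neg_mul_sq (b := 1 / 2) (by norm_num) (s := 2) (by norm_num)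
  refine this.congr (ae_of_all _ fun y => ?_)
  simp only [Real.rpow_two]; congr 2; ring

theorem hasDerivAt_exp_neg_half_sq (y : ℝ) :
    HasDerivAt (fun y : ℝ => Real.exp (-y ^ 2 / 2)) (-(y * Real.exp (-y ^ 2 / 2))) y := by
  have h : HasDerivAt (fun y : ℝ => -y ^ 2 / 2) (-y) y := by
    have := ((hasDerivAt_pow 2 y).fun_neg).div_const 2
    exact this.congr_deriv (by norm_num; ring)
  convert h.exp using 1
  ring

theorem tendsto_exp_neg_half_sq :
    Tendsto (fun y : ℝ => Real.exp (-y ^ 2 / 2)) atTop (nhds 0) := by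
  refine Real.tendsto_exp_atBot.comp ?_
  have h : Tendsto (fun y : ℝ => y ^ 2 / 2) atTop atTop :=
    (tendsto_pow_atTop (by norm_num)).atTop_div_const (by norm_num)
  have := tendsto_neg_atTop_atBot.comp h
  refine this.congr fun y => ?_
  simp [neg_div]

theorem tendsto_mul_exp_neg_half_sq :
    Tendsto (fun y : ℝ => y * Real.exp (-y ^ 2 / 2)) atTop (nhds 0) := by
  have h1 : Tendsto (fun y : ℝ => y * Real.exp (-y)) atTop (nhds 0) := by
    simpa using Real.tendsto_pow_mul_exp_neg_atTop_nhds_zero 1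
  refine squeeze_zero' ?_ ?_ h1
  · filter_upwards [eventually_ge_atTop 0] with y hy using by positivity
  · filter_upwards [eventually_ge_atTop 2] with y hy
    have : -y ^ 2 / 2 ≤ -y := by nlinarith
    gcongr

theorem integral_Ioi_mul_exp_neg_half_sq (x : ℝ) :
    ∫ y in Set.Ioi x, y * Real.exp (-y ^ 2 / 2) = Real.exp (-x ^ 2 / 2) := by
  have := integral_Ioi_of_hasDerivAt_of_tendsto (a := x)
    (f := fun y : ℝ => -Real.exp (-y ^ 2 / 2)) (f' := fun y => y * Real.exp (-y ^ 2 / 2)) (m := 0)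
    ((hasDerivAt_exp_neg_half_sq x).continuousAt.neg.continuousWithinAt)
    (fun y _ => by simpa using (hasDerivAt_exp_neg_half_sq y).fun_neg)
    integrable_mul_exp_neg_half_sq.integrableOn (by simpa using tendsto_exp_neg_half_sq.neg)
  rw [this]; ring

theorem integral_Ioi_sq_mul_exp_neg_half_sq (x : ℝ) :
    ∫ y in Set.Ioi x, y ^ 2 * Real.exp (-y ^ 2 / 2) =
      x * Real.exp (-x ^ 2 / 2) + ∫ y in Set.Ioi x, Real.exp (-y ^ 2 / 2) := by
  have hd : ∀ y : ℝ, HasDerivAt (fun y : ℝ => -(y * Real.exp (-y ^ 2 / 2)))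
      (y ^ 2 * Real.exp (-y ^ 2 / 2) - Real.exp (-y ^ 2 / 2)) y := fun y => by
    have := ((hasDerivAt_id' y).fun_mul (hasDerivAt_exp_neg_half_sq y)).fun_neg
    exact this.congr_deriv (by ring)
  have := integral_Ioi_of_hasDerivAt_of_tendsto (a := x)
    (f := fun y : ℝ => -(y * Real.exp (-y ^ 2 / 2))) (m := 0)
    ((hd x).continuousAt.continuousWithinAt) (fun y _ => hd y)
    (integrable_sq_mul_exp_neg_half_sq.sub integrable_exp_neg_half_sq).integrableOn
    (by simpa using tendsto_mul_exp_neg_half_sq.neg)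
  rw [integral_sub integrable_sq_mul_exp_neg_half_sq.integrableOn
    integrable_exp_neg_half_sq.integrableOn] at this
  linarith

theorem integral_exp_neg_half_sq_le : ∫ y : ℝ, Real.exp (-y ^ 2 / 2) ≤ 3 := by
  have h := integral_gaussian (1 / 2)
  have h' : ∫ y : ℝ, Real.exp (-y ^ 2 / 2) = ∫ y : ℝ, Real.exp (-(1 / 2) * y ^ 2) := by
    congr 1; ext y; congr 1; ring
  rw [h', h, Real.sqrt_le_left (by norm_num)]
  have := Real.pi_lt_four
  linarith

theorem continuous_of_abs_sub_le {q : ℝ → ℝ} (hq : ∀ x y, |q x - q y| ≤ |x - y|) : Continuous q :=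
  (LipschitzWith.of_dist_le_mul (K := 1) fun x y => by
    simpa [Real.dist_eq] using hq x y).continuous

theorem integrable_lipschitz_mul_exp {q : ℝ → ℝ} (hq : ∀ x y, |q x - q y| ≤ |x - y|) :
    Integrable fun y => q y * Real.exp (-y ^ 2 / 2) := by
  have h1 : Integrable fun y : ℝ => |q 0| * Real.exp (-y ^ 2 / 2) + |y * Real.exp (-y ^ 2 / 2)| :=
    (integrable_exp_neg_half_sq.const_mul _).add integrable_mul_exp_neg_half_sq.abs
  refine h1.mono' ?_ (ae_of_all _ fun y => ?_)
  · exact ((continuous_of_abs_sub_le hq).mul (by fun_prop)).aestronglyMeasurable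
  · rw [Real.norm_eq_abs, abs_mul, abs_mul, Real.abs_exp, ← add_mul]
    gcongr
    have := hq y 0
    have h2 := abs_sub_abs_le_abs_sub (q y) (q 0)
    rw [sub_zero] at this
    linarith

/-- Up to sign, the bounded quantity is the derivative of `x * g x` for the Stein solution `g`.
Replacing `q` by `q x` inside the integral costs at most the first tail moment `∫ (y - x) exp
(-y²/2)`; after the replacement, `q x` multiplies the second tail moment `∫ (y - x)² exp (-y²/2)`.
Both moments are explicit in `ρ` and `m`. -/
theorem abs_stein_tail_le {q : ℝ → ℝ} (hq : ∀ x y, |q x - q y| ≤ |x - y|) (h0 : |q 0| ≤ 1)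
    {x : ℝ} (hx : 0 ≤ x) :
    |(1 + x ^ 2) * (Real.exp (x ^ 2 / 2) * ∫ y in Set.Ioi x, q y * Real.exp (-y ^ 2 / 2))
      - x * q x| ≤ 14 := by
  set ρ := Real.exp (-x ^ 2 / 2) with hρ
  set m := ∫ y in Set.Ioi x, Real.exp (-y ^ 2 / 2) with hm
  set J := ∫ y in Set.Ioi x, q y * Real.exp (-y ^ 2 / 2) with hJ
  have hρ0 : 0 < ρ := Real.exp_pos _
  have hm0 : 0 ≤ m := integral_nonneg fun y => (Real.exp_pos _).le
  have hm3 : m ≤ 3 := (setIntegral_le_integral integrable_exp_neg_half_sq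
    (ae_of_all _ fun y => (Real.exp_pos _).le)).trans integral_exp_neg_half_sq_le
  have i0 := integrable_exp_neg_half_sq.integrableOn (s := Set.Ioi x)
  have i1 := integrable_mul_exp_neg_half_sq.integrableOn (s := Set.Ioi x)
  have i2 := integrable_sq_mul_exp_neg_half_sq.integrableOn (s := Set.Ioi x)
  have e1 : ∫ y in Set.Ioi x, (y - x) * Real.exp (-y ^ 2 / 2) = ρ - x * m := by
    rw [hρ, ← integral_Ioi_mul_exp_neg_half_sq, hm, ← integral_const_mul,
      ← integral_sub i1 (i0.const_mul x)]
    congr 1; ext y; ring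
  have e2 : ∫ y in Set.Ioi x, (y - x) ^ 2 * Real.exp (-y ^ 2 / 2) = (1 + x ^ 2) * m - x * ρ := by
    have : (1 + x ^ 2) * m - x * ρ = (x * ρ + m) - (2 * x) * ρ + x ^ 2 * m := by ring
    rw [this, hρ, hm, ← integral_Ioi_sq_mul_exp_neg_half_sq,
      ← integral_Ioi_mul_exp_neg_half_sq, ← integral_const_mul, ← integral_const_mul,
      ← integral_sub i2 (i1.const_mul _), ← integral_add (i2.sub' (i1.const_mul _)) (i0.const_mul _)]
    congr 1; ext y; ring
  have a1 : 0 ≤ ρ - x * m := by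
    rw [← e1]
    exact setIntegral_nonneg measurableSet_Ioi fun y hy =>
      mul_nonneg (sub_nonneg.2 (le_of_lt hy)) (Real.exp_pos _).le
  have a2 : 0 ≤ (1 + x ^ 2) * m - x * ρ := by
    rw [← e2]
    exact setIntegral_nonneg measurableSet_Ioi fun y hy => by positivity
  have hR : |J - q x * m| ≤ ρ - x * m := by
    rw [← e1, hJ, hm, ← integral_const_mul,
      ← integral_sub (integrable_lipschitz_mul_exp hq).integrableOn (i0.const_mul _)]
    refine (abs_integral_le_integral_abs).trans (setIntegral_mono_on ?_ ?_ measurableSet_Ioi ?_)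
    · exact ((integrable_lipschitz_mul_exp hq).integrableOn.sub (i0.const_mul _)).abs
    · refine (i1.sub (i0.const_mul x)).congr (ae_of_all _ fun y => ?_)
      simp only [Pi.sub_apply]; ring
    · intro y hy
      rw [← sub_mul, abs_mul, Real.abs_exp]
      gcongr
      exact (hq y x).trans_eq (abs_of_nonneg (sub_nonneg.2 (le_of_lt hy)))
  have hqx : |q x| ≤ x + 1 := by
    have := hq x 0
    have h2 := abs_sub_abs_le_abs_sub (q x) (q 0)
    rw [sub_zero, abs_of_nonneg hx] at this
    linarith
  -- Nonnegativity of the first moment bounds `x` times the second moment by `ρ`. For `1 ≤ x` this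
  -- already suffices; for `x ≤ 1` the second moment is at most `2 * 3` and `ρ > 1/2`.
  have ha2 : (1 + x ^ 2) * m - x * ρ ≤ 13 * ρ - x * ((1 + x ^ 2) * m - x * ρ) := by
    have hxa : x * ((1 + x ^ 2) * m - x * ρ) ≤ ρ := by nlinarith
    suffices (1 + x ^ 2) * m - x * ρ ≤ 12 * ρ by linarith
    rcases le_total 1 x with h1 | h1
    · nlinarith
    · have h3 : Real.exp (-(1 / 2)) ≤ ρ := Real.exp_le_exp.2 (by nlinarith)
      have h4 : -(1 / 2) + 1 < Real.exp (-(1 / 2) : ℝ) := Real.add_one_lt_exp (by norm_num)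
      nlinarith
  have hfin : |(1 + x ^ 2) * J - x * q x * ρ| ≤ 14 * ρ := by
    have : (1 + x ^ 2) * J - x * q x * ρ =
      (1 + x ^ 2) * (J - q x * m) + q x * ((1 + x ^ 2) * m - x * ρ) := by ring
    rw [this]
    refine (abs_add_le _ _).trans ?_
    rw [abs_mul, abs_mul, abs_of_nonneg a2, abs_of_nonneg (by positivity : 0 ≤ 1 + x ^ 2)]
    have b1 : (1 + x ^ 2) * |J - q x * m| ≤ (1 + x ^ 2) * (ρ - x * m) := by gcongr
    have b2 : |q x| * ((1 + x ^ 2) * m - x * ρ) ≤ (x + 1) * ((1 + x ^ 2) * m - x * ρ) := by gcongr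
    -- The bounds `b1` and `b2` add up to exactly `ρ` plus the second moment: the terms with the
    -- factor `x` cancel.
    nlinarith [mul_nonneg hx a2]
  have hee : Real.exp (x ^ 2 / 2) * ρ = 1 := by
    rw [hρ, ← Real.exp_add]; simp [neg_div]
  have : (1 + x ^ 2) * (Real.exp (x ^ 2 / 2) * J) - x * q x =
      Real.exp (x ^ 2 / 2) * ((1 + x ^ 2) * J - x * q x * ρ) := by
    linear_combination (x * q x) * hee
  rw [this, abs_mul, Real.abs_exp]
  calc _ ≤ Real.exp (x ^ 2 / 2) * (14 * ρ) := by gcongr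
    _ = 14 := by linear_combination 14 * hee

/-- The constant comes from `|f 0 - f y| ≤ |y| ≤ (1 + y²) / 2` and the unit variance. -/
theorem abs_integral_gaussian_sub_le {f : ℝ → ℝ} (hf : ∀ x y, |f x - f y| ≤ |x - y|) :
    Integrable f (gaussianReal 0 1) ∧ |f 0 - ∫ y, f y ∂gaussianReal 0 1| ≤ 1 := by
  have hid : Integrable (fun y : ℝ => y) (gaussianReal 0 1) :=
    (memLp_id_gaussianReal (μ := 0) (v := 1) 1).integrable (by simp)
  have hsq : Integrable (fun y : ℝ => y ^ 2) (gaussianReal 0 1) :=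
    (memLp_id_gaussianReal (μ := 0) (v := 1) 2).integrable_sq
  have hint : Integrable f (gaussianReal 0 1) := by
    refine ((integrable_const |f 0|).add hid.abs).mono'
      (continuous_of_abs_sub_le hf).aestronglyMeasurable (ae_of_all _ fun y => ?_)
    have := hf y 0
    have h2 := abs_sub_abs_le_abs_sub (f y) (f 0)
    rw [sub_zero] at this
    simp only [Real.norm_eq_abs, Pi.add_apply]
    linarith
  refine ⟨hint, ?_⟩
  have hvar : ∫ y : ℝ, y ^ 2 ∂gaussianReal 0 1 = 1 := by
    have h := variance_fun_id_gaussianReal (μ := 0) (v := 1)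
    rw [variance_eq_integral aemeasurable_id'] at h
    simpa [integral_id_gaussianReal] using h
  have h1 : f 0 - ∫ y, f y ∂gaussianReal 0 1 = ∫ y, (f 0 - f y) ∂gaussianReal 0 1 := by
    rw [integral_sub (integrable_const _) hint]; simp
  rw [h1]
  calc |∫ y, (f 0 - f y) ∂gaussianReal 0 1| ≤ ∫ y, |f 0 - f y| ∂gaussianReal 0 1 :=
        abs_integral_le_integral_abs
    _ ≤ ∫ y, (1 + y ^ 2) / 2 ∂gaussianReal 0 1 := by
        refine integral_mono (((integrable_const _).sub hint).abs)
          (((integrable_const _).add hsq).div_const 2) fun y => (hf 0 y).trans ?_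
        rw [zero_sub, abs_neg]
        nlinarith [sq_nonneg (|y| - 1), sq_abs y]
    _ = 1 := by
        rw [integral_div, integral_add (integrable_const _) hsq, hvar]; simp

/-- Every `1`-Lipschitz test function has a solution of its Stein equation whose derivative is
Lipschitz. -/
theorem exists_stein_solution {f : ℝ → ℝ} (hf : ∀ x y, |f x - f y| ≤ |x - y|) :
    ∃ g g' : ℝ → ℝ, (∀ x, HasDerivAt g (g' x) x) ∧
      (∀ x, g' x - x * g x = f x - ∫ y, f y ∂gaussianReal 0 1) ∧
      ∀ x y, |g' x - g' y| ≤ 15 * |x - y| := by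
  set c := ∫ y, f y ∂gaussianReal 0 1 with hc
  set q : ℝ → ℝ := fun x => f x - c with hqdef
  have hq : ∀ x y, |q x - q y| ≤ |x - y| := fun x y => by simpa [hqdef] using hf x y
  have hq0 : |q 0| ≤ 1 := (abs_integral_gaussian_sub_le hf).2
  have hqi := integrable_lipschitz_mul_exp hq
  have hqc : Continuous fun y => q y * Real.exp (-y ^ 2 / 2) :=
    (continuous_of_abs_sub_le hq).mul (by fun_prop)
  have hzero : ∫ y, q y * Real.exp (-y ^ 2 / 2) = 0 := by
    have h1 : ∫ y, q y ∂gaussianReal 0 1 = 0 := by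
      rw [hqdef, integral_sub (abs_integral_gaussian_sub_le hf).1 (integrable_const _)]
      simp [hc]
    rw [integral_gaussianReal_eq_integral_smul one_ne_zero] at h1
    simp only [gaussianPDFReal, smul_eq_mul, mul_assoc, integral_const_mul] at h1
    rcases mul_eq_zero.1 h1 with h | h
    · exfalso
      have : 0 < √(2 * (Real.pi * ((1 : NNReal) : ℝ))) := by simp [Real.pi_pos]
      exact (inv_pos.2 this).ne' h
    · rw [← h]; congr 1; ext y; simp [mul_comm]
  set G : ℝ → ℝ := fun x => ∫ y in Set.Iic x, q y * Real.exp (-y ^ 2 / 2) with hG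
  have hGd : ∀ x, HasDerivAt G (q x * Real.exp (-x ^ 2 / 2)) x := fun x => by
    have h1 : G = fun x => G 0 + ∫ y in (0 : ℝ)..x, q y * Real.exp (-y ^ 2 / 2) := by
      ext x
      rw [← intervalIntegral.integral_Iic_sub_Iic hqi.integrableOn hqi.integrableOn]
      simp [hG]
    rw [h1]
    exact (intervalIntegral.integral_hasDerivAt_right (hqc.intervalIntegrable _ _)
      (hqc.stronglyMeasurableAtFilter _ _) hqc.continuousAt).const_add _
  have hE : ∀ x : ℝ, Real.exp (x ^ 2 / 2) * Real.exp (-x ^ 2 / 2) = 1 := fun x => by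
    rw [← Real.exp_add]; simp [neg_div]
  set g : ℝ → ℝ := fun x => Real.exp (x ^ 2 / 2) * G x with hg
  have hgd : ∀ x, HasDerivAt g (x * g x + q x) x := fun x => by
    have h2 : HasDerivAt (fun y : ℝ => y ^ 2 / 2) x x := by
      exact ((hasDerivAt_pow 2 x).div_const 2).congr_deriv (by norm_num)
    refine (h2.exp.fun_mul (hGd x)).congr_deriv ?_
    simp only [hg]
    linear_combination (q x) * hE x
  -- As `q` has Gaussian mean zero, `G x` is also minus the upper tail, so the half-line estimate
  -- applies for `0 ≤ x`; reflecting `q` gives the case `x ≤ 0`.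
  have hbound : ∀ x, |(1 + x ^ 2) * g x + x * q x| ≤ 14 := fun x => by
    rcases le_total 0 x with hx | hx
    · have h := abs_stein_tail_le hq hq0 hx
      have h3 : G x = -∫ y in Set.Ioi x, q y * Real.exp (-y ^ 2 / 2) := by
        have := intervalIntegral.integral_Iic_add_Ioi (b := x) hqi.integrableOn hqi.integrableOn
        rw [hzero] at this
        simp only [hG]; linarith
      rw [← abs_neg]
      convert h using 2
      simp only [hg, h3]; ring
    · have h := abs_stein_tail_le (q := fun y => q (-y)) (fun a b => (hq _ _).trans_eq (by
        rw [← abs_neg]; congr 1; ring)) (by simpa using hq0) (neg_nonneg.2 hx)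
      have h3 : G x = ∫ y in Set.Ioi (-x), q (-y) * Real.exp (-y ^ 2 / 2) := by
        have := integral_comp_neg_Ioi (-x) fun y => q y * Real.exp (-y ^ 2 / 2)
        simp only [neg_neg, neg_sq] at this
        rw [this]
      rw [← h3] at h
      simpa [hg] using h
  refine ⟨g, fun x => x * g x + q x, hgd, fun x => by simp [hqdef], fun x y => ?_⟩
  -- The derivative of `g` is `x * g x + q x`: the first summand is `14`-Lipschitz by `hbound`, the
  -- second `1`-Lipschitz.
  have hxg : ∀ x, HasDerivAt (fun x => x * g x) ((1 + x ^ 2) * g x + x * q x) x := fun x =>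
    ((hasDerivAt_id' x).fun_mul (hgd x)).congr_deriv (by ring)
  have hlip := Convex.norm_image_sub_le_of_norm_hasDerivWithin_le (s := Set.univ)
    (fun x _ => (hxg x).hasDerivWithinAt) (fun x _ => hbound x) convex_univ
    (Set.mem_univ y) (Set.mem_univ x)
  simp only [Real.norm_eq_abs] at hlip
  calc |x * g x + q x - (y * g y + q y)| = |(x * g x - y * g y) + (q x - q y)| := by congr 1; ring
    _ ≤ |x * g x - y * g y| + |q x - q y| := abs_add_le _ _
    _ ≤ 15 * |x - y| := by linarith [hq x y]

end UniformAttachment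

namespace UniformAttachment

/-! ### Stein's method for sums of locally dependent variables -/

theorem dependsOn_sum {ι κ : Type*} {Ω : ι → Type*} {S : Set ι} {Y : κ → (∀ i, Ω i) → ℝ} {s : Finset κ}
    (h : ∀ a ∈ s, DependsOn (Y a) S) : DependsOn (fun ω => ∑ a ∈ s, Y a ω) S :=
  fun _ _ hω => Finset.sum_congr rfl fun a ha => h a ha hω

/-- Mean value inequality for `x ↦ g x - x * g' w`, whose derivative is at most `c * |z|` between `w
- z` and `w`. Taylor's factor `1/2` is given away. -/
theorem abs_taylor_le {g g' : ℝ → ℝ} {c : ℝ} (hg : ∀ x, HasDerivAt g (g' x) x)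
    (hc : ∀ x y, |g' x - g' y| ≤ c * |x - y|) (w z : ℝ) :
    |g w - g (w - z) - z * g' w| ≤ c * z ^ 2 := by
  have hc0 : 0 ≤ c := by
    have := (abs_nonneg _).trans (hc 1 0)
    simpa using this
  have h := Convex.norm_image_sub_le_of_norm_hasDerivWithin_le (s := Set.uIcc (w - z) w)
    (f := fun x => g x - x * g' w) (f' := fun x => g' x - g' w) (C := c * |z|) (x := w - z) (y := w)
    (fun x _ => ((hg x).fun_sub ((hasDerivAt_mul_const (g' w)))).hasDerivWithinAt)
    (fun x hx => (hc x w).trans (mul_le_mul_of_nonneg_left ?_ hc0)) (convex_uIcc _ _)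
    Set.left_mem_uIcc Set.right_mem_uIcc
  · simp only [Real.norm_eq_abs, sub_sub_cancel] at h
    calc |g w - g (w - z) - z * g' w| = |g w - w * g' w - (g (w - z) - (w - z) * g' w)| := by
          congr 1; ring
      _ ≤ c * |z| * |z| := h
      _ = c * z ^ 2 := by rw [mul_assoc, abs_mul_abs_self]; ring
  · have := Set.abs_sub_right_of_mem_uIcc hx
    rw [abs_sub_comm]
    simpa using this

section LocalDependence

variable {ι κ : Type*} [Fintype ι] {Ω : ι → Type*} [∀ i, MeasurableSpace (Ω i)]
  [∀ i, Finite (Ω i)] [∀ i, MeasurableSingletonClass (Ω i)] (μ : ∀ i, Measure (Ω i))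
  [∀ i, IsProbabilityMeasure (μ i)]

theorem integral_mul_of_dependsOn {f g : (∀ i, Ω i) → ℝ} {S T : Finset ι}
    (hf : DependsOn f (S : Set ι)) (hg : DependsOn g (T : Set ι)) (hST : Disjoint S T) :
    ∫ ω, f ω * g ω ∂Measure.pi μ = (∫ ω, f ω ∂Measure.pi μ) * ∫ ω, g ω ∂Measure.pi μ := by
  classical
  obtain ⟨f', rfl⟩ := dependsOn_iff_exists_comp.1 hf
  obtain ⟨g', rfl⟩ := dependsOn_iff_exists_comp.1 hg
  have hi : iIndepFun (fun i (ω : ∀ i, Ω i) => ω i) (Measure.pi μ) :=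
    iIndepFun_pi (X := fun i (x : Ω i) => x) fun i => aemeasurable_id
  have h2 := hi.indepFun_finset S T hST fun i => measurable_pi_apply i
  have h3 : IndepFun (f' ∘ (S : Set ι).domRestrict) (g' ∘ (T : Set ι).domRestrict) (Measure.pi μ) :=
    h2.comp (φ := f') (ψ := g') (measurable_of_finite _) (measurable_of_finite _)
  exact h3.integral_mul_eq_mul_integral (measurable_of_finite _).aestronglyMeasurable
    (measurable_of_finite _).aestronglyMeasurable

/-- Deleting from the sum `W` all variables that overlap `a` leaves something independent of the
centred `Y a`, so the mean of `Y a * g W` sees only the increment of `g`, which is linearised. This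
leaves terms `Y a * Y b * g' W` over overlapping pairs; deleting the variables that overlap `a` or
`b` decouples `g' W` from `Y a * Y b`. Each replacement costs a sum over triples. -/
theorem abs_integral_stein_le [DecidableEq ι] (s : Finset κ) (Y : κ → (∀ i, Ω i) → ℝ)
    (D : κ → Finset ι)
    (hD : ∀ a ∈ s, DependsOn (Y a) (D a : Set ι)) (h0 : ∀ a ∈ s, ∫ ω, Y a ω ∂Measure.pi μ = 0)
    (h1 : ∫ ω, (∑ a ∈ s, Y a ω) ^ 2 ∂Measure.pi μ = 1) {g g' : ℝ → ℝ} {c : ℝ}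
    (hg : ∀ x, HasDerivAt g (g' x) x) (hc : ∀ x y, |g' x - g' y| ≤ c * |x - y|) :
    |∫ ω, ((∑ a ∈ s, Y a ω) * g (∑ a ∈ s, Y a ω) - g' (∑ a ∈ s, Y a ω)) ∂Measure.pi μ| ≤
      2 * c * ∑ a ∈ s, ∑ b ∈ s with ¬ Disjoint (D a) (D b),
        ∑ d ∈ s with ¬ Disjoint (D a ∪ D b) (D d),
          ((∫ ω, |Y a ω * Y b ω * Y d ω| ∂Measure.pi μ) +
            (∫ ω, |Y a ω * Y b ω| ∂Measure.pi μ) * ∫ ω, |Y d ω| ∂Measure.pi μ) := by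
  classical
  have hint : ∀ f : (∀ i, Ω i) → ℝ, Integrable f (Measure.pi μ) := fun f => Integrable.of_finite
  have hc0 : 0 ≤ c := by
    have := (abs_nonneg _).trans (hc 1 0)
    simpa using this
  set E : ((∀ i, Ω i) → ℝ) → ℝ := fun f => ∫ ω, f ω ∂Measure.pi μ with hE
  set W : (∀ i, Ω i) → ℝ := fun ω => ∑ a ∈ s, Y a ω with hW
  have hEsum : ∀ (t : Finset κ) (F : κ → (∀ i, Ω i) → ℝ),
      E (fun ω => ∑ a ∈ t, F a ω) = ∑ a ∈ t, E (F a) :=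
    fun t F => integral_finsetSum _ fun _ _ => hint _
  have hEmono : ∀ F G : (∀ i, Ω i) → ℝ, (∀ ω, F ω ≤ G ω) → E F ≤ E G :=
    fun F G h => integral_mono (hint _) (hint _) h
  have hEabs : ∀ F : (∀ i, Ω i) → ℝ, |E F| ≤ E fun ω => |F ω| :=
    fun F => abs_integral_le_integral_abs
  have hEsub : ∀ F G : (∀ i, Ω i) → ℝ, E (fun ω => F ω - G ω) = E F - E G :=
    fun F G => integral_sub (hint _) (hint _)
  have hEc : ∀ (k : ℝ) (F : (∀ i, Ω i) → ℝ), E (fun ω => k * F ω) = k * E F :=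
    fun k F => integral_const_mul _ _
  set N : κ → Finset κ := fun a => {b ∈ s | ¬ Disjoint (D a) (D b)} with hN
  set N2 : κ → κ → Finset κ := fun a b => {d ∈ s | ¬ Disjoint (D a ∪ D b) (D d)} with hN2
  have hsplit : ∀ (S : Finset ι) (ω : ∀ i, Ω i), W ω - ∑ b ∈ s with ¬ Disjoint S (D b), Y b ω =
      ∑ b ∈ s with Disjoint S (D b), Y b ω := fun S ω => by
    rw [hW, sub_eq_iff_eq_add]
    exact (Finset.sum_filter_add_sum_filter_not s _ _).symm
  have hdis : ∀ S : Finset ι, DependsOn (fun ω => ∑ b ∈ s with Disjoint S (D b), Y b ω)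
      ((s.filter fun b => Disjoint S (D b)).biUnion D : Finset ι) := fun S =>
    dependsOn_sum fun b hb => (hD b (Finset.mem_filter.1 hb).1).mono
      (Finset.coe_subset.2 (Finset.subset_biUnion_of_mem D hb))
  have hdis' : ∀ S : Finset ι, Disjoint S ((s.filter fun b => Disjoint S (D b)).biUnion D) :=
    fun S => (Finset.disjoint_biUnion_right _ _ _).2 fun b hb => (Finset.mem_filter.1 hb).2
  have hcomp : ∀ (S : Finset ι) (k : ℝ → ℝ),
      DependsOn (fun ω => k (∑ b ∈ s with Disjoint S (D b), Y b ω))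
      ((s.filter fun b => Disjoint S (D b)).biUnion D : Finset ι) := fun S k _ _ h =>
    congrArg k (hdis S h)
  have hY2 : ∀ a ∈ s, ∀ b ∈ s, DependsOn (fun ω => Y a ω * Y b ω) ((D a ∪ D b : Finset ι) : Set ι) := by
    intro a ha b hb x y h
    have h1 := hD a ha (x := x) (y := y) fun i hi => h i (by simp at hi ⊢; exact Or.inl hi)
    have h2 := hD b hb (x := x) (y := y) fun i hi => h i (by simp at hi ⊢; exact Or.inr hi)
    simp only [h1, h2]
  -- the first-order expansion
  have S1 : ∀ a ∈ s, |E (fun ω => Y a ω * g (W ω)) - ∑ b ∈ N a, E (fun ω => Y a ω * Y b ω * g' (W ω))|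
      ≤ c * ∑ b ∈ N a, ∑ d ∈ N2 a b, E (fun ω => |Y a ω * Y b ω * Y d ω|) := by
    intro a ha
    have hz : E (fun ω => Y a ω * g (∑ b ∈ s with Disjoint (D a) (D b), Y b ω)) = 0 := by
      simp only [hE]
      rw [integral_mul_of_dependsOn μ (hD a ha) (hcomp (D a) g) (hdis' _), h0 a ha, zero_mul]
    have heq : E (fun ω => Y a ω * g (W ω)) - ∑ b ∈ N a, E (fun ω => Y a ω * Y b ω * g' (W ω)) =
        E (fun ω => Y a ω * (g (W ω) - g (W ω - ∑ b ∈ N a, Y b ω)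
          - (∑ b ∈ N a, Y b ω) * g' (W ω))) := by
      rw [← hEsum, ← sub_zero (E fun ω => Y a ω * g (W ω)), ← hz, ← hEsub, ← hEsub]
      congr 1; ext ω
      simp only [hN]
      rw [hsplit, Finset.sum_mul, mul_sub, Finset.mul_sum, mul_sub]
      congr 1
      exact Finset.sum_congr rfl fun b _ => by ring
    rw [heq]
    refine (hEabs _).trans ?_
    have hsub : ∀ b ∈ N a, N a ⊆ N2 a b := fun b _ d hd => by
      simp only [hN, hN2, Finset.mem_filter] at hd ⊢
      exact ⟨hd.1, fun h => hd.2 (Finset.disjoint_of_subset_left Finset.subset_union_left h)⟩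
    calc _ ≤ E (fun ω => c * ∑ b ∈ N a, ∑ d ∈ N a, |Y a ω * Y b ω * Y d ω|) := by
          refine hEmono _ _ fun ω => ?_
          rw [abs_mul]
          have h1 := abs_taylor_le hg hc (W ω) (∑ b ∈ N a, Y b ω)
          have h2 : (∑ b ∈ N a, Y b ω) ^ 2 ≤ (∑ b ∈ N a, |Y b ω|) ^ 2 := by
            rw [← sq_abs]
            gcongr
            exact Finset.abs_sum_le_sum_abs _ _
          calc _ ≤ |Y a ω| * (c * (∑ b ∈ N a, |Y b ω|) ^ 2) := by
                gcongr
                exact h1.trans (by gcongr)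
            _ = _ := by
                rw [sq, Finset.sum_mul_sum]
                simp only [abs_mul, Finset.mul_sum]
                refine Finset.sum_congr rfl fun b _ => Finset.sum_congr rfl fun d _ => by ring
      _ = c * ∑ b ∈ N a, ∑ d ∈ N a, E (fun ω => |Y a ω * Y b ω * Y d ω|) := by
          rw [hEc, hEsum]
          simp only [hEsum]
      _ ≤ _ := by
          gcongr with b hb
          exact hsub b hb
  -- the second-order expansion
  have S2 : ∀ a ∈ s, ∀ b ∈ s, |E (fun ω => Y a ω * Y b ω * g' (W ω)) -
      E (fun ω => Y a ω * Y b ω) * E (fun ω => g' (W ω))| ≤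
      c * ∑ d ∈ N2 a b, (E (fun ω => |Y a ω * Y b ω * Y d ω|) +
        E (fun ω => |Y a ω * Y b ω|) * E (fun ω => |Y d ω|)) := by
    intro a ha b hb
    set V : (∀ i, Ω i) → ℝ := fun ω => W ω - ∑ d ∈ N2 a b, Y d ω with hV
    have hVW : ∀ ω, |g' (W ω) - g' (V ω)| ≤ c * ∑ d ∈ N2 a b, |Y d ω| := fun ω => by
      refine (hc _ _).trans ?_
      gcongr
      simp only [hV, sub_sub_cancel]
      exact Finset.abs_sum_le_sum_abs _ _
    have hz : E (fun ω => Y a ω * Y b ω * g' (V ω)) =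
        E (fun ω => Y a ω * Y b ω) * E (fun ω => g' (V ω)) := by
      simp only [hV, hN2, hsplit]
      exact integral_mul_of_dependsOn μ (hY2 a ha b hb) (hcomp (D a ∪ D b) g') (hdis' _)
    have heq : E (fun ω => Y a ω * Y b ω * g' (W ω)) -
        E (fun ω => Y a ω * Y b ω) * E (fun ω => g' (W ω)) =
        E (fun ω => Y a ω * Y b ω * (g' (W ω) - g' (V ω))) -
        E (fun ω => Y a ω * Y b ω) * E (fun ω => g' (W ω) - g' (V ω)) := by
      simp only [mul_sub, hEsub, hz]; ring
    rw [heq]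
    have b1 : |E (fun ω => Y a ω * Y b ω * (g' (W ω) - g' (V ω)))| ≤
        c * ∑ d ∈ N2 a b, E (fun ω => |Y a ω * Y b ω * Y d ω|) := by
      refine (hEabs _).trans ?_
      rw [← hEsum, ← hEc]
      refine hEmono _ _ fun ω => ?_
      rw [abs_mul]
      refine (mul_le_mul_of_nonneg_left (hVW ω) (abs_nonneg _)).trans_eq ?_
      simp only [abs_mul, Finset.mul_sum]
      exact Finset.sum_congr rfl fun d _ => by ring
    have b2 : |E (fun ω => g' (W ω) - g' (V ω))| ≤ c * ∑ d ∈ N2 a b, E (fun ω => |Y d ω|) := by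
      refine (hEabs _).trans ?_
      rw [← hEsum, ← hEc]
      exact hEmono _ _ hVW
    calc _ ≤ |E (fun ω => Y a ω * Y b ω * (g' (W ω) - g' (V ω)))| +
        |E (fun ω => Y a ω * Y b ω) * E (fun ω => g' (W ω) - g' (V ω))| := abs_sub _ _
      _ ≤ c * ∑ d ∈ N2 a b, E (fun ω => |Y a ω * Y b ω * Y d ω|) +
          E (fun ω => |Y a ω * Y b ω|) * (c * ∑ d ∈ N2 a b, E (fun ω => |Y d ω|)) := by
          rw [abs_mul]
          exact add_le_add b1 (mul_le_mul (hEabs _) b2 (abs_nonneg _)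
            (integral_nonneg fun ω => abs_nonneg _))
      _ = _ := by
          rw [Finset.sum_add_distrib, mul_add, ← Finset.mul_sum]; ring
  -- the second moment
  have S3 : ∑ a ∈ s, ∑ b ∈ N a, E (fun ω => Y a ω * Y b ω) = 1 := by
    rw [← h1]
    have : ∀ ω, (∑ a ∈ s, Y a ω) ^ 2 = ∑ a ∈ s, ∑ b ∈ s, Y a ω * Y b ω := fun ω => by
      rw [sq, Finset.sum_mul_sum]
    simp only [this]
    change _ = E (fun ω => ∑ a ∈ s, ∑ b ∈ s, Y a ω * Y b ω)
    rw [hEsum]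
    refine Finset.sum_congr rfl fun a ha => ?_
    rw [hEsum, hN, Finset.sum_filter]
    refine Finset.sum_congr rfl fun b hb => ?_
    split_ifs with h
    · simp only [hE]
      rw [integral_mul_of_dependsOn μ (hD a ha) (hD b hb) h, h0 a ha, zero_mul]
    · rfl
  have hmain : E (fun ω => W ω * g (W ω) - g' (W ω)) =
      ∑ a ∈ s, ((E (fun ω => Y a ω * g (W ω)) - ∑ b ∈ N a, E (fun ω => Y a ω * Y b ω * g' (W ω))) +
        ∑ b ∈ N a, (E (fun ω => Y a ω * Y b ω * g' (W ω)) -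
          E (fun ω => Y a ω * Y b ω) * E (fun ω => g' (W ω)))) := by
    -- Since the second moment is `1`, the mean of `g' W` can be spread over the overlapping pairs
    -- and compared term by term.
    have hone : E (fun ω => g' (W ω)) =
        ∑ a ∈ s, (∑ b ∈ N a, E (fun ω => Y a ω * Y b ω)) * E (fun ω => g' (W ω)) := by
      rw [← Finset.sum_mul, S3, one_mul]
    rw [hEsub]
    have : (fun ω => W ω * g (W ω)) = fun ω => ∑ a ∈ s, Y a ω * g (W ω) := by
      ext ω; rw [← Finset.sum_mul]
    conv_lhs => rw [this, hEsum, hone, ← Finset.sum_sub_distrib]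
    refine Finset.sum_congr rfl fun a _ => ?_
    rw [Finset.sum_sub_distrib, Finset.sum_mul]
    ring
  change |E (fun ω => W ω * g (W ω) - g' (W ω))| ≤ _
  rw [hmain, Finset.mul_sum]
  refine (Finset.abs_sum_le_sum_abs _ _).trans (Finset.sum_le_sum fun a ha => ?_)
  refine (abs_add_le _ _).trans ?_
  have e2 : |∑ b ∈ N a, (E (fun ω => Y a ω * Y b ω * g' (W ω)) -
          E (fun ω => Y a ω * Y b ω) * E (fun ω => g' (W ω)))| ≤
      c * ∑ b ∈ N a, ∑ d ∈ N2 a b, (E (fun ω => |Y a ω * Y b ω * Y d ω|) +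
        E (fun ω => |Y a ω * Y b ω|) * E (fun ω => |Y d ω|)) := by
    rw [Finset.mul_sum]
    exact (Finset.abs_sum_le_sum_abs _ _).trans (Finset.sum_le_sum fun b hb =>
      S2 a ha b (Finset.mem_filter.1 hb).1)
  have e1 : ∑ b ∈ N a, ∑ d ∈ N2 a b, E (fun ω => |Y a ω * Y b ω * Y d ω|) ≤
      ∑ b ∈ N a, ∑ d ∈ N2 a b, (E (fun ω => |Y a ω * Y b ω * Y d ω|) +
        E (fun ω => |Y a ω * Y b ω|) * E (fun ω => |Y d ω|)) := by
    gcongr with b _ d _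
    exact le_add_of_nonneg_right (mul_nonneg (integral_nonneg fun ω => abs_nonneg _)
      (integral_nonneg fun ω => abs_nonneg _))
  calc _ ≤ _ := add_le_add ((S1 a ha).trans (mul_le_mul_of_nonneg_left e1 hc0)) e2
    _ = _ := by ring

end LocalDependence

end UniformAttachment

noncomputable section
namespace UniformAttachment

/-! ### Kernels -/

/-- The weight of an edge between the vertices `x` and `y`. -/
def edgeKernel (x y : ℕ) : ℝ := ((max (max x y) 1 : ℕ) : ℝ)⁻¹

/-- The weight function of the Schur test for `edgeKernel`. -/
def schurWeight (x : ℕ) : ℝ := (√((max x 1 : ℕ) : ℝ))⁻¹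

/-- The kernel which does not count the edges between the vertices of `O`. -/
def relKernel (O : Finset ℕ) (x y : ℕ) : ℝ := if x ∈ O ∧ y ∈ O then 1 else edgeKernel x y

/-- The weight function of the Schur test for `relKernel O`. -/
def relWeight (O : Finset ℕ) (x : ℕ) : ℝ := if x ∈ O then 1 else schurWeight x

/-- One plus a harmonic sum: the logarithmic scale in the bounds. -/
def logScale (n : ℕ) : ℝ := 1 + ∑ x ∈ Finset.range n, ((max x 1 : ℕ) : ℝ)⁻¹

theorem one_le_logScale (n : ℕ) : 1 ≤ logScale n :=
  le_add_of_nonneg_right (Finset.sum_nonneg fun _ _ => by positivity)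

theorem edgeKernel_pos (x y : ℕ) : 0 < edgeKernel x y := by
  unfold edgeKernel; positivity

theorem one_le_max_cast (x : ℕ) : (1 : ℝ) ≤ ((max x 1 : ℕ) : ℝ) := by
  exact_mod_cast le_max_right x 1

theorem edgeKernel_le_one (x y : ℕ) : edgeKernel x y ≤ 1 :=
  inv_le_one_of_one_le₀ (one_le_max_cast _)

theorem edgeKernel_comm (x y : ℕ) : edgeKernel x y = edgeKernel y x := by
  unfold edgeKernel; rw [max_comm x y]

theorem schurWeight_pos (x : ℕ) : 0 < schurWeight x := by
  unfold schurWeight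
  have := one_le_max_cast x
  positivity

theorem schurWeight_le_one (x : ℕ) : schurWeight x ≤ 1 :=
  inv_le_one_of_one_le₀ (Real.one_le_sqrt.2 (one_le_max_cast x))

theorem schurWeight_mul_self (x : ℕ) : schurWeight x * schurWeight x = ((max x 1 : ℕ) : ℝ)⁻¹ := by
  unfold schurWeight
  rw [← mul_inv, Real.mul_self_sqrt (by positivity)]

theorem edgeKernel_le_left (x y : ℕ) : edgeKernel x y ≤ ((max x 1 : ℕ) : ℝ)⁻¹ := by
  unfold edgeKernel
  have := one_le_max_cast x
  gcongr
  exact le_max_left x y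

theorem edgeKernel_le_right (x y : ℕ) : edgeKernel x y ≤ ((max y 1 : ℕ) : ℝ)⁻¹ := by
  rw [edgeKernel_comm]; exact edgeKernel_le_left y x

theorem edgeKernel_zero_right (x : ℕ) : edgeKernel x 0 = schurWeight x * schurWeight x := by
  rw [schurWeight_mul_self]; simp [edgeKernel]

/-- The maximum dominates the geometric mean. -/
theorem edgeKernel_le_schurWeight (x y : ℕ) :
    edgeKernel x y ≤ schurWeight x * schurWeight y := by
  have hx := edgeKernel_le_left x y
  have hy := edgeKernel_le_right x y
  rw [← schurWeight_mul_self] at hx hy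
  have h0 := edgeKernel_pos x y
  have h1 := schurWeight_pos x
  have h2 := schurWeight_pos y
  refine le_of_sq_le_sq ?_ (by positivity) |>.trans le_rfl
  calc edgeKernel x y ^ 2 = edgeKernel x y * edgeKernel x y := sq _
    _ ≤ (schurWeight x * schurWeight x) * (schurWeight y * schurWeight y) := by gcongr
    _ = _ := by ring

/-- The terms with `x < y` add up to at most `y * (1 / y)`, which is the summand `1` in `logScale`;
the others are harmonic. -/
theorem sum_edgeKernel_le (n y : ℕ) : ∑ x ∈ Finset.range n, edgeKernel x y ≤ logScale n := by
  have h : ∀ x, edgeKernel x y ≤ (if x < y then ((max y 1 : ℕ) : ℝ)⁻¹ else 0) +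
      ((max x 1 : ℕ) : ℝ)⁻¹ := fun x => by
    split_ifs with hxy
    · exact (edgeKernel_le_right x y).trans (le_add_of_nonneg_right (by positivity))
    · rw [zero_add]; exact edgeKernel_le_left x y
  refine (Finset.sum_le_sum fun x _ => h x).trans ?_
  rw [Finset.sum_add_distrib, logScale]
  gcongr
  rw [← Finset.sum_filter, Finset.sum_const, nsmul_eq_mul, ← div_eq_mul_inv]
  refine div_le_one_of_le₀ ?_ (by positivity)
  norm_cast
  refine le_trans (Finset.card_le_card (t := Finset.range y) ?_) (by simp)
  intro x hx
  simp at hx ⊢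
  exact hx.2

theorem sum_schurWeight_le (n : ℕ) : ∑ x ∈ Finset.range n, schurWeight x ≤ 3 * √n := by
  induction n with
  | zero => simp
  | succ n ih =>
    rw [Finset.sum_range_succ]
    suffices h : schurWeight n ≤ 3 * (√((n + 1 : ℕ) : ℝ) - √n) by linarith
    rcases Nat.eq_zero_or_pos n with rfl | hn
    · simp [schurWeight]
    · rw [schurWeight, max_eq_left hn]
      have hn' : (0 : ℝ) < n := by exact_mod_cast hn
      have ha : 0 < √(n : ℝ) := Real.sqrt_pos.2 hn'
      have ha2 : √(n : ℝ) ^ 2 = n := Real.sq_sqrt hn'.le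
      have hb2 : √((n + 1 : ℕ) : ℝ) ^ 2 = n + 1 := by rw [Real.sq_sqrt (by positivity)]; simp
      have hb : 0 ≤ √((n + 1 : ℕ) : ℝ) := Real.sqrt_nonneg _
      have h1 : (1 : ℝ) ≤ n := by exact_mod_cast hn
      set a := √(n : ℝ)
      set b := √((n + 1 : ℕ) : ℝ)
      have hab : b ≤ 2 * a := by nlinarith
      have : (b - a) * (b + a) = 1 := by nlinarith
      have hba : 0 ≤ b - a := by nlinarith
      rw [inv_le_iff_one_le_mul₀ ha]
      nlinarith

/-- The Schur test. Below `z = max y 1` the sum is at most `z⁻¹ ∑ x^(-1/2)`, of order `z^(-1/2)`;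
above `z` it is a tail of `∑ x^(-3/2)`, of the same order. -/
theorem sum_schurWeight_mul_edgeKernel_le (n y : ℕ) :
    ∑ x ∈ Finset.range n, schurWeight x * edgeKernel x y ≤ 8 * schurWeight y := by
  set z := max y 1 with hz
  have hz1 : 1 ≤ z := le_max_right _ _
  have hz0 : (0 : ℝ) < z := by exact_mod_cast hz1
  have hsz : 0 < √(z : ℝ) := Real.sqrt_pos.2 hz0
  have hsmall : ∀ m, m ≤ z → ∑ x ∈ Finset.range m, schurWeight x * edgeKernel x y ≤
      3 * schurWeight y := by
    intro m hm
    calc _ ≤ ∑ x ∈ Finset.range m, schurWeight x * (z : ℝ)⁻¹ := by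
          gcongr with x
          · exact (schurWeight_pos x).le
          · exact edgeKernel_le_right x y
      _ ≤ (3 * √(z : ℝ)) * (z : ℝ)⁻¹ := by
          rw [← Finset.sum_mul]
          gcongr
          exact (sum_schurWeight_le m).trans (by gcongr)
      _ = 3 * schurWeight y := by
          rw [schurWeight, ← hz]
          field_simp
          rw [Real.sq_sqrt hz0.le]
  -- The term `4 / √m` makes the induction telescope, since `m^(-3/2) ≤ 4 (m^(-1/2) -
  -- (m+1)^(-1/2))`; at `m = z` the claim is `hsmall`, as `7 - 4 = 3`.
  have hlarge : ∀ m, z ≤ m → ∑ x ∈ Finset.range m, schurWeight x * edgeKernel x y ≤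
      7 * schurWeight y - 4 * (√(m : ℝ))⁻¹ := by
    intro m hm
    induction m, hm using Nat.le_induction with
    | base =>
      refine (hsmall z le_rfl).trans ?_
      rw [schurWeight, ← hz]; linarith
    | succ m hm ih =>
      rw [Finset.sum_range_succ]
      suffices h : schurWeight m * edgeKernel m y ≤
          4 * ((√(m : ℝ))⁻¹ - (√((m + 1 : ℕ) : ℝ))⁻¹) by linarith
      have hm1 : 1 ≤ m := hz1.trans hm
      have hm0 : (0 : ℝ) < m := by exact_mod_cast hm1
      have hk := edgeKernel_le_left m y
      rw [max_eq_left hm1] at hk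
      have ha : 0 < √(m : ℝ) := Real.sqrt_pos.2 hm0
      have hb : 0 < √((m + 1 : ℕ) : ℝ) := Real.sqrt_pos.2 (by positivity)
      have ha2 : √(m : ℝ) ^ 2 = m := Real.sq_sqrt hm0.le
      have hb2 : √((m + 1 : ℕ) : ℝ) ^ 2 = m + 1 := by rw [Real.sq_sqrt (by positivity)]; simp
      have h1 : (1 : ℝ) ≤ m := by exact_mod_cast hm1
      have hs : schurWeight m = (√(m : ℝ))⁻¹ := by rw [schurWeight, max_eq_left hm1]
      rw [hs]
      refine (mul_le_mul_of_nonneg_left hk (by positivity)).trans ?_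
      set a := √(m : ℝ)
      set b := √((m + 1 : ℕ) : ℝ)
      have hba : (b - a) * (b + a) = 1 := by nlinarith
      have hab2 : b ^ 2 ≤ 2 * a ^ 2 := by nlinarith
      have hab : b ≤ 3 / 2 * a := by nlinarith
      have : (a)⁻¹ - b⁻¹ = 1 / (a * b * (b + a)) := by
        field_simp
        linear_combination hba
      rw [this, ← ha2, ← mul_inv, mul_one_div, inv_eq_one_div, div_le_div_iff₀ (by positivity) (by positivity)]
      have e1 : b * (b + a) ≤ 4 * a ^ 2 := by nlinarith
      nlinarith
  rcases le_total n z with h | h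
  · exact (hsmall n h).trans (by linarith [schurWeight_pos y])
  · have : 0 ≤ (√(n : ℝ))⁻¹ := by positivity
    exact (hlarge n h).trans (by linarith [schurWeight_pos y])

theorem relKernel_nonneg (O : Finset ℕ) (x y : ℕ) : 0 ≤ relKernel O x y := by
  unfold relKernel; split_ifs; exacts [zero_le_one, (edgeKernel_pos x y).le]

theorem relKernel_le_one (O : Finset ℕ) (x y : ℕ) : relKernel O x y ≤ 1 := by
  unfold relKernel; split_ifs; exacts [le_rfl, edgeKernel_le_one x y]

theorem relWeight_nonneg (O : Finset ℕ) (x : ℕ) : 0 ≤ relWeight O x := by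
  unfold relWeight; split_ifs; exacts [zero_le_one, (schurWeight_pos x).le]

theorem schurWeight_le_relWeight (O : Finset ℕ) (x : ℕ) : schurWeight x ≤ relWeight O x := by
  unfold relWeight; split_ifs; exacts [schurWeight_le_one x, le_rfl]

/-- In the application `O` is the vertex set of copies already chosen: an edge inside `O` may
already be present and is then free, so it counts `1`. The weight `1` on `O` keeps the Schur test
valid for this larger kernel. -/
theorem relKernel_le_relWeight (O : Finset ℕ) (x y : ℕ) :
    relKernel O x y ≤ relWeight O x * relWeight O y := by
  by_cases h : x ∈ O ∧ y ∈ O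
  · simp [relKernel, relWeight, h]
  · rw [relKernel, if_neg h]
    exact (edgeKernel_le_schurWeight x y).trans (mul_le_mul (schurWeight_le_relWeight O x)
      (schurWeight_le_relWeight O y) (schurWeight_pos y).le (relWeight_nonneg O x))

theorem sum_ite_mem_le (n : ℕ) (O : Finset ℕ) {c : ℝ} (hc : 0 ≤ c) :
    ∑ x ∈ Finset.range n, (if x ∈ O then c else 0) ≤ O.card * c := by
  rw [← Finset.sum_filter, Finset.sum_const, nsmul_eq_mul]
  gcongr
  intro x hx
  exact (Finset.mem_filter.1 hx).2

theorem sum_relKernel_le (n : ℕ) (O : Finset ℕ) (y : ℕ) :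
    ∑ x ∈ Finset.range n, relKernel O x y ≤ O.card + logScale n := by
  have h : ∀ x, relKernel O x y ≤ (if x ∈ O then 1 else 0) + edgeKernel x y := fun x => by
    unfold relKernel
    have := (edgeKernel_pos x y).le
    split_ifs <;> simp_all
  refine (Finset.sum_le_sum fun x _ => h x).trans ?_
  rw [Finset.sum_add_distrib]
  exact add_le_add (by simpa using sum_ite_mem_le n O zero_le_one) (sum_edgeKernel_le n y)

/-- The vertices of `O` add at most `|O|` terms to the Schur test, each at most `relWeight O y`. -/
theorem sum_relWeight_mul_relKernel_le (n : ℕ) (O : Finset ℕ) (y : ℕ) :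
    ∑ x ∈ Finset.range n, relWeight O x * relKernel O x y ≤ (O.card + 8) * relWeight O y := by
  have h : ∀ x, relWeight O x * relKernel O x y ≤ (if x ∈ O then relWeight O y else 0) +
      schurWeight x * edgeKernel x y := fun x => by
    have h1 := relKernel_le_relWeight O x y
    have h2 := mul_pos (schurWeight_pos x) (edgeKernel_pos x y)
    by_cases hx : x ∈ O
    · simp only [relWeight, hx, if_true] at h1 ⊢
      linarith
    · simp [relWeight, relKernel, hx]
  refine (Finset.sum_le_sum fun x _ => h x).trans ?_
  rw [Finset.sum_add_distrib, add_mul]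
  exact add_le_add (sum_ite_mem_le n O (relWeight_nonneg O y))
    ((sum_schurWeight_mul_edgeKernel_le n y).trans
      (mul_le_mul_of_nonneg_left (schurWeight_le_relWeight O y) (by norm_num)))

theorem sum_relWeight_sq_le (n : ℕ) (O : Finset ℕ) :
    ∑ x ∈ Finset.range n, relWeight O x * relWeight O x ≤ O.card + logScale n := by
  have h : ∀ x, relWeight O x * relWeight O x ≤ (if x ∈ O then 1 else 0) +
      ((max x 1 : ℕ) : ℝ)⁻¹ := fun x => by
    rw [← schurWeight_mul_self]
    unfold relWeight
    split_ifs
    · nlinarith [schurWeight_pos x]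
    · simp
  refine (Finset.sum_le_sum fun x _ => h x).trans ?_
  rw [Finset.sum_add_distrib]
  refine add_le_add (by simpa using sum_ite_mem_le n O zero_le_one) ?_
  unfold logScale; linarith

theorem relKernel_empty (x y : ℕ) : relKernel ∅ x y = edgeKernel x y := by simp [relKernel]

/-! ### Iterated sums -/

/-- The sum of `F ψ` over all `ψ` with `ψ k < n` for `k < N` and `ψ k = 0` for `k ≥ N`. -/
def iterSum (n : ℕ) : ℕ → ((ℕ → ℕ) → ℝ) → ℝ
  | 0, F => F fun _ => 0
  | N + 1, F => iterSum n N fun ψ => ∑ x ∈ Finset.range n, F (Function.update ψ N x)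

theorem iterSum_mono {n N : ℕ} {F G : (ℕ → ℕ) → ℝ} (h : ∀ ψ, F ψ ≤ G ψ) :
    iterSum n N F ≤ iterSum n N G := by
  induction N generalizing F G with
  | zero => exact h _
  | succ N ih => exact ih fun ψ => Finset.sum_le_sum fun x _ => h _

theorem iterSum_const_mul (n N : ℕ) (c : ℝ) (F : (ℕ → ℕ) → ℝ) :
    iterSum n N (fun ψ => c * F ψ) = c * iterSum n N F := by
  induction N generalizing F with
  | zero => rfl
  | succ N ih => simp only [iterSum, ← Finset.mul_sum, ih]

theorem iterSum_nonneg {n N : ℕ} {F : (ℕ → ℕ) → ℝ} (h : ∀ ψ, 0 ≤ F ψ) : 0 ≤ iterSum n N F := by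
  have := iterSum_mono (n := n) (N := N) (F := fun ψ => 0 * F ψ) (G := F) fun ψ => by simpa using h ψ
  rwa [iterSum_const_mul, zero_mul] at this

/-- The extension by zero of a finite sequence of elements of `Fin n`. -/
def extendNat {n N : ℕ} (φ : Fin N → Fin n) (k : ℕ) : ℕ := if h : k < N then φ ⟨k, h⟩ else 0

theorem extendNat_val {n N : ℕ} (φ : Fin N → Fin n) (k : Fin N) : extendNat φ k = φ k := by
  simp [extendNat]

/-- The nested form allows the last vertex to be summed out first; this lemma translates back to
sums over placements. -/
theorem iterSum_eq_sum (n N : ℕ) (F : (ℕ → ℕ) → ℝ) :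
    iterSum n N F = ∑ φ : Fin N → Fin n, F (extendNat φ) := by
  induction N generalizing F with
  | zero =>
    rw [Fintype.sum_unique]
    simp only [iterSum]
    congr 1
  | succ N ih =>
    rw [iterSum, ih, ← (Fin.snocEquiv fun _ => Fin n).sum_comp, Fintype.sum_prod_type_right]
    refine Finset.sum_congr rfl fun φ _ => ?_
    rw [← Fin.sum_univ_eq_sum_range fun x => F (Function.update (extendNat φ) N x)]
    refine Finset.sum_congr rfl fun x _ => ?_
    congr 1
    ext k
    rcases lt_trichotomy k N with h | h | h
    · rw [Function.update_of_ne h.ne, extendNat, extendNat, dif_pos h, dif_pos (by omega)]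
      simp [Fin.snocEquiv, Fin.snoc, h]
    · subst h
      have h' : (⟨k, by omega⟩ : Fin (k + 1)) = Fin.last k := rfl
      rw [Function.update_self, extendNat, dif_pos (by omega), h']
      simp [Fin.snocEquiv]
    · rw [Function.update_of_ne h.ne', extendNat, extendNat, dif_neg (by omega), dif_neg (by omega)]


/-! ### Weighted sums over cycles with trees attached -/

/-- The product of the kernel over the edges of the cycle with vertices `0, …, j`. -/
def cycleProd (R : ℕ → ℕ → ℝ) (j : ℕ) (ψ : ℕ → ℕ) : ℝ :=
  (∏ i ∈ Finset.range j, R (ψ (i + 1)) (ψ i)) * R (ψ 0) (ψ j)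

theorem cycleProd_nonneg {R : ℕ → ℕ → ℝ} (hR : ∀ x y, 0 ≤ R x y) (j : ℕ) (ψ : ℕ → ℕ) :
    0 ≤ cycleProd R j ψ :=
  mul_nonneg (Finset.prod_nonneg fun _ _ => hR _ _) (hR _ _)

theorem cycleProd_update (R : ℕ → ℕ → ℝ) {j k : ℕ} (hk : j < k) (ψ : ℕ → ℕ) (x : ℕ) :
    cycleProd R j (Function.update ψ k x) = cycleProd R j ψ := by
  unfold cycleProd
  rw [Function.update_of_ne (by omega), Function.update_of_ne (by omega)]
  congr 1
  refine Finset.prod_congr rfl fun i hi => ?_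
  have := Finset.mem_range.1 hi
  rw [Function.update_of_ne (by omega), Function.update_of_ne (by omega)]

/-- Summing out the last vertex of the path moves the factor `w` to the vertex before it, at the
price `A`. -/
theorem iterSum_path_le {n : ℕ} {R : ℕ → ℕ → ℝ} {w G : ℕ → ℝ} {A : ℝ} (hR : ∀ x y, 0 ≤ R x y)
    (hG : ∀ x, 0 ≤ G x) (hA : 0 ≤ A)
    (hS : ∀ y, ∑ x ∈ Finset.range n, w x * R x y ≤ A * w y) (j : ℕ) :
    iterSum n (j + 1) (fun ψ => G (ψ 0) * (∏ i ∈ Finset.range j, R (ψ (i + 1)) (ψ i)) * w (ψ j)) ≤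
      A ^ j * ∑ x ∈ Finset.range n, G x * w x := by
  induction j with
  | zero => simp [iterSum]
  | succ j ih =>
    rw [iterSum]
    refine (iterSum_mono (G := fun ψ => A * (G (ψ 0) *
      (∏ i ∈ Finset.range j, R (ψ (i + 1)) (ψ i)) * w (ψ j))) fun ψ => ?_).trans ?_
    · have h : ∀ x, G (Function.update ψ (j + 1) x 0) * (∏ i ∈ Finset.range (j + 1),
          R (Function.update ψ (j + 1) x (i + 1)) (Function.update ψ (j + 1) x i)) *
          w (Function.update ψ (j + 1) x (j + 1)) =
          G (ψ 0) * (∏ i ∈ Finset.range j, R (ψ (i + 1)) (ψ i)) * (w x * R x (ψ j)) := fun x => by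
        rw [Finset.prod_range_succ, Function.update_self, Function.update_of_ne (by omega),
          Function.update_of_ne (by omega)]
        rw [Finset.prod_congr rfl fun i hi => by
          have := Finset.mem_range.1 hi
          rw [Function.update_of_ne (by omega), Function.update_of_ne (by omega)]]
        ring
      simp only [h, ← Finset.mul_sum]
      calc _ ≤ G (ψ 0) * (∏ i ∈ Finset.range j, R (ψ (i + 1)) (ψ i)) * (A * w (ψ j)) := by
            refine mul_le_mul_of_nonneg_left (hS _) (mul_nonneg (hG _) ?_)
            exact Finset.prod_nonneg fun _ _ => hR _ _
        _ = _ := by ring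
    · rw [iterSum_const_mul]
      refine (mul_le_mul_of_nonneg_left ih hA).trans_eq ?_
      ring

/-- The cycle product is invariant under translation in `Fin (j + 1)`, so the marked vertex can be
moved to `0`. -/
theorem iterSum_cycleProd_rotate (n : ℕ) (R : ℕ → ℕ → ℝ) (G : ℕ → ℝ) {j k : ℕ} (hk : k ≤ j) :
    iterSum n (j + 1) (fun ψ => G (ψ k) * cycleProd R j ψ) =
      iterSum n (j + 1) (fun ψ => G (ψ 0) * cycleProd R j ψ) := by
  have key : ∀ φ : Fin (j + 1) → Fin n, cycleProd R j (extendNat φ) =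
      ∏ i : Fin (j + 1), R (φ (i + 1)) (φ i) := fun φ => by
    rw [Fin.prod_univ_castSucc, cycleProd, ← Fin.prod_univ_eq_prod_range
      (fun i => R (extendNat φ (i + 1)) (extendNat φ i))]
    congr 1
    · refine Finset.prod_congr rfl fun i _ => ?_
      congr 1
      · rw [← extendNat_val φ]; congr 1; simp
      · rw [← extendNat_val φ]; congr 1
    · congr 1
      · rw [← extendNat_val φ]; congr 1; simp
      · rw [← extendNat_val φ]; congr 1
  rw [iterSum_eq_sum, iterSum_eq_sum]
  simp only [key]
  set k' : Fin (j + 1) := ⟨k, by omega⟩ with hk'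
  rw [← (Equiv.arrowCongr (Equiv.addRight k') (Equiv.refl (Fin n))).sum_comp]
  refine Finset.sum_congr rfl fun φ _ => ?_
  have e : ∀ i, (Equiv.arrowCongr (Equiv.addRight k') (Equiv.refl (Fin n))) φ i = φ (i - k') :=
    fun i => by simp [Equiv.arrowCongr, sub_eq_add_neg]
  congr 1
  · congr 1
    have h1 : extendNat ((Equiv.arrowCongr (Equiv.addRight k') (Equiv.refl (Fin n))) φ) k =
      ((Equiv.arrowCongr (Equiv.addRight k') (Equiv.refl (Fin n))) φ k') := extendNat_val _ k'
    rw [h1, e, sub_self]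
    exact (extendNat_val φ 0).symm
  · simp only [e]
    rw [← (Equiv.subRight k').prod_comp fun i => R (φ (i + 1)) (φ i)]
    refine Finset.prod_congr rfl fun i _ => ?_
    simp only [Equiv.subRight_apply]
    congr 3
    abel

/-- The cycle is cut at its closing edge, which is at most `w (ψ 0) * w (ψ j)`. What is left is a
path with a factor `w` at both ends, and it collapses to a single sum of `G * w²`: hence one
logarithm for any cycle length. -/
theorem iterSum_cycle_le {n : ℕ} {R : ℕ → ℕ → ℝ} {w G : ℕ → ℝ} {A : ℝ} (hR : ∀ x y, 0 ≤ R x y)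
    (hRw : ∀ x y, R x y ≤ w x * w y) (hw : ∀ x, 0 ≤ w x)
    (hG : ∀ x, 0 ≤ G x) (hA : 0 ≤ A)
    (hS : ∀ y, ∑ x ∈ Finset.range n, w x * R x y ≤ A * w y) {j k : ℕ} (hk : k ≤ j) :
    iterSum n (j + 1) (fun ψ => G (ψ k) * cycleProd R j ψ) ≤
      A ^ j * ∑ x ∈ Finset.range n, G x * (w x * w x) := by
  rw [iterSum_cycleProd_rotate n R G hk]
  have := iterSum_path_le (G := fun x => G x * w x) hR (fun x => mul_nonneg (hG x) (hw x)) hA hS j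
  simp only [← mul_assoc]
  refine (iterSum_mono fun ψ => ?_).trans this
  have h1 : 0 ≤ ∏ i ∈ Finset.range j, R (ψ (i + 1)) (ψ i) := Finset.prod_nonneg fun _ _ => hR _ _
  calc G (ψ 0) * cycleProd R j ψ ≤
      G (ψ 0) * ((∏ i ∈ Finset.range j, R (ψ (i + 1)) (ψ i)) * (w (ψ 0) * w (ψ j))) := by
        unfold cycleProd
        have := hRw (ψ 0) (ψ j)
        have := hG (ψ 0)
        gcongr
    _ = _ := by ring

/-- Summing out the vertices of the trees, the youngest one first. -/
theorem iterSum_tree_le {n N : ℕ} {F : (ℕ → ℕ) → ℝ} (hF0 : ∀ ψ, 0 ≤ F ψ)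
    (hF : ∀ ψ k x, N ≤ k → F (Function.update ψ k x) = F ψ) {R : ℕ → ℕ → ℕ → ℝ}
    (hR : ∀ i x y, 0 ≤ R i x y) {B : ℕ → ℝ}
    (hB : ∀ i y, ∑ x ∈ Finset.range n, R i x y ≤ B i) {p : ℕ → ℕ} (t : ℕ)
    (hp : ∀ i < t, p (N + i) < N + i) :
    iterSum n (N + t) (fun ψ => F ψ * ∏ i ∈ Finset.range t, R i (ψ (N + i)) (ψ (p (N + i)))) ≤
      (∏ i ∈ Finset.range t, B i) * iterSum n N F := by
  have hB0 : ∀ i, 0 ≤ B i := fun i =>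
    (Finset.sum_nonneg fun x _ => hR i x 0).trans (hB i 0)
  induction t with
  | zero => simp
  | succ t ih =>
    have ih' := ih fun i hi => hp i (by omega)
    rw [← add_assoc, iterSum]
    refine (iterSum_mono (G := fun ψ => B t * (F ψ *
      ∏ i ∈ Finset.range t, R i (ψ (N + i)) (ψ (p (N + i))))) fun ψ => ?_).trans ?_
    -- Parents precede their children and `F` sees only the first `N` coordinates, so the last
    -- vertex occurs in one factor only.
    · have h : ∀ x, F (Function.update ψ (N + t) x) * ∏ i ∈ Finset.range (t + 1),
          R i (Function.update ψ (N + t) x (N + i)) (Function.update ψ (N + t) x (p (N + i))) =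
          (F ψ * ∏ i ∈ Finset.range t, R i (ψ (N + i)) (ψ (p (N + i)))) *
            R t x (ψ (p (N + t))) := fun x => by
        have := hp t (by omega)
        rw [hF _ _ _ (by omega), Finset.prod_range_succ, Function.update_self,
          Function.update_of_ne (by omega), ← mul_assoc]
        rw [Finset.prod_congr rfl fun i hi => by
          have h1 := Finset.mem_range.1 hi
          have h2 := hp i (by omega)
          rw [Function.update_of_ne (by omega), Function.update_of_ne (by omega)]]
      simp only [h, ← Finset.mul_sum]
      rw [mul_comm (B t)]
      refine mul_le_mul_of_nonneg_left (hB _ _) (mul_nonneg (hF0 _) ?_)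
      exact Finset.prod_nonneg fun _ _ => hR _ _ _
    · rw [iterSum_const_mul, Finset.prod_range_succ]
      refine (mul_le_mul_of_nonneg_left ih' (hB0 t)).trans_eq ?_
      ring

/-- The product of the kernel over all edges: the cycle on `0, …, j` and, for `i < t`, the edge
between the vertex `j + 1 + i` and its parent. -/
def shapeProd (R : ℕ → ℕ → ℝ) (j t : ℕ) (p : ℕ → ℕ) (ψ : ℕ → ℕ) : ℝ :=
  cycleProd R j ψ * ∏ i ∈ Finset.range t, R (ψ (j + 1 + i)) (ψ (p (j + 1 + i)))

theorem shapeProd_nonneg {R : ℕ → ℕ → ℝ} (hR : ∀ x y, 0 ≤ R x y) (j t : ℕ) (p ψ : ℕ → ℕ) :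
    0 ≤ shapeProd R j t p ψ :=
  mul_nonneg (cycleProd_nonneg hR j ψ) (Finset.prod_nonneg fun _ _ => hR _ _)

/-! ### Total weights of a cycle with trees: unrestricted, hitting a set, pinned at a vertex -/

section Bounds

variable {n j t : ℕ} {p : ℕ → ℕ}

theorem iterSum_cycle_relKernel_le (O : Finset ℕ) {G : ℕ → ℝ} (hG : ∀ x, 0 ≤ G x) {k : ℕ}
    (hk : k ≤ j) :
    iterSum n (j + 1) (fun ψ => G (ψ k) * cycleProd (relKernel O) j ψ) ≤
      (O.card + 8 : ℝ) ^ j * ∑ x ∈ Finset.range n, G x * (relWeight O x * relWeight O x) :=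
  iterSum_cycle_le (relKernel_nonneg O) (relKernel_le_relWeight O) (relWeight_nonneg O) hG
    (by positivity) (sum_relWeight_mul_relKernel_le n O) hk

theorem iterSum_cycle_edgeKernel_le {G : ℕ → ℝ} (hG : ∀ x, 0 ≤ G x) {k : ℕ} (hk : k ≤ j) :
    iterSum n (j + 1) (fun ψ => G (ψ k) * cycleProd edgeKernel j ψ) ≤
      8 ^ j * ∑ x ∈ Finset.range n, G x * (schurWeight x * schurWeight x) :=
  iterSum_cycle_le (fun x y => (edgeKernel_pos x y).le) edgeKernel_le_schurWeight
    (fun x => (schurWeight_pos x).le) hG (by norm_num) (sum_schurWeight_mul_edgeKernel_le n) hk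

theorem card_add_logScale_le (O : Finset ℕ) : O.card + logScale n ≤ (O.card + 1) * logScale n := by
  have := one_le_logScale n
  have : (O.card : ℝ) ≤ O.card * logScale n := le_mul_of_one_le_right (by positivity) this
  linarith

/-- The total weight of the sequences hitting `O` at the position `k`. -/
theorem iterSum_hit_le (hp : ∀ i < t, p (j + 1 + i) < j + 1 + i) (O : Finset ℕ) {k : ℕ}
    (hk : k < j + 1 + t) :
    iterSum n (j + 1 + t) (fun ψ => (if ψ k ∈ O then 1 else 0) * shapeProd (relKernel O) j t p ψ) ≤
      (O.card + 8 : ℝ) ^ (j + 1) * ((O.card + 1) * logScale n) ^ t := by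
  have hL := one_le_logScale n
  have hOL := card_add_logScale_le (n := n) O
  -- For a hit on the cycle, the one free sum of `relWeight²` runs over `O` only and is at most
  -- `|O|` instead of a logarithm.
  rcases Nat.lt_or_ge k (j + 1) with hkj | hkj
  · have h := iterSum_tree_le (n := n) (N := j + 1)
      (F := fun ψ => (if ψ k ∈ O then 1 else 0) * cycleProd (relKernel O) j ψ)
      (fun ψ => mul_nonneg (by split_ifs <;> norm_num) (cycleProd_nonneg (relKernel_nonneg O) j ψ))
      (fun ψ k' x hk' => by
        rw [cycleProd_update _ (by omega), Function.update_of_ne (by omega)])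
      (R := fun _ => relKernel O) (fun _ => relKernel_nonneg O)
      (B := fun _ => O.card + logScale n) (fun _ => sum_relKernel_le n O) t hp
    have hc := iterSum_cycle_relKernel_le (n := n) (j := j) O (G := fun x => if x ∈ O then 1 else 0)
      (fun x => by split_ifs <;> norm_num) (k := k) (by omega)
    have hs : ∑ x ∈ Finset.range n, (if x ∈ O then 1 else 0) * (relWeight O x * relWeight O x) ≤
        (O.card : ℝ) := by
      refine le_trans (Finset.sum_le_sum fun x _ => ?_) ((sum_ite_mem_le n O zero_le_one).trans_eq
        (mul_one _))
      unfold relWeight; split_ifs <;> simp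
    simp only [Finset.prod_const, Finset.card_range] at h
    simp only [shapeProd, ← mul_assoc]
    refine h.trans ?_
    calc _ ≤ ((O.card + 1) * logScale n) ^ t * ((O.card + 8 : ℝ) ^ j * (O.card + 8)) := by
          refine mul_le_mul (pow_le_pow_left₀ (by positivity) hOL t)
            (hc.trans (mul_le_mul_of_nonneg_left (hs.trans (by linarith)) (by positivity)))
            (iterSum_nonneg fun ψ => mul_nonneg (by split_ifs <;> norm_num)
              (cycleProd_nonneg (relKernel_nonneg O) j ψ)) (by positivity)
      _ = _ := by ring
  · obtain ⟨i0, rfl⟩ := Nat.exists_eq_add_of_le hkj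
    have hi0 : i0 < t := by omega
    have h := iterSum_tree_le (n := n) (N := j + 1) (F := cycleProd (relKernel O) j)
      (cycleProd_nonneg (relKernel_nonneg O) j)
      (fun ψ k' x hk' => cycleProd_update _ (by omega) _ _)
      -- For a hit at the tree vertex `i0`, the indicator is put into the kernel of that vertex,
      -- whose row sums drop from a logarithm to `|O|`.
      (R := fun i x y => if i = i0 then (if x ∈ O then 1 else 0) * relKernel O x y
        else relKernel O x y)
      (fun i x y => by
        have := relKernel_nonneg O x y
        split_ifs <;> simp [this])
      (B := fun i => if i = i0 then O.card else O.card + logScale n)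
      (fun i y => by
        by_cases hi : i = i0
        · simp only [hi, if_true]
          refine le_trans (Finset.sum_le_sum fun x _ => ?_)
            ((sum_ite_mem_le n O zero_le_one).trans_eq (mul_one _))
          split_ifs
          · rw [one_mul]; exact relKernel_le_one O x y
          · simp
        · simp only [hi, if_false]; exact sum_relKernel_le n O y) t hp
    have hc := iterSum_cycle_relKernel_le (n := n) (j := j) O (G := fun x => 1)
      (fun x => zero_le_one) (k := 0) (by omega)
    simp only [one_mul] at hc
    have hprod : ∀ ψ : ℕ → ℕ, (if ψ (j + 1 + i0) ∈ O then (1 : ℝ) else 0) *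
        shapeProd (relKernel O) j t p ψ = cycleProd (relKernel O) j ψ * ∏ i ∈ Finset.range t,
        (if i = i0 then (if ψ (j + 1 + i) ∈ O then 1 else 0) *
          relKernel O (ψ (j + 1 + i)) (ψ (p (j + 1 + i)))
          else relKernel O (ψ (j + 1 + i)) (ψ (p (j + 1 + i)))) := fun ψ => by
      rw [shapeProd, mul_left_comm]
      congr 1
      rw [← Finset.mul_prod_erase _ _ (Finset.mem_range.2 hi0),
        ← Finset.mul_prod_erase _ _ (Finset.mem_range.2 hi0), if_pos rfl, mul_assoc]
      congr 2
      exact Finset.prod_congr rfl fun i hi => by rw [if_neg (Finset.ne_of_mem_erase hi)]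
    simp only [hprod]
    refine h.trans ?_
    have hB : ∏ i ∈ Finset.range t, (if i = i0 then (O.card : ℝ) else O.card + logScale n) ≤
        O.card * ((O.card + 1) * logScale n) ^ (t - 1) := by
      rw [← Finset.mul_prod_erase _ _ (Finset.mem_range.2 hi0), if_pos rfl]
      gcongr
      rw [Finset.prod_congr rfl fun i hi => if_neg (Finset.ne_of_mem_erase hi), Finset.prod_const,
        Finset.card_erase_of_mem (Finset.mem_range.2 hi0), Finset.card_range]
      gcongr
    calc _ ≤ (O.card * ((O.card + 1) * logScale n) ^ (t - 1)) *
          ((O.card + 8 : ℝ) ^ j * ((O.card + 1) * logScale n)) := by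
          refine mul_le_mul hB ?_ (iterSum_nonneg (cycleProd_nonneg (relKernel_nonneg O) j))
            (by positivity)
          refine hc.trans ?_
          gcongr
          exact (sum_relWeight_sq_le n O).trans hOL
      _ = O.card * (O.card + 8 : ℝ) ^ j * (((O.card + 1) * logScale n) ^ (t - 1 + 1)) := by ring
      _ ≤ _ := by
          rw [Nat.sub_add_cancel (by omega), pow_succ' _ j]
          gcongr
          linarith

/-- The total weight of all sequences. -/
theorem iterSum_shapeProd_le (hp : ∀ i < t, p (j + 1 + i) < j + 1 + i) :
    iterSum n (j + 1 + t) (shapeProd edgeKernel j t p) ≤ 8 ^ j * logScale n ^ (t + 1) := by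
  have h := iterSum_tree_le (n := n) (N := j + 1) (F := cycleProd edgeKernel j)
    (cycleProd_nonneg (fun x y => (edgeKernel_pos x y).le) j)
    (fun ψ k' x hk' => cycleProd_update _ (by omega) _ _)
    (R := fun _ => edgeKernel) (fun _ x y => (edgeKernel_pos x y).le)
    (B := fun _ => logScale n) (fun _ => sum_edgeKernel_le n) t hp
  have hc := iterSum_cycle_edgeKernel_le (n := n) (j := j) (G := fun x => 1)
    (fun x => zero_le_one) (k := 0) (by omega)
  simp only [one_mul, schurWeight_mul_self] at hc
  have hL := one_le_logScale n
  simp only [Finset.prod_const, Finset.card_range] at h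
  refine h.trans ?_
  calc _ ≤ logScale n ^ t * (8 ^ j * logScale n) := by
        gcongr
        refine hc.trans ?_
        gcongr
        unfold logScale; linarith
    _ = _ := by ring

theorem shapeProd_succ_update (R : ℕ → ℕ → ℝ) (hp : ∀ i < t + 1, p (j + 1 + i) < j + 1 + i)
    (ψ : ℕ → ℕ) (x : ℕ) :
    shapeProd R j (t + 1) p (Function.update ψ (j + 1 + t) x) =
      shapeProd R j t p ψ * R x (ψ (p (j + 1 + t))) := by
  have := hp t (by omega)
  rw [shapeProd, shapeProd, cycleProd_update _ (by omega), Finset.prod_range_succ,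
    Function.update_self, Function.update_of_ne (by omega), ← mul_assoc]
  rw [Finset.prod_congr rfl fun i hi => by
    have h1 := Finset.mem_range.1 hi
    have h2 := hp i (by omega)
    rw [Function.update_of_ne (by omega), Function.update_of_ne (by omega)]]

/-- An extra factor `x^(-1/2)` at any vertex saves the logarithm of the cycle. If its vertex is
summed out in a tree, the Schur test hands the factor on to the parent; once on the cycle, it turns
`∑ 1/x` into the convergent `∑ x^(-3/2)`. -/
theorem iterSum_schurWeight_mul_shapeProd_le (hp : ∀ i < t, p (j + 1 + i) < j + 1 + i) {k : ℕ}
    (hk : k < j + 1 + t) :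
    iterSum n (j + 1 + t) (fun ψ => schurWeight (ψ k) * shapeProd edgeKernel j t p ψ) ≤
      8 ^ (j + 1 + t) * logScale n ^ t := by
  have hL := one_le_logScale n
  have hK : ∀ x y, 0 ≤ edgeKernel x y := fun x y => (edgeKernel_pos x y).le
  induction t generalizing k with
  | zero =>
    have hc := iterSum_cycle_edgeKernel_le (n := n) (j := j) (G := schurWeight)
      (fun x => (schurWeight_pos x).le) (k := k) (by omega)
    simp only [shapeProd, Finset.range_zero, Finset.prod_empty, mul_one, add_zero, pow_zero]
    refine hc.trans ?_
    rw [pow_succ]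
    gcongr
    -- At `y = 0` the kernel is `schurWeight²`, so the Schur test itself bounds the sum of
    -- `schurWeight³`.
    have := sum_schurWeight_mul_edgeKernel_le n 0
    simp only [edgeKernel_zero_right] at this
    exact this.trans (by nlinarith [schurWeight_le_one 0])
  | succ t ih =>
    have hp' : ∀ i < t, p (j + 1 + i) < j + 1 + i := fun i hi => hp i (by omega)
    rw [← add_assoc, iterSum]
    simp only [shapeProd_succ_update edgeKernel hp]
    rcases (show k < j + 1 + t ∨ k = j + 1 + t by omega) with hk' | rfl
    · refine (iterSum_mono (G := fun ψ => logScale n * (schurWeight (ψ k) *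
        shapeProd edgeKernel j t p ψ)) fun ψ => ?_).trans ?_
      · have : ∀ x, schurWeight (Function.update ψ (j + 1 + t) x k) = schurWeight (ψ k) :=
          fun x => by rw [Function.update_of_ne (by omega)]
        simp only [this, ← mul_assoc, ← Finset.mul_sum]
        rw [mul_assoc, mul_comm, mul_assoc, mul_comm]
        have h0 := mul_nonneg (schurWeight_pos (ψ k)).le (shapeProd_nonneg hK j t p ψ)
        have h1 := sum_edgeKernel_le n (ψ (p (j + 1 + t)))
        nlinarith
      · rw [iterSum_const_mul]
        refine (mul_le_mul_of_nonneg_left (ih hp' hk') (by positivity)).trans ?_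
        rw [pow_succ (logScale n), pow_succ (8 : ℝ) (j + 1 + t)]
        have : 0 ≤ (8 : ℝ) ^ (j + 1 + t) * (logScale n ^ t * logScale n) := by positivity
        nlinarith
    · have hpt := hp t (by omega)
      refine (iterSum_mono (G := fun ψ => 8 * (schurWeight (ψ (p (j + 1 + t))) *
        shapeProd edgeKernel j t p ψ)) fun ψ => ?_).trans ?_
      · have : ∀ x, schurWeight (Function.update ψ (j + 1 + t) x (j + 1 + t)) *
          (shapeProd edgeKernel j t p ψ * edgeKernel x (ψ (p (j + 1 + t)))) =
          shapeProd edgeKernel j t p ψ * (schurWeight x * edgeKernel x (ψ (p (j + 1 + t)))) :=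
          fun x => by rw [Function.update_self]; ring
        simp only [this, ← Finset.mul_sum]
        have h1 := mul_le_mul_of_nonneg_left (sum_schurWeight_mul_edgeKernel_le n
          (ψ (p (j + 1 + t)))) (shapeProd_nonneg hK j t p ψ)
        linarith
      · rw [iterSum_const_mul]
        refine (mul_le_mul_of_nonneg_left (ih hp' hpt) (by positivity)).trans ?_
        rw [pow_succ (logScale n), pow_succ (8 : ℝ) (j + 1 + t)]
        have : 0 ≤ (8 : ℝ) ^ (j + 1 + t) * logScale n ^ t := by positivity
        nlinarith

/-- The total weight of the sequences with the value `z` at the position `k`. -/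
theorem logScale_mul_iterSum_pinned_le (hp : ∀ i < t, p (j + 1 + i) < j + 1 + i) (z : ℕ) {k : ℕ}
    (hk : k < j + 1 + t) :
    logScale n * iterSum n (j + 1 + t)
      (fun ψ => (if ψ k = z then 1 else 0) * shapeProd edgeKernel j t p ψ) ≤
      8 ^ (j + 1 + t) * logScale n ^ t *
        (logScale n * (schurWeight z * schurWeight z) + schurWeight z) := by
  have hL := one_le_logScale n
  have hz := schurWeight_pos z
  have hK : ∀ x y, 0 ≤ edgeKernel x y := fun x y => (edgeKernel_pos x y).le
  induction t with
  | zero =>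
    have hc := iterSum_cycle_edgeKernel_le (n := n) (j := j) (G := fun x => if x = z then 1 else 0)
      (fun x => by split_ifs <;> norm_num) (k := k) (by omega)
    have hs : ∑ x ∈ Finset.range n, (if x = z then 1 else 0) * (schurWeight x * schurWeight x) ≤
        schurWeight z * schurWeight z := by
      simp only [ite_mul, one_mul, zero_mul, Finset.sum_ite_eq']
      split_ifs
      · rfl
      · positivity
    simp only [shapeProd, Finset.range_zero, Finset.prod_empty, mul_one, add_zero, pow_zero]
    calc _ ≤ logScale n * (8 ^ j * (schurWeight z * schurWeight z)) := by
          gcongr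
          exact hc.trans (by gcongr)
      _ ≤ logScale n * (8 ^ (j + 1) * (schurWeight z * schurWeight z)) := by
          gcongr <;> norm_num
      _ ≤ _ := by
          rw [mul_left_comm]
          gcongr
          linarith
  | succ t ih =>
    have hp' : ∀ i < t, p (j + 1 + i) < j + 1 + i := fun i hi => hp i (by omega)
    rw [← add_assoc, iterSum]
    simp only [shapeProd_succ_update edgeKernel hp]
    rcases (show k < j + 1 + t ∨ k = j + 1 + t by omega) with hk' | rfl
    · have hstep : iterSum n (j + 1 + t) (fun ψ => ∑ x ∈ Finset.range n,
          (if Function.update ψ (j + 1 + t) x k = z then 1 else 0) *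
          (shapeProd edgeKernel j t p ψ * edgeKernel x (ψ (p (j + 1 + t))))) ≤
          iterSum n (j + 1 + t) (fun ψ => logScale n * ((if ψ k = z then 1 else 0) *
            shapeProd edgeKernel j t p ψ)) := iterSum_mono fun ψ => by
        have : ∀ x, Function.update ψ (j + 1 + t) x k = ψ k :=
          fun x => by rw [Function.update_of_ne (by omega)]
        simp only [this, ← mul_assoc, ← Finset.mul_sum]
        have h0 : 0 ≤ (if ψ k = z then (1 : ℝ) else 0) * shapeProd edgeKernel j t p ψ :=
          mul_nonneg (by split_ifs <;> norm_num) (shapeProd_nonneg hK j t p ψ)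
        have h1 := sum_edgeKernel_le n (ψ (p (j + 1 + t)))
        nlinarith
      rw [iterSum_const_mul] at hstep
      calc _ ≤ logScale n * (logScale n * iterSum n (j + 1 + t)
            (fun ψ => (if ψ k = z then 1 else 0) * shapeProd edgeKernel j t p ψ)) := by gcongr
        _ ≤ logScale n * (8 ^ (j + 1 + t) * logScale n ^ t *
            (logScale n * (schurWeight z * schurWeight z) + schurWeight z)) := by
            exact mul_le_mul_of_nonneg_left (ih hp' hk') (by positivity)
        _ = 8 ^ (j + 1 + t) * (logScale n ^ (t + 1) *
            (logScale n * (schurWeight z * schurWeight z) + schurWeight z)) := by ring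
        _ ≤ 8 ^ (j + 1 + t + 1) * (logScale n ^ (t + 1) *
            (logScale n * (schurWeight z * schurWeight z) + schurWeight z)) := by
            exact mul_le_mul_of_nonneg_right (pow_le_pow_right₀ (by norm_num) (by omega))
              (by positivity)
        _ = _ := by ring
    -- Pinned at the last vertex: its edge is at most `schurWeight z` times the weight of the
    -- parent, and that second factor saves a logarithm. The factor `logScale n` on the left avoids
    -- writing this saving as a quotient.
    · have hpt := hp t (by omega)
      have hstep : iterSum n (j + 1 + t) (fun ψ => ∑ x ∈ Finset.range n,
          (if Function.update ψ (j + 1 + t) x (j + 1 + t) = z then 1 else 0) *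
          (shapeProd edgeKernel j t p ψ * edgeKernel x (ψ (p (j + 1 + t))))) ≤
          iterSum n (j + 1 + t) (fun ψ => schurWeight z * (schurWeight (ψ (p (j + 1 + t))) *
            shapeProd edgeKernel j t p ψ)) := iterSum_mono fun ψ => by
        simp only [Function.update_self, ite_mul, one_mul, zero_mul, Finset.sum_ite_eq']
        have h0 := shapeProd_nonneg hK j t p ψ
        have h1 := schurWeight_pos (ψ (p (j + 1 + t)))
        split_ifs
        · have := mul_le_mul_of_nonneg_left (edgeKernel_le_schurWeight z (ψ (p (j + 1 + t)))) h0
          linarith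
        · positivity
      rw [iterSum_const_mul] at hstep
      calc _ ≤ logScale n * (schurWeight z * (8 ^ (j + 1 + t) * logScale n ^ t)) := by
            gcongr
            exact hstep.trans (mul_le_mul_of_nonneg_left
              (iterSum_schurWeight_mul_shapeProd_le hp' hpt) hz.le)
        _ = 8 ^ (j + 1 + t) * logScale n ^ (t + 1) * schurWeight z := by ring
        _ ≤ 8 ^ (j + 1 + (t + 1)) * logScale n ^ (t + 1) *
            (logScale n * (schurWeight z * schurWeight z) + schurWeight z) := by
            refine mul_le_mul (mul_le_mul_of_nonneg_right
              (pow_le_pow_right₀ (by norm_num) (by omega)) (by positivity))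
              (le_add_of_nonneg_left (by positivity)) hz.le (by positivity)

end Bounds


/-! ### Normal form of the unicyclic graph -/

/-- A parent function describing a unicyclic graph with the vertices `0, …, j + t`: the first
`j + 1` vertices form a cycle and every other vertex has a smaller parent. The edges join the
vertices to their parents. -/
structure Shape (j t : ℕ) where
  parent : Fin (j + 1 + t) → Fin (j + 1 + t)
  parent_castAdd : ∀ k : Fin (j + 1), parent (Fin.castAdd t k) = Fin.castAdd t (k - 1)
  parent_natAdd_lt : ∀ i : Fin t, parent (Fin.natAdd (j + 1) i) < Fin.natAdd (j + 1) i

theorem exists_adj_dist_lt {V : Type*} {G : SimpleGraph V} (hG : G.Connected) {r v : V}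
    (h : v ≠ r) : ∃ w, G.Adj v w ∧ G.dist r w < G.dist r v := by
  obtain ⟨p, hp⟩ := (hG v r).exists_walk_length_eq_dist
  cases p with
  | nil => exact absurd rfl h
  | @cons _ w _ hvw q =>
    refine ⟨w, hvw, ?_⟩
    rw [SimpleGraph.dist_comm, SimpleGraph.dist_comm (u := r), ← hp, SimpleGraph.Walk.length_cons]
    exact Nat.lt_succ_of_le (SimpleGraph.dist_le q)

/-- Enumerating the tree vertices by depth makes every parent precede its children. -/
theorem exists_equiv_fin_of_depth {U : Type*} [Fintype U] {t : ℕ} (hU : Fintype.card U = t)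
    (d : U → ℕ) : ∃ e : U ≃ Fin t, ∀ u u', d u < d u' → e u < e u' := by
  have e0 : U ≃ Fin t := Fintype.equivFinOfCardEq hU
  refine ⟨e0.trans (Tuple.sort (d ∘ e0.symm)).symm, fun u u' h => ?_⟩
  by_contra hle
  have := Tuple.monotone_sort (d ∘ e0.symm) (not_lt.1 hle)
  simp at this
  omega

variable {s : ℕ} {τ : Fin s → ℕ}

/-- The unicyclic graph is isomorphic to the graph of a parent function. -/
theorem exists_shape {j t : ℕ} (hτ : ∑ i, τ i = t) (T : ∀ i, RootedTree (τ i))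
    (a : Fin s → Fin (j + 1)) :
    ∃ (S : Shape j t) (e : Fin (j + 1 + t) ≃ UVertex (j + 1) T)
      (g : Fin (j + 1 + t) ≃ UEdge (j + 1) T), ∀ k, ends T a (g k) = s(e k, e (S.parent k)) := by
  classical
  have hpar : ∀ (i : Fin s) (v : {v : Fin (τ i + 1) // v ≠ (T i).root}), ∃ w,
      (T i).graph.Adj v w ∧ (T i).graph.dist (T i).root w < (T i).graph.dist (T i).root v :=
    fun i v => exists_adj_dist_lt (T i).isTree.connected v.2
  choose par hadj hdist using hpar
  have hbij : ∀ i, Function.Bijective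
      (fun v : {v : Fin (τ i + 1) // v ≠ (T i).root} =>
        (⟨s((v : Fin (τ i + 1)), par i v), hadj i v⟩ : (T i).graph.edgeSet)) := fun i => by
    rw [Fintype.bijective_iff_injective_and_card]
    constructor
    · intro v v' h
      have h' := congrArg Subtype.val h
      rcases Sym2.eq_iff.1 h' with h1 | h1
      · exact Subtype.ext h1.1
      · have d1 := hdist i v
        have d2 := hdist i v'
        rw [h1.2] at d1
        rw [← h1.1] at d2
        omega
    · have h1 := (T i).isTree.card_edgeFinset
      rw [SimpleGraph.edgeFinset_card] at h1
      simp only [Fintype.card_fin, Nat.add_right_cancel_iff] at h1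
      rw [h1, Fintype.card_subtype_compl]
      simp
  have hcard : Fintype.card (Σ i, {v : Fin (τ i + 1) // v ≠ (T i).root}) = t := by
    rw [Fintype.card_sigma, ← hτ]
    refine Finset.sum_congr rfl fun i _ => ?_
    rw [Fintype.card_subtype_compl]
    simp
  obtain ⟨eU, heU⟩ := exists_equiv_fin_of_depth hcard
    fun u => (T u.1).graph.dist (T u.1).root (u.2 : Fin (τ u.1 + 1))
  set e : Fin (j + 1 + t) ≃ UVertex (j + 1) T :=
    finSumFinEquiv.symm.trans (Equiv.sumCongr (Equiv.refl _) eU.symm) with he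
  -- The edge between the cycle vertex `k` and its parent `k - 1` is the cycle edge with number `k -
  -- 1`; hence the shift by one.
  set g : Fin (j + 1 + t) ≃ UEdge (j + 1) T :=
    finSumFinEquiv.symm.trans (Equiv.sumCongr (Equiv.subRight 1)
      (eU.symm.trans (Equiv.sigmaCongrRight fun i => Equiv.ofBijective _ (hbij i)))) with hg
  have hec : ∀ k, e (Fin.castAdd t k) = Sum.inl k := fun k => by simp [he]
  have hen : ∀ i, e (Fin.natAdd (j + 1) i) = Sum.inr (eU.symm i) := fun i => by simp [he]
  let q : UVertex (j + 1) T → UVertex (j + 1) T := Sum.elim (fun k => Sum.inl (k - 1))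
    fun u => place T a u.1 (par u.1 u.2)
  refine ⟨⟨fun k => e.symm (q (e k)), fun k => ?_, fun i => ?_⟩, e, g, fun k => ?_⟩
  · rw [hec, Equiv.symm_apply_eq, hec]
    rfl
  · rw [hen]
    simp only [q, Sum.elim_inr, place]
    split_ifs with h
    · have : e.symm (Sum.inl (a (eU.symm i).1)) = Fin.castAdd t (a (eU.symm i).1) := by
        rw [Equiv.symm_apply_eq, hec]
      rw [this, Fin.lt_def]
      simp only [Fin.val_castAdd, Fin.val_natAdd]
      omega
    · have : e.symm (Sum.inr ⟨(eU.symm i).1, par _ (eU.symm i).2, h⟩) =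
          Fin.natAdd (j + 1) (eU ⟨(eU.symm i).1, par _ (eU.symm i).2, h⟩) := by
        rw [Equiv.symm_apply_eq, hen, Equiv.symm_apply_apply]
      rw [this, Fin.lt_def]
      have h2 := heU ⟨(eU.symm i).1, par _ (eU.symm i).2, h⟩ (eU.symm i) (hdist _ _)
      rw [Equiv.apply_symm_apply] at h2
      simpa using h2
  · simp only [Equiv.apply_symm_apply]
    refine Fin.addCases (fun k => ?_) (fun i => ?_) k
    · have : g (Fin.castAdd t k) = Sum.inl (k - 1) := by simp [hg]
      rw [this, hec]
      simp only [ends, q, Sum.elim_inl]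
      rw [Sym2.eq_swap, finRotate_apply, sub_add_cancel]
    · have : g (Fin.natAdd (j + 1) i) = Sum.inr ⟨(eU.symm i).1,
          ⟨s(((eU.symm i).2 : Fin _), par _ (eU.symm i).2), hadj _ _⟩⟩ := by simp [hg]
      rw [this, hen]
      simp only [ends, q, Sum.elim_inr, Sym2.map_mk]
      congr 1
      simp only [place, dif_neg (eU.symm i).2.2]


/-! ### Copies as sets of edges -/

section Placement

variable {j t m n : ℕ}

theorem Shape.parent_ne (S : Shape j t) (hj : 1 ≤ j) (k : Fin (j + 1 + t)) : S.parent k ≠ k := by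
  refine Fin.addCases (fun k => ?_) (fun i => ?_) k
  · rw [S.parent_castAdd, Ne, Fin.castAdd_inj, sub_eq_self]
    rw [Fin.one_eq_zero_iff]
    omega
  · exact (S.parent_natAdd_lt i).ne

/-- The edge between the images of `k` and its parent, with label `b k`. -/
def Shape.edge (S : Shape j t) (φ : Fin (j + 1 + t) → Fin n) (b : Fin (j + 1 + t) → Fin m)
    (k : Fin (j + 1 + t)) : EdgeName m n :=
  (max (φ k) (φ (S.parent k)), min (φ k) (φ (S.parent k)), b k)

/-- The choice of vertices `φ` and labels `b` describes a potential copy. -/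
def Shape.IsPlacement (S : Shape j t) (φ : Fin (j + 1 + t) → Fin n)
    (b : Fin (j + 1 + t) → Fin m) : Prop :=
  Function.Injective φ ∧ Function.Injective fun k => ((S.edge φ b k).1, (S.edge φ b k).2.2)

/-- The set of edges of the copy described by `φ` and `b`. -/
def Shape.edges (S : Shape j t) (φ : Fin (j + 1 + t) → Fin n) (b : Fin (j + 1 + t) → Fin m) :
    Finset (EdgeName m n) :=
  Finset.univ.image (S.edge φ b)

open Classical in
/-- The edge sets of the potential copies. -/
def Shape.copies (S : Shape j t) (m n : ℕ) : Finset (Finset (EdgeName m n)) :=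
  (Finset.univ.filter fun x : (Fin (j + 1 + t) → Fin n) × (Fin (j + 1 + t) → Fin m) =>
    S.IsPlacement x.1 x.2).image fun x => S.edges x.1 x.2

theorem Shape.mem_copies {S : Shape j t} {A : Finset (EdgeName m n)} :
    A ∈ S.copies m n ↔ ∃ φ b, S.IsPlacement φ b ∧ S.edges φ b = A := by
  simp [Shape.copies]

/-- All edges of `A` are present in the graph determined by `ω`. -/
def Occurs (A : Finset (EdgeName m n)) (ω : Sample m n) : Prop :=
  ∀ e ∈ A, ∃ h : 0 < (e.1 : ℕ), (ω (⟨e.1, h⟩, e.2.2) : Fin n) = e.2.1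

theorem Shape.mk_edge_eq (S : Shape j t) (φ : Fin (j + 1 + t) → Fin n)
    (b : Fin (j + 1 + t) → Fin m) (k : Fin (j + 1 + t)) :
    s(φ k, φ (S.parent k)) = s((S.edge φ b k).1, (S.edge φ b k).2.1) := by
  rcases le_total (φ k) (φ (S.parent k)) with h | h
  · simp [Shape.edge, h, Sym2.eq_swap]
  · simp [Shape.edge, h]

theorem Shape.edge_lt (S : Shape j t) (hj : 1 ≤ j) {φ : Fin (j + 1 + t) → Fin n}
    (hφ : Function.Injective φ) (b : Fin (j + 1 + t) → Fin m) (k : Fin (j + 1 + t)) :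
    (S.edge φ b k).2.1 < (S.edge φ b k).1 :=
  min_lt_max.2 fun h => S.parent_ne hj k (hφ h).symm

variable {V E : Type*} {H : Graph V E} {ε : E → Sym2 V}

theorem exists_placement_of_mem_potentialCopies {S : Shape j t}
    (hV : H.vertexSet = Set.univ) (hE : H.edgeSet = Set.univ)
    (hL : ∀ e x y, H.IsLink e x y ↔ s(x, y) = ε e) (f : Fin (j + 1 + t) ≃ V)
    (g : Fin (j + 1 + t) ≃ E) (hfg : ∀ k, ε (g k) = s(f k, f (S.parent k)))
    {α : Graph (Fin n) (EdgeName m n)} (hα : α ∈ potentialCopies m n H) :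
    ∃ (φ : Fin (j + 1 + t) → Fin n) (b : Fin (j + 1 + t) → Fin m), S.IsPlacement φ b ∧
      α.vertexSet = Set.range φ ∧ α.edgeSet = (S.edges φ b : Finset (EdgeName m n)) := by
  obtain ⟨hle, ⟨F, G, hFG⟩, hslot⟩ := hα
  have hv : ∀ v, v ∈ H.vertexSet := fun v => hV ▸ Set.mem_univ v
  have he : ∀ e, e ∈ H.edgeSet := fun e => hE ▸ Set.mem_univ e
  let φ : Fin (j + 1 + t) → Fin n := fun k => F.symm ⟨f k, hv _⟩
  let η : Fin (j + 1 + t) → EdgeName m n := fun k => G.symm ⟨g k, he _⟩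
  let b : Fin (j + 1 + t) → Fin m := fun k => (η k).2.2
  -- In the complete multigraph an edge name lists the larger endpoint first, so endpoints and label
  -- determine it.
  have hη : ∀ k, η k = S.edge φ b k := fun k => by
    have h1 : α.IsLink (η k) (φ k) (φ (S.parent k)) := by
      refine (hFG _ _ _).2 ?_
      simp only [Equiv.apply_symm_apply]
      rw [hL, hfg]
    obtain ⟨hlt, hs⟩ := Graph.IsLink.mono hle h1
    have h2 : η k = ((η k).1, (η k).2.1, b k) := rfl
    rw [h2, Shape.edge]
    rcases Sym2.eq_iff.1 hs with ⟨ha, hb⟩ | ⟨ha, hb⟩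
    · rw [ha, hb, max_eq_left hlt.le, min_eq_right hlt.le]
    · rw [ha, hb, max_eq_right hlt.le, min_eq_left hlt.le]
  have hηinj : Function.Injective η := fun k k' h => by
    have := G.symm.injective (Subtype.ext h)
    exact g.injective (congrArg Subtype.val this)
  have hηrange : α.edgeSet = Set.range η := by
    ext e
    constructor
    · intro h
      refine ⟨g.symm (G ⟨e, h⟩), ?_⟩
      simp [η]
    · rintro ⟨k, rfl⟩
      exact (G.symm _).2
  refine ⟨φ, b, ⟨fun k k' h => ?_, fun k k' h => ?_⟩, ?_, ?_⟩
  · have := F.symm.injective (Subtype.ext h)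
    exact f.injective (congrArg Subtype.val this)
  · simp only [← hη, Prod.mk.injEq] at h
    exact hηinj (hslot _ (G.symm _).2 _ (G.symm _).2 h.1 h.2)
  · ext v
    constructor
    · intro h
      refine ⟨f.symm (F ⟨v, h⟩), ?_⟩
      simp [φ]
    · rintro ⟨k, rfl⟩
      exact (F.symm _).2
  · rw [hηrange, Shape.edges, Finset.coe_image, Finset.coe_univ, Set.image_univ]
    congr 1
    exact funext hη

/-- The copy described by `φ` and `b`, as a graph. -/
def Shape.copyGraph (S : Shape j t) (φ : Fin (j + 1 + t) → Fin n)
    (b : Fin (j + 1 + t) → Fin m) : Graph (Fin n) (EdgeName m n) where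
  vertexSet := Set.range φ
  IsLink e x y := ∃ k, S.edge φ b k = e ∧ s(x, y) = s(φ k, φ (S.parent k))
  edgeSet := S.edges φ b
  isLink_symm := fun _ _ => ⟨fun _ _ ⟨k, h⟩ => ⟨k, h.1, Sym2.eq_swap.trans h.2⟩⟩
  eq_or_eq_of_isLink_of_isLink := by
    rintro e x y v w ⟨k, h, hs⟩ ⟨k', h', hs'⟩
    rw [S.mk_edge_eq φ b, h] at hs
    rw [S.mk_edge_eq φ b, h', ← hs, Sym2.eq_iff] at hs'
    tauto
  edge_mem_iff_exists_isLink := fun e => by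
    simp only [Shape.edges, Finset.coe_image, Finset.coe_univ, Set.image_univ, Set.mem_range]
    exact ⟨fun ⟨k, h⟩ => ⟨_, _, k, h, rfl⟩, fun ⟨_, _, k, h, _⟩ => ⟨k, h⟩⟩
  left_mem_of_isLink := by
    rintro e x y ⟨k, _, hs⟩
    rcases Sym2.eq_iff.1 hs with h | h
    · exact ⟨k, h.1.symm⟩
    · exact ⟨_, h.1.symm⟩

theorem copyGraph_mem_potentialCopies {S : Shape j t} (hj : 1 ≤ j)
    (hV : H.vertexSet = Set.univ) (hE : H.edgeSet = Set.univ)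
    (hL : ∀ e x y, H.IsLink e x y ↔ s(x, y) = ε e) (f : Fin (j + 1 + t) ≃ V)
    (g : Fin (j + 1 + t) ≃ E) (hfg : ∀ k, ε (g k) = s(f k, f (S.parent k)))
    {φ : Fin (j + 1 + t) → Fin n} {b : Fin (j + 1 + t) → Fin m} (h : S.IsPlacement φ b) :
    S.copyGraph φ b ∈ potentialCopies m n H := by
  have hinj : Function.Injective (S.edge φ b) := fun k k' hk => h.2 (by simp only [hk])
  have hmem : ∀ e, e ∈ (S.copyGraph φ b).edgeSet ↔ ∃ k, S.edge φ b k = e := fun e => by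
    simp [Shape.copyGraph, Shape.edges]
  refine ⟨⟨Set.subset_univ _, ?_⟩, ?_, ?_⟩
  · rintro e x y ⟨k, rfl, hs⟩
    exact ⟨S.edge_lt hj h.1 b k, hs.trans (S.mk_edge_eq φ b k)⟩
  · let F : Fin (j + 1 + t) ≃ (S.copyGraph φ b).vertexSet := Equiv.ofInjective φ h.1
    let G : Fin (j + 1 + t) ≃ (S.copyGraph φ b).edgeSet :=
      Equiv.ofBijective (fun k => ⟨S.edge φ b k, (hmem _).2 ⟨k, rfl⟩⟩)
        ⟨fun k k' hk => hinj (congrArg Subtype.val hk), fun ⟨e, he⟩ => by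
          obtain ⟨k, hk⟩ := (hmem e).1 he
          exact ⟨k, Subtype.ext hk⟩⟩
    refine ⟨F.symm.trans (f.trans ((Equiv.Set.univ V).symm.trans (Equiv.setCongr hV.symm))),
      G.symm.trans (g.trans ((Equiv.Set.univ E).symm.trans (Equiv.setCongr hE.symm))), ?_⟩
    intro e x y
    obtain ⟨k, rfl⟩ := G.surjective e
    obtain ⟨x, rfl⟩ := F.surjective x
    obtain ⟨y, rfl⟩ := F.surjective y
    rw [hL]
    have e1 : ((G k : (S.copyGraph φ b).edgeSet) : EdgeName m n) = S.edge φ b k := rfl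
    have e2 : ∀ x, ((F x : (S.copyGraph φ b).vertexSet) : Fin n) = φ x := fun x => rfl
    simp only [Equiv.trans_apply, Equiv.symm_apply_apply, Equiv.setCongr_apply,
      Equiv.Set.univ_symm_apply, hfg]
    constructor
    · rintro ⟨k', hk', hs⟩
      rw [e1] at hk'
      obtain rfl := hinj hk'
      rw [e2, e2, Sym2.eq_iff] at hs
      rcases hs with hs | hs
      · rw [h.1 hs.1, h.1 hs.2]
      · rw [h.1 hs.1, h.1 hs.2, Sym2.eq_swap]
    · intro hs
      refine ⟨k, rfl, ?_⟩
      rw [e2, e2]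
      rw [Sym2.eq_iff] at hs
      rcases hs with hs | hs
      · rw [f.injective hs.1, f.injective hs.2]
      · rw [f.injective hs.1, f.injective hs.2, Sym2.eq_swap]
  · intro e he e' he' h1 h2
    obtain ⟨k, rfl⟩ := (hmem e).1 he
    obtain ⟨k', rfl⟩ := (hmem e').1 he'
    rw [h.2 (Prod.ext h1 h2)]

open Classical in
-- No vertex of a copy is isolated, so a copy is determined by its edge set. Working with edge sets
-- makes placements that differ by an automorphism count once.
theorem copyCount_eq_sum {S : Shape j t} (hj : 1 ≤ j)
    (hV : H.vertexSet = Set.univ) (hE : H.edgeSet = Set.univ)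
    (hL : ∀ e x y, H.IsLink e x y ↔ s(x, y) = ε e) (f : Fin (j + 1 + t) ≃ V)
    (g : Fin (j + 1 + t) ≃ E) (hfg : ∀ k, ε (g k) = s(f k, f (S.parent k))) (ω : Sample m n) :
    copyCount m n H ω = ∑ A ∈ S.copies m n, if Occurs A ω then 1 else 0 := by
  have hex : ∀ α ∈ potentialCopies m n H, ∃ (φ : Fin (j + 1 + t) → Fin n)
      (b : Fin (j + 1 + t) → Fin m), S.IsPlacement φ b ∧
      α.vertexSet = Set.range φ ∧ α.edgeSet = (S.edges φ b : Finset (EdgeName m n)) := fun α hα =>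
    exists_placement_of_mem_potentialCopies hV hE hL f g hfg hα
  have hverts : ∀ α ∈ potentialCopies m n H, ∀ v,
      v ∈ α.vertexSet ↔ ∃ e ∈ α.edgeSet, v = e.1 ∨ v = e.2.1 := by
    intro α hα v
    obtain ⟨φ, b, -, h1, h2⟩ := hex α hα
    rw [h1, h2]
    constructor
    · rintro ⟨k, rfl⟩
      refine ⟨S.edge φ b k, by simp [Shape.edges], ?_⟩
      have := Sym2.eq_iff.1 (S.mk_edge_eq φ b k)
      tauto
    · rintro ⟨e, he, hv⟩
      simp only [Shape.edges, Finset.coe_image, Finset.coe_univ, Set.image_univ,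
        Set.mem_range] at he
      obtain ⟨k, rfl⟩ := he
      have := Sym2.eq_iff.1 (S.mk_edge_eq φ b k)
      rcases hv with rfl | rfl
      · rcases this with h | h
        · exact ⟨_, h.1⟩
        · exact ⟨_, h.2⟩
      · rcases this with h | h
        · exact ⟨_, h.2⟩
        · exact ⟨_, h.1⟩
  have hocc : ∀ α ∈ potentialCopies m n H, ∀ A : Finset (EdgeName m n), α.edgeSet = A →
      (α ≤ attachmentGraph ω ↔ Occurs A ω) := by
    intro α hα A hA
    constructor
    · intro hle e he
      have he' : e ∈ α.edgeSet := hA ▸ he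
      obtain ⟨x, y, hxy⟩ := (α.edge_mem_iff_exists_isLink e).1 he'
      exact (Graph.IsLink.mono hle hxy).1
    · intro ho
      refine ⟨Set.subset_univ _, fun e x y hxy => ⟨ho e ?_, (Graph.IsLink.mono hα.1 hxy).2⟩⟩
      have : e ∈ α.edgeSet := (α.edge_mem_iff_exists_isLink e).2 ⟨x, y, hxy⟩
      rw [hA] at this
      exact this
  rw [copyCount, Finset.sum_boole, ← Set.ncard_coe_finset]
  congr 1
  refine Set.ncard_congr (fun α _ => (Set.toFinite α.edgeSet).toFinset) ?_ ?_ ?_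
  · rintro α ⟨hα, hle⟩
    obtain ⟨φ, b, hφ, h1, h2⟩ := hex α hα
    have h3 : (Set.toFinite α.edgeSet).toFinset = S.edges φ b := by
      ext e
      rw [Set.Finite.mem_toFinset, h2]
      exact Finset.mem_coe
    rw [h3]
    simp only [Finset.coe_filter, Set.mem_ofPred_eq]
    exact ⟨Shape.mem_copies.2 ⟨φ, b, hφ, rfl⟩, (hocc α hα _ h2).1 hle⟩
  · rintro α β ⟨hα, -⟩ ⟨hβ, -⟩ h
    have hEE : α.edgeSet = β.edgeSet := by
      ext e
      have := Finset.ext_iff.1 h e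
      simpa using this
    refine Graph.ext ?_ fun e x y => ?_
    · ext v
      rw [hverts α hα, hverts β hβ, hEE]
    · by_cases he : e ∈ α.edgeSet
      · rw [Graph.IsSubgraph.isLink_iff hα.1 he, Graph.IsSubgraph.isLink_iff hβ.1 (hEE ▸ he)]
      · rw [α.edge_mem_iff_exists_isLink] at he
        have he' : e ∉ β.edgeSet := by
          rwa [← hEE, α.edge_mem_iff_exists_isLink]
        rw [β.edge_mem_iff_exists_isLink] at he'
        push Not at he he'
        exact iff_of_false (he x y) (he' x y)
  · intro A hA
    simp only [Finset.coe_filter, Set.mem_ofPred_eq] at hA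
    obtain ⟨φ, b, hφ, rfl⟩ := Shape.mem_copies.1 hA.1
    have hmem := copyGraph_mem_potentialCopies hj hV hE hL f g hfg hφ
    refine ⟨S.copyGraph φ b, ⟨hmem, (hocc _ hmem _ rfl).2 hA.2⟩, ?_⟩
    ext e
    rw [Set.Finite.mem_toFinset]
    exact Finset.mem_coe

end Placement

open Classical in
theorem exists_shape_copyCount_eq {s j t : ℕ} {τ : Fin s → ℕ} (hj : 1 ≤ j) (hτ : ∑ i, τ i = t)
    (T : ∀ i, RootedTree (τ i)) (a : Fin s → Fin (j + 1)) :
    ∃ S : Shape j t, ∀ (m n : ℕ) (ω : Sample m n), copyCount m n (unicyclicGraph T a) ω =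
      ∑ A ∈ S.copies m n, if Occurs A ω then 1 else 0 := by
  obtain ⟨S, f, g, hfg⟩ := exists_shape hτ T a
  refine ⟨S, fun m n ω => copyCount_eq_sum (ε := ends T a) hj rfl ?_ (fun _ _ _ => Iff.rfl) f g
    hfg ω⟩
  rw [Set.eq_univ_iff_forall]
  intro e
  induction h : ends T a e with
  | _ x y => exact ⟨x, y, h.symm⟩


/-! ### Probabilities of the copies -/

section Probability

variable {m n : ℕ}

instance isProbabilityMeasure_choice (e : Slot m n) :
    IsProbabilityMeasure (uniformOn (Set.univ : Set {i : Fin n // i < e.1.1})) := by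
  have : Nonempty {i : Fin n // i < e.1.1} := ⟨⟨⟨0, lt_of_le_of_lt (Nat.zero_le _) e.1.1.2⟩, e.1.2⟩⟩
  exact isProbabilityMeasure_uniformOn Set.finite_univ Set.univ_nonempty

instance isProbabilityMeasure_law : IsProbabilityMeasure (law m n) := by
  unfold law; infer_instance

theorem integrable_law (f : Sample m n → ℝ) : Integrable f (law m n) := Integrable.of_finite

/-- The expected number of occurrences of a set of edges without two edges in the same slot. -/
def edgeWeight (A : Finset (EdgeName m n)) : ℝ := ∏ e ∈ A, ((e.1 : ℕ) : ℝ)⁻¹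

/-- The slots of the edges in `A`. -/
def slots (A : Finset (EdgeName m n)) : Finset (Slot m n) :=
  Finset.univ.filter fun s => ∃ e ∈ A, e.1 = s.1.1 ∧ e.2.2 = s.2

open Classical in
/-- The indicator function of `Occurs A`. -/
def occInd (A : Finset (EdgeName m n)) (ω : Sample m n) : ℝ := if Occurs A ω then 1 else 0

theorem inv_natCast_le_one (k : ℕ) : ((k : ℕ) : ℝ)⁻¹ ≤ 1 := by
  rcases Nat.eq_zero_or_pos k with rfl | h
  · simp
  · exact inv_le_one_of_one_le₀ (by exact_mod_cast h)

theorem edgeWeight_nonneg (A : Finset (EdgeName m n)) : 0 ≤ edgeWeight A :=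
  Finset.prod_nonneg fun _ _ => by positivity

theorem edgeWeight_le_one (A : Finset (EdgeName m n)) : edgeWeight A ≤ 1 :=
  Finset.prod_le_one (fun _ _ => by positivity) fun _ _ => inv_natCast_le_one _

theorem edgeWeight_union_mul_inter (A B : Finset (EdgeName m n)) :
    edgeWeight (A ∪ B) * edgeWeight (A ∩ B) = edgeWeight A * edgeWeight B :=
  Finset.prod_union_inter

theorem edgeWeight_mul_le (A B : Finset (EdgeName m n)) :
    edgeWeight A * edgeWeight B ≤ edgeWeight (A ∪ B) := by
  rw [← edgeWeight_union_mul_inter]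
  exact mul_le_of_le_one_right (edgeWeight_nonneg _) (edgeWeight_le_one _)

theorem edgeWeight_union (A B : Finset (EdgeName m n)) :
    edgeWeight (A ∪ B) = edgeWeight A * edgeWeight (B \ A) := by
  rw [← Finset.union_sdiff_self_eq_union]
  exact Finset.prod_union Finset.disjoint_sdiff

theorem occInd_nonneg (A : Finset (EdgeName m n)) (ω : Sample m n) : 0 ≤ occInd A ω := by
  unfold occInd; split_ifs <;> norm_num

theorem occInd_mul (A B : Finset (EdgeName m n)) (ω : Sample m n) :
    occInd A ω * occInd B ω = occInd (A ∪ B) ω := by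
  have : Occurs (A ∪ B) ω ↔ Occurs A ω ∧ Occurs B ω := by
    simp [Occurs, Finset.mem_union, or_imp, forall_and]
  unfold occInd
  by_cases h1 : Occurs A ω <;> by_cases h2 : Occurs B ω <;> simp [this, h1, h2]

theorem dependsOn_occInd (A : Finset (EdgeName m n)) :
    DependsOn (occInd A) (slots A : Set (Slot m n)) := by
  intro ω ω' h
  have : Occurs A ω ↔ Occurs A ω' := by
    unfold Occurs
    refine forall_congr' fun e => forall_congr' fun he => exists_congr fun h0 => ?_
    rw [h (⟨e.1, h0⟩, e.2.2) (by simp only [slots, Finset.coe_filter, Set.mem_ofPred_eq]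
                                 exact ⟨Finset.mem_univ _, e, he, rfl, rfl⟩)]
  by_cases h1 : Occurs A ω
  · rw [occInd, occInd, if_pos h1, if_pos (this.1 h1)]
  · rw [occInd, occInd, if_neg h1, if_neg fun h2 => h1 (this.2 h2)]

/-- The event is a product set: every slot of `A` has one prescribed value, the other slots are
free, and the slots of a vertex with value `x` choose among `x` older vertices. -/
theorem integral_occInd_eq {A : Finset (EdgeName m n)} (hA : ∀ e ∈ A, e.2.1 < e.1)
    (hinj : Set.InjOn (fun e : EdgeName m n => (e.1, e.2.2)) A) :
    ∫ ω, occInd A ω ∂law m n = edgeWeight A := by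
  classical
  set B : ∀ s : Slot m n, Set {i : Fin n // i < s.1.1} := fun s =>
    {i | ∀ e ∈ A, e.1 = s.1.1 → e.2.2 = s.2 → (i : Fin n) = e.2.1} with hB
  have hpos : ∀ e ∈ A, 0 < (e.1 : ℕ) := fun e he => lt_of_le_of_lt (Nat.zero_le _) (hA e he)
  have hocc : ∀ ω : Sample m n, Occurs A ω ↔ ω ∈ Set.pi Set.univ B := fun ω => by
    simp only [Occurs, Set.mem_pi, Set.mem_univ, true_imp_iff, hB]
    constructor
    · rintro h ⟨⟨i, hi⟩, a⟩ ⟨e1, e2, e3⟩ he rfl rfl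
      exact (h _ he).2
    · intro h e he
      exact ⟨hpos e he, h (⟨e.1, hpos e he⟩, e.2.2) e he rfl rfl⟩
  have h1 : ∫ ω, occInd A ω ∂law m n = (law m n).real (Set.pi Set.univ B) := by
    rw [← integral_indicator_one (Set.toFinite _).measurableSet]
    congr 1; ext ω
    simp only [occInd, Set.indicator, hocc, Pi.one_apply]
  rw [h1, law, measureReal_def, Measure.pi_pi, ENNReal.toReal_prod]
  have hone : ∀ s : Slot m n, s ∉ slots A → (uniformOn Set.univ (B s)).toReal = 1 := by
    intro s hs
    have : B s = Set.univ := by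
      rw [Set.eq_univ_iff_forall]
      intro i e he h1 h2
      exact absurd (Finset.mem_filter.2 ⟨Finset.mem_univ s, e, he, h1, h2⟩) hs
    rw [this, measure_univ, ENNReal.toReal_one]
  rw [← Finset.prod_subset (Finset.subset_univ (slots A)) fun s _ hs => hone s hs, edgeWeight]
  refine (Finset.prod_bij (fun e he => ((⟨e.1, hpos e he⟩, e.2.2) : Slot m n)) ?_ ?_ ?_ ?_).symm
  · intro e he
    exact Finset.mem_filter.2 ⟨Finset.mem_univ _, e, he, rfl, rfl⟩
  · intro e he e' he' h
    simp only [Prod.mk.injEq, Subtype.mk.injEq] at h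
    exact hinj he he' (Prod.ext h.1 h.2)
  · intro s hs
    obtain ⟨e, he, h1, h2⟩ := (Finset.mem_filter.1 hs).2
    exact ⟨e, he, Prod.ext (Subtype.ext h1) h2⟩
  · intro e he
    have hBe : B (⟨e.1, hpos e he⟩, e.2.2) = {⟨e.2.1, hA e he⟩} := by
      ext i
      simp only [hB, Set.mem_ofPred_eq, Set.mem_singleton_iff]
      constructor
      · intro h
        exact Subtype.ext (h e he rfl rfl)
      · rintro rfl e' he' h1 h2
        rw [hinj he' he (Prod.ext h1 h2)]
    have hcard : Fintype.card {i : Fin n // i < e.1} = e.1 := by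
      rw [Fintype.card_subtype]
      simp [Finset.filter_gt_eq_Iio]
    rw [hBe, uniformOn_univ, Measure.count_singleton, hcard]
    simp

theorem not_occurs {A : Finset (EdgeName m n)}
    (hinj : ¬ Set.InjOn (fun e : EdgeName m n => (e.1, e.2.2)) A) (ω : Sample m n) :
    occInd A ω = 0 := by
  rw [occInd, if_neg]
  intro h
  apply hinj
  rintro ⟨e1, e2, e3⟩ he ⟨e1', e2', e3'⟩ he' heq
  simp only [Prod.mk.injEq] at heq
  obtain ⟨rfl, rfl⟩ := heq
  have h1 := (h _ he).2
  have h2 := (h _ he').2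
  simp only at h1 h2
  rw [h1] at h2
  rw [h2]

/-- If two edges of `A` compete for the same slot, the event is empty. -/
theorem integral_occInd_le {A : Finset (EdgeName m n)} (hA : ∀ e ∈ A, e.2.1 < e.1) :
    ∫ ω, occInd A ω ∂law m n ≤ edgeWeight A := by
  by_cases hinj : Set.InjOn (fun e : EdgeName m n => (e.1, e.2.2)) A
  · exact (integral_occInd_eq hA hinj).le
  · simp only [not_occurs hinj, integral_zero]
    exact edgeWeight_nonneg A

/-- The centred indicator function of `Occurs A`. -/
def occCentred (A : Finset (EdgeName m n)) (ω : Sample m n) : ℝ := occInd A ω - edgeWeight A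

theorem dependsOn_occCentred (A : Finset (EdgeName m n)) :
    DependsOn (occCentred A) (slots A : Set (Slot m n)) := by
  intro ω ω' h
  unfold occCentred
  rw [dependsOn_occInd A h]

theorem abs_occCentred_le (A : Finset (EdgeName m n)) (ω : Sample m n) :
    |occCentred A ω| ≤ occInd A ω + edgeWeight A := by
  unfold occCentred
  have h1 := occInd_nonneg A ω
  have h2 := edgeWeight_nonneg A
  exact abs_le.2 ⟨by linarith, by linarith⟩

variable {A B D : Finset (EdgeName m n)}

theorem integral_abs_occCentred_le (hA : ∀ e ∈ A, e.2.1 < e.1) :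
    ∫ ω, |occCentred A ω| ∂law m n ≤ 2 * edgeWeight A := by
  calc _ ≤ ∫ ω, (occInd A ω + edgeWeight A) ∂law m n :=
        integral_mono (integrable_law _) (integrable_law _) fun ω => abs_occCentred_le A ω
    _ = ∫ ω, occInd A ω ∂law m n + edgeWeight A := by
        rw [integral_add (integrable_law _) (integrable_law _)]; simp
    _ ≤ _ := by linarith [integral_occInd_le hA]

theorem integral_occInd_union_mul_le (hA : ∀ e ∈ A, e.2.1 < e.1) (B : Finset (EdgeName m n)) :
    (∫ ω, occInd A ω ∂law m n) * edgeWeight B ≤ edgeWeight (A ∪ B) :=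
  (mul_le_mul_of_nonneg_right (integral_occInd_le hA) (edgeWeight_nonneg B)).trans
    (edgeWeight_mul_le A B)

theorem proper_union (hA : ∀ e ∈ A, e.2.1 < e.1) (hB : ∀ e ∈ B, e.2.1 < e.1) :
    ∀ e ∈ A ∪ B, e.2.1 < e.1 := fun e he =>
  (Finset.mem_union.1 he).elim (hA e) (hB e)

/-- Expanding the product of the bounds indicator plus weight gives four terms. Each has mean at
most the weight of the union, since a product of weights counts common edges twice and all factors
are at most `1`. -/
theorem integral_abs_occCentred_mul_le (hA : ∀ e ∈ A, e.2.1 < e.1) (hB : ∀ e ∈ B, e.2.1 < e.1) :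
    ∫ ω, |occCentred A ω * occCentred B ω| ∂law m n ≤ 4 * edgeWeight (A ∪ B) := by
  calc _ ≤ ∫ ω, (occInd (A ∪ B) ω + (occInd A ω * edgeWeight B + (occInd B ω * edgeWeight A +
        edgeWeight A * edgeWeight B))) ∂law m n := by
        refine integral_mono (integrable_law _) (integrable_law _) fun ω => ?_
        simp only [abs_mul]
        refine (mul_le_mul (abs_occCentred_le A ω) (abs_occCentred_le B ω) (abs_nonneg _)
          (add_nonneg (occInd_nonneg A ω) (edgeWeight_nonneg A))).trans_eq ?_
        rw [← occInd_mul]; ring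
    _ = ∫ ω, occInd (A ∪ B) ω ∂law m n + ((∫ ω, occInd A ω ∂law m n) * edgeWeight B +
        ((∫ ω, occInd B ω ∂law m n) * edgeWeight A + edgeWeight A * edgeWeight B)) := by
        rw [integral_add (integrable_law _) (integrable_law _),
          integral_add (integrable_law _) (integrable_law _),
          integral_add (integrable_law _) (integrable_law _), integral_mul_const,
          integral_mul_const]
        simp
    _ ≤ _ := by
        have h1 := integral_occInd_le (proper_union hA hB)
        have h2 := integral_occInd_union_mul_le hA B
        have h3 := integral_occInd_union_mul_le hB A
        rw [Finset.union_comm] at h3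
        have h4 := edgeWeight_mul_le A B
        linarith

theorem integral_abs_occCentred_mul_mul_le (hA : ∀ e ∈ A, e.2.1 < e.1)
    (hB : ∀ e ∈ B, e.2.1 < e.1) (hD : ∀ e ∈ D, e.2.1 < e.1) :
    ∫ ω, |occCentred A ω * occCentred B ω * occCentred D ω| ∂law m n ≤
      8 * edgeWeight (A ∪ B ∪ D) := by
  have hAB := proper_union hA hB
  have hAD := proper_union hA hD
  have hBD := proper_union hB hD
  calc _ ≤ ∫ ω, (occInd (A ∪ B ∪ D) ω + (occInd (A ∪ B) ω * edgeWeight D +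
        (occInd (A ∪ D) ω * edgeWeight B + (occInd (B ∪ D) ω * edgeWeight A +
        (occInd A ω * (edgeWeight B * edgeWeight D) + (occInd B ω * (edgeWeight A * edgeWeight D) +
        (occInd D ω * (edgeWeight A * edgeWeight B) +
          edgeWeight A * edgeWeight B * edgeWeight D))))))) ∂law m n := by
        refine integral_mono (integrable_law _) (integrable_law _) fun ω => ?_
        simp only [abs_mul]
        have hA0 := add_nonneg (occInd_nonneg A ω) (edgeWeight_nonneg A)
        have hB0 := add_nonneg (occInd_nonneg B ω) (edgeWeight_nonneg B)
        refine (mul_le_mul (mul_le_mul (abs_occCentred_le A ω) (abs_occCentred_le B ω)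
          (abs_nonneg _) hA0) (abs_occCentred_le D ω) (abs_nonneg _)
          (mul_nonneg hA0 hB0)).trans_eq ?_
        simp only [← occInd_mul]; ring
    _ = ∫ ω, occInd (A ∪ B ∪ D) ω ∂law m n + ((∫ ω, occInd (A ∪ B) ω ∂law m n) * edgeWeight D +
        ((∫ ω, occInd (A ∪ D) ω ∂law m n) * edgeWeight B +
        ((∫ ω, occInd (B ∪ D) ω ∂law m n) * edgeWeight A +
        ((∫ ω, occInd A ω ∂law m n) * (edgeWeight B * edgeWeight D) +
        ((∫ ω, occInd B ω ∂law m n) * (edgeWeight A * edgeWeight D) +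
        ((∫ ω, occInd D ω ∂law m n) * (edgeWeight A * edgeWeight B) +
          edgeWeight A * edgeWeight B * edgeWeight D)))))) := by
        simp only [integral_add (integrable_law _) (integrable_law _), integral_mul_const]
        simp
    _ ≤ _ := by
        have e1 : A ∪ D ∪ B = A ∪ B ∪ D := by
          rw [Finset.union_assoc, Finset.union_comm D B, ← Finset.union_assoc]
        have e2 : B ∪ D ∪ A = A ∪ B ∪ D := by
          rw [Finset.union_comm, Finset.union_assoc]
        have hmul : ∀ {U V V' : Finset (EdgeName m n)}, (∀ e ∈ U, e.2.1 < e.1) →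
            (∫ ω, occInd U ω ∂law m n) * (edgeWeight V * edgeWeight V') ≤
              edgeWeight (U ∪ V ∪ V') := fun {U V V'} hU => by
          rw [← mul_assoc]
          exact (mul_le_mul_of_nonneg_right (integral_occInd_union_mul_le hU V)
            (edgeWeight_nonneg V')).trans (edgeWeight_mul_le _ _)
        have h1 := integral_occInd_le (proper_union hAB hD)
        have h2 := integral_occInd_union_mul_le hAB D
        have h3 := integral_occInd_union_mul_le hAD B
        have h4 := integral_occInd_union_mul_le hBD A
        have h5 := hmul (V := B) (V' := D) hA
        have h6 := hmul (V := A) (V' := D) hB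
        have h7 := hmul (V := A) (V' := B) hD
        have h8 : edgeWeight A * edgeWeight B * edgeWeight D ≤ edgeWeight (A ∪ B ∪ D) :=
          (mul_le_mul_of_nonneg_right (edgeWeight_mul_le A B) (edgeWeight_nonneg D)).trans
            (edgeWeight_mul_le _ _)
        rw [e1] at h3
        rw [e2] at h4
        rw [Finset.union_comm B A] at h6
        rw [Finset.union_assoc, Finset.union_comm D] at h7
        linarith

theorem integral_occCentred_mul_eq (hA : ∫ ω, occInd A ω ∂law m n = edgeWeight A)
    (hB : ∫ ω, occInd B ω ∂law m n = edgeWeight B) :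
    ∫ ω, occCentred A ω * occCentred B ω ∂law m n =
      ∫ ω, occInd (A ∪ B) ω ∂law m n - edgeWeight A * edgeWeight B := by
  calc _ = ∫ ω, (occInd (A ∪ B) ω - occInd A ω * edgeWeight B - occInd B ω * edgeWeight A +
        edgeWeight A * edgeWeight B) ∂law m n := by
        congr 1; ext ω
        rw [← occInd_mul]; unfold occCentred; ring
    _ = _ := by
        rw [integral_add (integrable_law _) (integrable_law _),
          integral_sub (integrable_law _) (integrable_law _),
          integral_sub (integrable_law _) (integrable_law _), integral_mul_const,
          integral_mul_const, hA, hB]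
        simp; ring

end Probability

/-! ### Moments of the number of copies -/

section Moments

variable {j t m n : ℕ} {S : Shape j t}

theorem proper_of_mem_copies (hj : 1 ≤ j) {A : Finset (EdgeName m n)} (hA : A ∈ S.copies m n) :
    ∀ e ∈ A, e.2.1 < e.1 := by
  obtain ⟨φ, b, h, rfl⟩ := Shape.mem_copies.1 hA
  intro e he
  obtain ⟨k, -, rfl⟩ := Finset.mem_image.1 he
  exact S.edge_lt hj h.1 b k

theorem injOn_slot_of_mem_copies {A : Finset (EdgeName m n)} (hA : A ∈ S.copies m n) :
    Set.InjOn (fun e : EdgeName m n => (e.1, e.2.2)) A := by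
  obtain ⟨φ, b, h, rfl⟩ := Shape.mem_copies.1 hA
  intro e he e' he' heq
  obtain ⟨k, -, rfl⟩ := Finset.mem_image.1 (Finset.mem_coe.1 he)
  obtain ⟨k', -, rfl⟩ := Finset.mem_image.1 (Finset.mem_coe.1 he')
  rw [h.2 heq]

theorem integral_occInd_copy (hj : 1 ≤ j) {A : Finset (EdgeName m n)} (hA : A ∈ S.copies m n) :
    ∫ ω, occInd A ω ∂law m n = edgeWeight A :=
  integral_occInd_eq (proper_of_mem_copies hj hA) (injOn_slot_of_mem_copies hA)

theorem integral_occCentred_copy (hj : 1 ≤ j) {A : Finset (EdgeName m n)}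
    (hA : A ∈ S.copies m n) : ∫ ω, occCentred A ω ∂law m n = 0 := by
  unfold occCentred
  rw [integral_sub (integrable_law _) (integrable_law _), integral_occInd_copy hj hA]
  simp

/-- The expected number of copies. -/
def Shape.mean (S : Shape j t) (m n : ℕ) : ℝ := ∑ A ∈ S.copies m n, edgeWeight A

/-- The variance of the number of copies. -/
def Shape.var (S : Shape j t) (m n : ℕ) : ℝ :=
  ∫ ω, (∑ A ∈ S.copies m n, occCentred A ω) ^ 2 ∂law m n

theorem integral_sum_occInd (hj : 1 ≤ j) (S : Shape j t) :
    ∫ ω, ∑ A ∈ S.copies m n, occInd A ω ∂law m n = S.mean m n := by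
  rw [integral_finsetSum _ fun _ _ => integrable_law _, Shape.mean]
  exact Finset.sum_congr rfl fun A hA => integral_occInd_copy hj hA

theorem sum_occInd_sub_mean (S : Shape j t) (ω : Sample m n) :
    ∑ A ∈ S.copies m n, occInd A ω - S.mean m n = ∑ A ∈ S.copies m n, occCentred A ω := by
  rw [Shape.mean, ← Finset.sum_sub_distrib]; rfl

theorem variance_sum_occInd (hj : 1 ≤ j) (S : Shape j t) :
    variance (fun ω => ∑ A ∈ S.copies m n, occInd A ω) (law m n) = S.var m n := by
  rw [variance_eq_integral (measurable_of_finite _).aemeasurable, integral_sum_occInd hj,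
    Shape.var]
  simp only [sum_occInd_sub_mean]

theorem var_eq_sum (S : Shape j t) : S.var m n = ∑ A ∈ S.copies m n, ∑ B ∈ S.copies m n,
    ∫ ω, occCentred A ω * occCentred B ω ∂law m n := by
  unfold Shape.var
  simp only [sq, Finset.sum_mul_sum]
  rw [integral_finsetSum _ fun _ _ => integrable_law _]
  refine Finset.sum_congr rfl fun A _ => ?_
  rw [integral_finsetSum _ fun _ _ => integrable_law _]

theorem integral_occCentred_mul_of_disjoint (hj : 1 ≤ j) {A B : Finset (EdgeName m n)}
    (hA : A ∈ S.copies m n) (h : Disjoint (slots A) (slots B)) :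
    ∫ ω, occCentred A ω * occCentred B ω ∂law m n = 0 := by
  rw [law, integral_mul_of_dependsOn _ (dependsOn_occCentred A) (dependsOn_occCentred B) h]
  have := integral_occCentred_copy hj hA
  rw [law] at this
  rw [this, zero_mul]

end Moments


/-! ### Upper bounds for sums over copies -/

section UpperBounds

variable {j t m n : ℕ} {S : Shape j t}

/-- The endpoints of the edges in `A`. -/
def verts (A : Finset (EdgeName m n)) : Finset ℕ :=
  A.image (fun e => (e.1 : ℕ)) ∪ A.image fun e => (e.2.1 : ℕ)

theorem fst_mem_verts {A : Finset (EdgeName m n)} {e : EdgeName m n} (he : e ∈ A) :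
    (e.1 : ℕ) ∈ verts A :=
  Finset.mem_union_left _ (Finset.mem_image_of_mem _ he)

theorem verts_union (A B : Finset (EdgeName m n)) : verts (A ∪ B) = verts A ∪ verts B := by
  ext z
  simp only [verts, Finset.mem_union, Finset.mem_image]
  grind

theorem mem_verts_edges {φ : Fin (j + 1 + t) → Fin n} {b : Fin (j + 1 + t) → Fin m} {z : ℕ} :
    z ∈ verts (S.edges φ b) ↔ ∃ k, (φ k : ℕ) = z := by
  constructor
  · intro h
    simp only [verts, Finset.mem_union, Finset.mem_image, Shape.edges, Finset.mem_univ,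
      true_and, exists_exists_eq_and] at h
    rcases h with ⟨k, rfl⟩ | ⟨k, rfl⟩
    · rcases max_choice (φ k) (φ (S.parent k)) with h | h
      · exact ⟨k, by simp only [Shape.edge, h]⟩
      · exact ⟨S.parent k, by simp only [Shape.edge, h]⟩
    · rcases min_choice (φ k) (φ (S.parent k)) with h | h
      · exact ⟨k, by simp only [Shape.edge, h]⟩
      · exact ⟨S.parent k, by simp only [Shape.edge, h]⟩
  · rintro ⟨k, rfl⟩
    have hk : S.edge φ b k ∈ S.edges φ b := Finset.mem_image_of_mem _ (Finset.mem_univ k)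
    rcases Sym2.eq_iff.1 (S.mk_edge_eq φ b k) with h | h
    · rw [h.1]; exact fst_mem_verts hk
    · rw [h.1]; exact Finset.mem_union_right _ (Finset.mem_image_of_mem _ hk)

theorem parent_mem_verts {φ : Fin (j + 1 + t) → Fin n} {b : Fin (j + 1 + t) → Fin m}
    {U : Finset (EdgeName m n)} {k : Fin (j + 1 + t)} (h : S.edge φ b k ∈ U) :
    (φ k : ℕ) ∈ verts U ∧ (φ (S.parent k) : ℕ) ∈ verts U := by
  have h1 := fst_mem_verts h
  have h2 : ((S.edge φ b k).2.1 : ℕ) ∈ verts U :=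
    Finset.mem_union_right _ (Finset.mem_image_of_mem _ h)
  rcases Sym2.eq_iff.1 (S.mk_edge_eq φ b k) with h | h
  · rw [h.1, h.2]; exact ⟨h1, h2⟩
  · rw [h.1, h.2]; exact ⟨h2, h1⟩

theorem card_verts_le {A : Finset (EdgeName m n)} (hA : A ∈ S.copies m n) :
    (verts A).card ≤ j + 1 + t := by
  obtain ⟨φ, b, -, rfl⟩ := Shape.mem_copies.1 hA
  calc _ ≤ (Finset.univ.image fun k => (φ k : ℕ)).card := by
        refine Finset.card_le_card fun z hz => ?_
        obtain ⟨k, rfl⟩ := mem_verts_edges.1 hz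
        exact Finset.mem_image_of_mem _ (Finset.mem_univ k)
    _ ≤ _ := Finset.card_image_le.trans (by simp)

/-- A copy may arise from several placements; for nonnegative summands, counting all of them is
harmless. As `G` ignores the labels, these contribute the power of `m`. -/
theorem sum_copies_le (p : Finset (EdgeName m n) → Prop) [DecidablePred p] {g : Finset (EdgeName m n) → ℝ}
    (hg : ∀ A, 0 ≤ g A) {G : (Fin (j + 1 + t) → Fin n) → ℝ} (hG0 : ∀ φ, 0 ≤ G φ)
    (hG : ∀ φ b, S.IsPlacement φ b → p (S.edges φ b) → g (S.edges φ b) ≤ G φ) :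
    ∑ A ∈ S.copies m n with p A, g A ≤ (m : ℝ) ^ (j + 1 + t) * ∑ φ, G φ := by
  classical
  rw [Finset.sum_filter]
  have hg' : ∀ A, 0 ≤ if p A then g A else 0 := fun A => by split_ifs; exacts [hg A, le_rfl]
  calc _ ≤ ∑ x ∈ Finset.univ.filter (fun x : (Fin (j + 1 + t) → Fin n) ×
          (Fin (j + 1 + t) → Fin m) => S.IsPlacement x.1 x.2),
          (if p (S.edges x.1 x.2) then g (S.edges x.1 x.2) else 0) := by
        exact Finset.sum_image_le_of_nonneg fun A _ => hg' A
    _ ≤ ∑ x : (Fin (j + 1 + t) → Fin n) × (Fin (j + 1 + t) → Fin m), G x.1 := by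
        rw [Finset.sum_filter]
        refine Finset.sum_le_sum fun x _ => ?_
        split_ifs with h1 h2
        exacts [hG _ _ h1 h2, hG0 _, hG0 _]
    _ = _ := by
        rw [Fintype.sum_prod_type]
        simp only [Finset.sum_const, Finset.card_univ, Fintype.card_fun, Fintype.card_fin,
          nsmul_eq_mul, ← Finset.mul_sum]
        push_cast
        rfl

theorem parent_extend_lt (S : Shape j t) :
    ∀ i < t, extendNat S.parent (j + 1 + i) < j + 1 + i := fun i hi => by
  have h := S.parent_natAdd_lt ⟨i, hi⟩
  rw [Fin.lt_def, ← extendNat_val S.parent] at h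
  exact h

theorem prod_eq_shapeProd (S : Shape j t) (R : ℕ → ℕ → ℝ) (φ : Fin (j + 1 + t) → Fin n) :
    ∏ k, R (φ k) (φ (S.parent k)) = shapeProd R j t (extendNat S.parent) (extendNat φ) := by
  rw [Fin.prod_univ_add, shapeProd, cycleProd, Fin.prod_univ_succ, mul_comm (R _ _)]
  have h0 : (0 : Fin (j + 1)) - 1 = Fin.last j := by
    rw [sub_eq_iff_eq_add, Fin.last_add_one]
  have hs : ∀ i : Fin j, i.succ - 1 = i.castSucc := fun i => by
    rw [sub_eq_iff_eq_add, Fin.coeSucc_eq_succ]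
  congr 1
  · congr 1
    · rw [← Fin.prod_univ_eq_prod_range
        fun i => R (extendNat φ (i + 1)) (extendNat φ i)]
      refine Finset.prod_congr rfl fun i _ => ?_
      rw [S.parent_castAdd, hs, ← extendNat_val φ, ← extendNat_val φ]
      rfl
    · rw [S.parent_castAdd, h0, ← extendNat_val φ, ← extendNat_val φ]
      rfl
  · rw [← Fin.prod_univ_eq_prod_range
      fun i => R (extendNat φ (j + 1 + i)) (extendNat φ (extendNat S.parent (j + 1 + i)))]
    refine Finset.prod_congr rfl fun i _ => ?_
    have e1 : (φ (Fin.natAdd (j + 1) i) : ℕ) = extendNat φ (j + 1 + i) := by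
      rw [← extendNat_val φ]; rfl
    have e2 : (φ (S.parent (Fin.natAdd (j + 1) i)) : ℕ) =
        extendNat φ (extendNat S.parent (j + 1 + i)) := by
      rw [← extendNat_val φ, ← extendNat_val S.parent]; rfl
    rw [e1, e2]

theorem inv_edge_eq_edgeKernel (hj : 1 ≤ j) {φ : Fin (j + 1 + t) → Fin n}
    (hφ : Function.Injective φ) (b : Fin (j + 1 + t) → Fin m) (k : Fin (j + 1 + t)) :
    (((S.edge φ b k).1 : ℕ) : ℝ)⁻¹ = edgeKernel (φ k) (φ (S.parent k)) := by
  have h := S.edge_lt hj hφ b k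
  have h1 : 1 ≤ ((S.edge φ b k).1 : ℕ) := Nat.one_le_of_lt h
  have h2 : ((S.edge φ b k).1 : ℕ) = max (φ k : ℕ) (φ (S.parent k)) := by
    simp only [Shape.edge]
    exact (Fin.val_strictMono.monotone.map_max)
  rw [edgeKernel, ← h2, max_eq_left h1]

/-- An edge that belongs to `U` has both endpoints in `verts U`, where the relative kernel is `1`,
so omitting it from the weight is accounted for. -/
theorem edgeWeight_sdiff_le (hj : 1 ≤ j) {φ : Fin (j + 1 + t) → Fin n}
    {b : Fin (j + 1 + t) → Fin m} (h : S.IsPlacement φ b) (U : Finset (EdgeName m n)) :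
    edgeWeight (S.edges φ b \ U) ≤
      shapeProd (relKernel (verts U)) j t (extendNat S.parent) (extendNat φ) := by
  classical
  have hinj : Function.Injective (S.edge φ b) := fun k k' hk => h.2 (by simp only [hk])
  rw [← prod_eq_shapeProd, edgeWeight]
  have : S.edges φ b \ U = (Finset.univ.filter fun k => S.edge φ b k ∉ U).image (S.edge φ b) := by
    ext e
    simp only [Shape.edges, Finset.mem_sdiff, Finset.mem_image, Finset.mem_univ, true_and,
      Finset.mem_filter]
    grind
  rw [this, Finset.prod_image hinj.injOn, Finset.prod_filter]
  refine Finset.prod_le_prod (fun k _ => by split_ifs <;> positivity) fun k _ => ?_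
  rw [inv_edge_eq_edgeKernel hj h.1]
  split_ifs with hk
  · rw [relKernel, if_pos (parent_mem_verts hk)]
  · unfold relKernel
    split_ifs
    · exact edgeKernel_le_one _ _
    · rfl

theorem edgeWeight_edges_le (hj : 1 ≤ j) {φ : Fin (j + 1 + t) → Fin n}
    {b : Fin (j + 1 + t) → Fin m} (h : S.IsPlacement φ b) :
    edgeWeight (S.edges φ b) ≤
      shapeProd edgeKernel j t (extendNat S.parent) (extendNat φ) := by
  have := edgeWeight_sdiff_le hj h ∅
  have e : relKernel (verts (∅ : Finset (EdgeName m n))) = edgeKernel := by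
    funext x y; exact relKernel_empty x y
  rwa [Finset.sdiff_empty, e] at this

/-- The constant in the bound for the weight of the copies meeting given copies. -/
def meetConst (j t m : ℕ) : ℝ :=
  (m : ℝ) ^ (j + 1 + t) * ((j + 1 + t : ℕ) * ((2 * (j + 1 + t : ℕ) + 8) ^ (j + 1) *
    (2 * (j + 1 + t : ℕ) + 1) ^ t))

/-- The constant in the bound for the expected number of copies. -/
def meanConst (j t m : ℕ) : ℝ := (m : ℝ) ^ (j + 1 + t) * 8 ^ j

/-- The constant in the bound for the expected number of copies containing a given vertex. -/
def vertexConst (j t m : ℕ) : ℝ :=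
  (m : ℝ) ^ (j + 1 + t) * ((j + 1 + t : ℕ) * 8 ^ (j + 1 + t))

theorem meetConst_nonneg (j t m : ℕ) : 0 ≤ meetConst j t m := by unfold meetConst; positivity

theorem meanConst_nonneg (j t m : ℕ) : 0 ≤ meanConst j t m := by unfold meanConst; positivity

theorem mean_le (hj : 1 ≤ j) (S : Shape j t) (m n : ℕ) :
    S.mean m n ≤ meanConst j t m * logScale n ^ (t + 1) := by
  classical
  have h := sum_copies_le (S := S) (m := m) (n := n) (fun _ => True) (g := edgeWeight)
    edgeWeight_nonneg
    (G := fun φ => shapeProd edgeKernel j t (extendNat S.parent) (extendNat φ))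
    (fun φ => shapeProd_nonneg (fun x y => (edgeKernel_pos x y).le) _ _ _ _)
    (fun φ b hφ _ => edgeWeight_edges_le hj hφ)
  rw [← iterSum_eq_sum n (j + 1 + t)] at h
  simp only [Finset.filter_true] at h
  refine h.trans ?_
  rw [meanConst, mul_assoc]
  exact mul_le_mul_of_nonneg_left (iterSum_shapeProd_le (parent_extend_lt S)) (by positivity)

theorem one_le_sum_ite_of_mem {φ : Fin (j + 1 + t) → Fin n} {q : ℕ → Prop} [DecidablePred q]
    (h : ∃ k, q (φ k)) :
    (1 : ℝ) ≤ ∑ k ∈ Finset.range (j + 1 + t), if q (extendNat φ k) then 1 else 0 := by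
  obtain ⟨k, hk⟩ := h
  refine le_trans ?_ (Finset.single_le_sum (f := fun k => if q (extendNat φ k) then (1 : ℝ) else 0)
    (fun i _ => by split_ifs <;> norm_num) (Finset.mem_range.2 k.2))
  rw [extendNat_val, if_pos hk]

/-- Union bound over the position at which `D` meets `U`. The hypothesis on the size lets `U` be a
union of two copies, as the triples require. -/
theorem sum_meeting_le (hj : 1 ≤ j) (S : Shape j t) {U : Finset (EdgeName m n)}
    (hU : (verts U).card ≤ 2 * (j + 1 + t)) :
    ∑ D ∈ S.copies m n with ¬ Disjoint (verts U) (verts D), edgeWeight (D \ U) ≤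
      meetConst j t m * logScale n ^ t := by
  have hK := relKernel_nonneg (verts U)
  have h := sum_copies_le (S := S) (m := m) (n := n) (fun D => ¬ Disjoint (verts U) (verts D))
    (g := fun D => edgeWeight (D \ U)) (fun _ => edgeWeight_nonneg _)
    (G := fun φ => ∑ k ∈ Finset.range (j + 1 + t), (if extendNat φ k ∈ verts U then 1 else 0) *
      shapeProd (relKernel (verts U)) j t (extendNat S.parent) (extendNat φ))
    (fun φ => Finset.sum_nonneg fun k _ => mul_nonneg (by split_ifs <;> norm_num)
      (shapeProd_nonneg hK _ _ _ _))
    (fun φ b hφ hd => by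
      rw [← Finset.sum_mul]
      refine (edgeWeight_sdiff_le hj hφ U).trans (le_mul_of_one_le_left
        (shapeProd_nonneg hK _ _ _ _) (one_le_sum_ite_of_mem (q := fun x => x ∈ verts U) ?_))
      obtain ⟨z, hz, hz'⟩ := Finset.not_disjoint_iff.1 hd
      obtain ⟨k, rfl⟩ := mem_verts_edges.1 hz'
      exact ⟨k, hz⟩)
  refine h.trans ?_
  rw [Finset.sum_comm, meetConst, mul_assoc]
  refine mul_le_mul_of_nonneg_left ?_ (by positivity)
  have hL := one_le_logScale n
  have hU' : ((verts U).card : ℝ) ≤ 2 * (j + 1 + t : ℕ) := by exact_mod_cast hU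
  calc _ ≤ ∑ k ∈ Finset.range (j + 1 + t), ((2 * (j + 1 + t : ℕ) + 8 : ℝ) ^ (j + 1) *
        ((2 * (j + 1 + t : ℕ) + 1) * logScale n) ^ t) := by
        refine Finset.sum_le_sum fun k hk => ?_
        rw [← iterSum_eq_sum n (j + 1 + t) fun ψ => (if ψ k ∈ verts U then 1 else 0) *
          shapeProd (relKernel (verts U)) j t (extendNat S.parent) ψ]
        refine (iterSum_hit_le (parent_extend_lt S) _ (Finset.mem_range.1 hk)).trans ?_
        gcongr
    _ = _ := by
        rw [Finset.sum_const, Finset.card_range, nsmul_eq_mul, mul_pow]; ring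

theorem sum_containing_le (hj : 1 ≤ j) (S : Shape j t) (m n z : ℕ) :
    logScale n * ∑ A ∈ S.copies m n with z ∈ verts A, edgeWeight A ≤
      vertexConst j t m * logScale n ^ t *
        (logScale n * (schurWeight z * schurWeight z) + schurWeight z) := by
  have hK : ∀ x y, 0 ≤ edgeKernel x y := fun x y => (edgeKernel_pos x y).le
  have h := sum_copies_le (S := S) (m := m) (n := n) (fun A => z ∈ verts A)
    (g := edgeWeight) edgeWeight_nonneg
    (G := fun φ => ∑ k ∈ Finset.range (j + 1 + t), (if extendNat φ k = z then 1 else 0) *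
      shapeProd edgeKernel j t (extendNat S.parent) (extendNat φ))
    (fun φ => Finset.sum_nonneg fun k _ => mul_nonneg (by split_ifs <;> norm_num)
      (shapeProd_nonneg hK _ _ _ _))
    (fun φ b hφ hd => by
      rw [← Finset.sum_mul]
      exact (edgeWeight_edges_le hj hφ).trans (le_mul_of_one_le_left
        (shapeProd_nonneg hK _ _ _ _) (one_le_sum_ite_of_mem (q := fun x => x = z) (mem_verts_edges.1 hd))))
  have hL := one_le_logScale n
  refine (mul_le_mul_of_nonneg_left h (by positivity)).trans ?_
  rw [Finset.sum_comm, vertexConst, mul_left_comm]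
  simp only [mul_assoc]
  refine mul_le_mul_of_nonneg_left ?_ (by positivity)
  rw [Finset.mul_sum]
  calc _ ≤ ∑ k ∈ Finset.range (j + 1 + t), (8 ^ (j + 1 + t) * logScale n ^ t *
        (logScale n * (schurWeight z * schurWeight z) + schurWeight z)) := by
        refine Finset.sum_le_sum fun k hk => ?_
        rw [← iterSum_eq_sum n (j + 1 + t) fun ψ => (if ψ k = z then 1 else 0) *
          shapeProd edgeKernel j t (extendNat S.parent) ψ]
        exact logScale_mul_iterSum_pinned_le (parent_extend_lt S) z (Finset.mem_range.1 hk)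
    _ = _ := by
        rw [Finset.sum_const, Finset.card_range, nsmul_eq_mul]; ring

theorem not_disjoint_verts {A B : Finset (EdgeName m n)} (h : ¬ Disjoint (slots A) (slots B)) :
    ¬ Disjoint (verts A) (verts B) := by
  obtain ⟨s, hA, hB⟩ := Finset.not_disjoint_iff.1 h
  obtain ⟨e, he, h1, -⟩ := (Finset.mem_filter.1 hA).2
  obtain ⟨e', he', h1', -⟩ := (Finset.mem_filter.1 hB).2
  refine Finset.not_disjoint_iff.2 ⟨e.1, fst_mem_verts he, ?_⟩
  rw [h1, ← h1']
  exact fst_mem_verts he'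

theorem slots_union (A B : Finset (EdgeName m n)) : slots (A ∪ B) = slots A ∪ slots B := by
  ext s
  simp only [slots, Finset.mem_union, Finset.mem_filter, Finset.mem_univ, true_and]
  grind

/-- Only the edges of `D` outside `U` cost anything new, and a common slot gives a common vertex. -/
theorem sum_dependent_edgeWeight_le (hj : 1 ≤ j) (S : Shape j t) {U : Finset (EdgeName m n)}
    (hU : (verts U).card ≤ 2 * (j + 1 + t)) :
    ∑ D ∈ S.copies m n with ¬ Disjoint (slots U) (slots D), edgeWeight (U ∪ D) ≤
      edgeWeight U * (meetConst j t m * logScale n ^ t) := by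
  classical
  simp only [edgeWeight_union, ← Finset.mul_sum]
  refine mul_le_mul_of_nonneg_left (le_trans ?_ (sum_meeting_le hj S hU)) (edgeWeight_nonneg U)
  refine Finset.sum_le_sum_of_subset_of_nonneg (fun D hD => ?_) fun _ _ _ => edgeWeight_nonneg _
  rw [Finset.mem_filter] at hD ⊢
  exact ⟨hD.1, not_disjoint_verts hD.2⟩

theorem sum_pairs_le (hj : 1 ≤ j) (S : Shape j t) (m n : ℕ) :
    ∑ A ∈ S.copies m n, ∑ B ∈ S.copies m n with ¬ Disjoint (slots A) (slots B),
      edgeWeight (A ∪ B) ≤ meanConst j t m * meetConst j t m * logScale n ^ (2 * t + 1) := by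
  have hL := one_le_logScale n
  calc _ ≤ ∑ A ∈ S.copies m n, edgeWeight A * (meetConst j t m * logScale n ^ t) :=
        Finset.sum_le_sum fun A hA => sum_dependent_edgeWeight_le hj S
          ((card_verts_le hA).trans (by omega))
    _ = S.mean m n * (meetConst j t m * logScale n ^ t) := by rw [← Finset.sum_mul]; rfl
    _ ≤ (meanConst j t m * logScale n ^ (t + 1)) * (meetConst j t m * logScale n ^ t) :=
        mul_le_mul_of_nonneg_right (mean_le hj S m n)
          (mul_nonneg (meetConst_nonneg j t m) (by positivity))
    _ = _ := by ring

theorem sum_triples_le (hj : 1 ≤ j) (S : Shape j t) (m n : ℕ) :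
    ∑ A ∈ S.copies m n, ∑ B ∈ S.copies m n with ¬ Disjoint (slots A) (slots B),
      ∑ D ∈ S.copies m n with ¬ Disjoint (slots A ∪ slots B) (slots D), edgeWeight (A ∪ B ∪ D) ≤
      meanConst j t m * meetConst j t m ^ 2 * logScale n ^ (3 * t + 1) := by
  have hL := one_le_logScale n
  have h0 : 0 ≤ meetConst j t m * logScale n ^ t :=
    mul_nonneg (meetConst_nonneg j t m) (by positivity)
  calc _ ≤ ∑ A ∈ S.copies m n, ∑ B ∈ S.copies m n with ¬ Disjoint (slots A) (slots B),
        edgeWeight (A ∪ B) * (meetConst j t m * logScale n ^ t) := by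
        refine Finset.sum_le_sum fun A hA => Finset.sum_le_sum fun B hB => ?_
        rw [← slots_union]
        refine sum_dependent_edgeWeight_le hj S ?_
        rw [verts_union]
        refine (Finset.card_union_le _ _).trans ?_
        have h1 := card_verts_le hA
        have h2 := card_verts_le (Finset.mem_filter.1 hB).1
        omega
    _ = (∑ A ∈ S.copies m n, ∑ B ∈ S.copies m n with ¬ Disjoint (slots A) (slots B),
        edgeWeight (A ∪ B)) * (meetConst j t m * logScale n ^ t) := by
        simp only [Finset.sum_mul]
    _ ≤ (meanConst j t m * meetConst j t m * logScale n ^ (2 * t + 1)) *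
        (meetConst j t m * logScale n ^ t) :=
        mul_le_mul_of_nonneg_right (sum_pairs_le hj S m n) h0
    _ = _ := by ring

theorem var_le (hj : 1 ≤ j) (S : Shape j t) (m n : ℕ) :
    S.var m n ≤ 4 * (meanConst j t m * meetConst j t m) * logScale n ^ (2 * t + 1) := by
  rw [var_eq_sum, mul_assoc]
  refine le_trans ?_ (mul_le_mul_of_nonneg_left (sum_pairs_le hj S m n) (by norm_num))
  rw [Finset.mul_sum]
  refine Finset.sum_le_sum fun A hA => ?_
  rw [Finset.mul_sum, Finset.sum_filter]
  refine Finset.sum_le_sum fun B hB => ?_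
  split_ifs with h
  · exact (integral_occCentred_mul_of_disjoint hj hA h).le
  · exact (le_abs_self _).trans (abs_integral_le_integral_abs.trans
      (integral_abs_occCentred_mul_le (proper_of_mem_copies hj hA) (proper_of_mem_copies hj hB)))

/-- Two sets of edges contain different edges in the same slot. -/
def Conflict (A B : Finset (EdgeName m n)) : Prop :=
  ¬ Set.InjOn (fun e : EdgeName m n => (e.1, e.2.2)) (A ∪ B : Finset (EdgeName m n))

theorem exists_mem_verts_of_conflict {A B : Finset (EdgeName m n)} (hA : A ∈ S.copies m n)
    (hB : B ∈ S.copies m n) (h : Conflict A B) : ∃ z < n, z ∈ verts A ∧ z ∈ verts B := by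
  by_contra hne
  push Not at hne
  refine h fun e he e' he' heq => ?_
  have h1 : e.1 = e'.1 := (Prod.ext_iff.1 heq).1
  rcases Finset.mem_union.1 (Finset.mem_coe.1 he) with he | he <;>
    rcases Finset.mem_union.1 (Finset.mem_coe.1 he') with he' | he'
  · exact injOn_slot_of_mem_copies hA he he' heq
  · exact absurd (h1 ▸ fst_mem_verts he') (hne _ e.1.2 (fst_mem_verts he))
  · exact absurd (h1 ▸ fst_mem_verts he) (hne _ e'.1.2 (fst_mem_verts he'))
  · exact injOn_slot_of_mem_copies hB he he' heq

open Classical in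
-- Conflicting copies share a vertex, so the sum is at most `∑ ρ z ^ 2`, with `ρ z` the weight of
-- the copies through `z`. With `L = logScale n`, `sum_containing_le` makes `ρ z` of order `L^t (1/z
-- + z^(-1/2) / L)`. The square of this bracket is at most `2 z^(-3/2) + 2 / (z L²)`, and the sum
-- over `z` is at most `2 * 8 + 2 = 18`.
theorem sum_conflict_le (hj : 1 ≤ j) (S : Shape j t) (m n : ℕ) :
    ∑ A ∈ S.copies m n, ∑ B ∈ S.copies m n with Conflict A B, edgeWeight A * edgeWeight B ≤
      18 * vertexConst j t m ^ 2 * logScale n ^ (2 * t) := by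
  have hL := one_le_logScale n
  set ρ : ℕ → ℝ := fun z => ∑ A ∈ S.copies m n with z ∈ verts A, edgeWeight A with hρ
  have hρ0 : ∀ z, 0 ≤ ρ z := fun z => Finset.sum_nonneg fun _ _ => edgeWeight_nonneg _
  have h1 : ∑ A ∈ S.copies m n, ∑ B ∈ S.copies m n with Conflict A B,
      edgeWeight A * edgeWeight B ≤ ∑ z ∈ Finset.range n, ρ z ^ 2 := by
    have e : ∀ z, ρ z ^ 2 = ∑ A ∈ S.copies m n, ∑ B ∈ S.copies m n,
        if z ∈ verts A ∧ z ∈ verts B then edgeWeight A * edgeWeight B else 0 := fun z => by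
      rw [sq, hρ]
      simp only [Finset.sum_filter, Finset.sum_mul_sum]
      refine Finset.sum_congr rfl fun A _ => Finset.sum_congr rfl fun B _ => ?_
      by_cases hA : z ∈ verts A <;> by_cases hB : z ∈ verts B <;> simp [hA, hB]
    simp only [e]
    rw [Finset.sum_comm]
    refine Finset.sum_le_sum fun A hA => ?_
    rw [Finset.sum_comm, Finset.sum_filter]
    refine Finset.sum_le_sum fun B hB => ?_
    have hw := mul_nonneg (edgeWeight_nonneg A) (edgeWeight_nonneg B)
    have hnn : ∀ z ∈ Finset.range n, 0 ≤
        if z ∈ verts A ∧ z ∈ verts B then edgeWeight A * edgeWeight B else 0 :=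
      fun z _ => by split_ifs; exacts [hw, le_rfl]
    split_ifs with hc
    · obtain ⟨z, hz, hzA, hzB⟩ := exists_mem_verts_of_conflict hA hB hc
      refine le_trans ?_ (Finset.single_le_sum hnn (Finset.mem_range.2 hz))
      rw [if_pos ⟨hzA, hzB⟩]
    · exact Finset.sum_nonneg hnn
  have h2 : ∀ z, (logScale n * ρ z) ^ 2 ≤ vertexConst j t m ^ 2 * logScale n ^ (2 * t) *
      (2 * logScale n ^ 2 * (schurWeight z * (schurWeight z * schurWeight z)) +
        2 * ((max z 1 : ℕ) : ℝ)⁻¹) := fun z => by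
    have h := sum_containing_le hj S m n z
    have hs := schurWeight_pos z
    have hs1 := schurWeight_le_one z
    have hsq : (logScale n * (schurWeight z * schurWeight z) + schurWeight z) ^ 2 ≤
        2 * logScale n ^ 2 * (schurWeight z * (schurWeight z * schurWeight z)) +
        2 * (schurWeight z * schurWeight z) := by
      have e1 : (schurWeight z * schurWeight z) ^ 2 ≤
          schurWeight z * (schurWeight z * schurWeight z) := by
        have : 0 ≤ schurWeight z * (schurWeight z * schurWeight z) := by positivity
        nlinarith
      have e2 : 0 ≤ logScale n ^ 2 := by positivity
      nlinarith [sq_nonneg (logScale n * (schurWeight z * schurWeight z) - schurWeight z)]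
    calc _ ≤ (vertexConst j t m * logScale n ^ t *
        (logScale n * (schurWeight z * schurWeight z) + schurWeight z)) ^ 2 :=
          pow_le_pow_left₀ (mul_nonneg (by positivity) (hρ0 z)) h 2
      _ = vertexConst j t m ^ 2 * logScale n ^ (2 * t) *
        (logScale n * (schurWeight z * schurWeight z) + schurWeight z) ^ 2 := by ring
      _ ≤ _ := by
        rw [← schurWeight_mul_self]
        exact mul_le_mul_of_nonneg_left hsq (by positivity)
  have h3 : logScale n ^ 2 * ∑ z ∈ Finset.range n, ρ z ^ 2 ≤
      vertexConst j t m ^ 2 * logScale n ^ (2 * t) * (18 * logScale n ^ 2) := by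
    rw [Finset.mul_sum]
    simp only [← mul_pow]
    refine (Finset.sum_le_sum fun z _ => h2 z).trans ?_
    rw [← Finset.mul_sum]
    refine mul_le_mul_of_nonneg_left ?_ (by positivity)
    rw [Finset.sum_add_distrib, ← Finset.mul_sum, ← Finset.mul_sum]
    have b1 : ∑ z ∈ Finset.range n, schurWeight z * (schurWeight z * schurWeight z) ≤ 8 := by
      have := sum_schurWeight_mul_edgeKernel_le n 0
      simp only [edgeKernel_zero_right] at this
      linarith [schurWeight_le_one 0]
    have b2 : ∑ z ∈ Finset.range n, ((max z 1 : ℕ) : ℝ)⁻¹ ≤ logScale n ^ 2 := by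
      have : ∑ z ∈ Finset.range n, ((max z 1 : ℕ) : ℝ)⁻¹ ≤ logScale n := by
        unfold logScale; linarith
      nlinarith
    nlinarith [sq_nonneg (logScale n)]
  have h4 : ∑ z ∈ Finset.range n, ρ z ^ 2 ≤ 18 * vertexConst j t m ^ 2 * logScale n ^ (2 * t) := by
    have : 0 < logScale n ^ 2 := by positivity
    refine le_of_mul_le_mul_left ?_ this
    linarith
  exact h1.trans h4

end UpperBounds


/-! ### Lower bounds -/

/-! ### Increasing vertex sequences in windows at geometric scales -/

section Windows

/-- The left end of the window of the `k`th vertex. -/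
def windowLo (j R q k : ℕ) : ℕ := if k < j + 1 then k * (j + 1) ^ (q + 1) else R ^ (k - j)

/-- The right end of the window of the `k`th vertex. -/
def windowHi (j R q k : ℕ) : ℕ :=
  if k < j + 1 then (k + 1) * (j + 1) ^ (q + 1) else R ^ (k - j + 1)

/-- The sequences whose members lie in consecutive windows. -/
def windowSeqs (j R q N n : ℕ) : Finset (Fin N → Fin n) :=
  Fintype.piFinset fun k => Finset.univ.filter fun x : Fin n =>
    windowLo j R q k ≤ x ∧ (x : ℕ) < windowHi j R q k

/-- The contribution of the `k`th vertex of an increasing sequence to the weight of a copy. -/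
def vertexWeight (j k x : ℕ) : ℝ :=
  if k = 0 then 1 else if k = j then ((x : ℝ)⁻¹) ^ 2 else (x : ℝ)⁻¹

variable {j R Q N n : ℕ}

/-- The cycle windows at a scale `q < Q` end at `(j + 1)^(q + 2) ≤ (j + 1)^(Q + 1) ≤ R`, and the
tree windows start at `R`. -/
theorem windowHi_le_windowLo (hR : (j + 1) ^ (Q + 1) ≤ R) {q : ℕ} (hq : q < Q) {a b : ℕ}
    (h : a < b) : windowHi j R q a ≤ windowLo j R q b := by
  have hR1 : 1 ≤ R := (Nat.one_le_pow _ _ (Nat.succ_pos j)).trans hR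
  unfold windowHi windowLo
  split_ifs with h1 h2 h2
  · exact Nat.mul_le_mul_right _ h
  · calc (a + 1) * (j + 1) ^ (q + 1) ≤ (j + 1) * (j + 1) ^ (q + 1) := Nat.mul_le_mul_right _ h1
      _ = (j + 1) ^ (q + 2) := by ring
      _ ≤ (j + 1) ^ (Q + 1) := Nat.pow_le_pow_right (Nat.succ_pos j) (by omega)
      _ ≤ R ^ 1 := by simpa using hR
      _ ≤ R ^ (b - j) := Nat.pow_le_pow_right hR1 (by omega)
  · omega
  · exact Nat.pow_le_pow_right hR1 (by omega)

theorem windowHi_le (hR : (j + 1) ^ (Q + 1) ≤ R) (hn : R ^ (N - j) ≤ n) (hN : j + 1 ≤ N) {q : ℕ}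
    (hq : q < Q) {k : ℕ} (hk : k < N) : windowHi j R q k ≤ n := by
  have hR1 : 1 ≤ R := (Nat.one_le_pow _ _ (Nat.succ_pos j)).trans hR
  refine le_trans ?_ hn
  refine (windowHi_le_windowLo hR hq hk).trans ?_
  unfold windowLo
  rw [if_neg (by omega)]

theorem strictMono_of_mem_windowSeqs (hR : (j + 1) ^ (Q + 1) ≤ R) {q : ℕ} (hq : q < Q)
    {φ : Fin N → Fin n} (hφ : φ ∈ windowSeqs j R q N n) : StrictMono φ := by
  intro a b hab
  rw [windowSeqs, Fintype.mem_piFinset] at hφ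
  have ha := (Finset.mem_filter.1 (hφ a)).2.2
  have hb := (Finset.mem_filter.1 (hφ b)).2.1
  have := windowHi_le_windowLo hR hq (Fin.lt_def.1 hab)
  rw [Fin.lt_def]
  omega

/-- The windows of the last cycle vertex `j` at different scales are already disjoint. -/
theorem disjoint_windowSeqs (hj : 1 ≤ j) (hN : j < N) {q q' : ℕ} (hqq : q ≠ q') :
    Disjoint (windowSeqs j R q N n) (windowSeqs j R q' N n) := by
  wlog h : q < q' generalizing q q'
  · exact (this hqq.symm (lt_of_le_of_ne (not_lt.1 h) hqq.symm)).symm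
  rw [Finset.disjoint_left]
  intro φ h1 h2
  rw [windowSeqs, Fintype.mem_piFinset] at h1 h2
  have a1 := (Finset.mem_filter.1 (h1 ⟨j, hN⟩)).2.2
  have a2 := (Finset.mem_filter.1 (h2 ⟨j, hN⟩)).2.1
  simp only [windowHi, windowLo, Nat.lt_succ_self, if_true] at a1 a2
  have : (j + 1) * (j + 1) ^ (q + 1) ≤ j * (j + 1) ^ (q' + 1) :=
    calc (j + 1) * (j + 1) ^ (q + 1) = (j + 1) ^ (q + 2) := by ring
      _ ≤ (j + 1) ^ (q' + 1) := Nat.pow_le_pow_right (Nat.succ_pos j) (by omega)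
      _ ≤ j * (j + 1) ^ (q' + 1) := Nat.le_mul_of_pos_left _ hj
  omega

theorem two_le_of_mem_windowSeqs (hj : 1 ≤ j) (hN : j < N) {q : ℕ} {φ : Fin N → Fin n}
    (hφ : φ ∈ windowSeqs j R q N n) : 2 ≤ (φ ⟨j, hN⟩ : ℕ) := by
  rw [windowSeqs, Fintype.mem_piFinset] at hφ
  have a2 := (Finset.mem_filter.1 (hφ ⟨j, hN⟩)).2.1
  simp only [windowLo, Nat.lt_succ_self, if_true] at a2
  have : j + 1 ≤ j * (j + 1) ^ (q + 1) :=
    calc j + 1 = (j + 1) ^ 1 := by ring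
      _ ≤ (j + 1) ^ (q + 1) := Nat.pow_le_pow_right (Nat.succ_pos j) (by omega)
      _ ≤ j * (j + 1) ^ (q + 1) := Nat.le_mul_of_pos_left _ hj
  omega

theorem log_sub_log_le_sum {a b : ℕ} (ha : 1 ≤ a) (hab : a ≤ b) :
    Real.log b - Real.log a ≤ ∑ x ∈ Finset.Ico a b, (x : ℝ)⁻¹ := by
  induction b, hab using Nat.le_induction with
  | base => simp
  | succ b hb ih =>
    rw [Finset.sum_Ico_succ_top hb]
    have hb0 : (0 : ℝ) < b := by exact_mod_cast (ha.trans hb)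
    have := Real.log_le_sub_one_of_pos (x := ((b + 1 : ℕ) : ℝ) / b) (by positivity)
    rw [Real.log_div (by positivity) hb0.ne'] at this
    have e : ((b + 1 : ℕ) : ℝ) / b - 1 = (b : ℝ)⁻¹ := by
      push_cast; field_simp; ring
    linarith

/-- Lower bounds for the sums of `vertexWeight` over the windows. -/
def windowMass (j R q k : ℕ) : ℝ :=
  if k = 0 then ((j + 1 : ℕ) : ℝ) ^ (q + 1)
  else if k = j then (((j + 1 : ℕ) : ℝ) ^ (q + 1) * ((j + 1 : ℕ) : ℝ) ^ 2)⁻¹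
  else if k < j then ((j + 1 : ℕ) : ℝ)⁻¹ else Real.log R

theorem windowMass_nonneg (j R q k : ℕ) : 0 ≤ windowMass j R q k := by
  unfold windowMass
  split_ifs <;> positivity

/-- With `z = (j + 1)^(q + 1)`, a cycle window has `z` elements, all at most `(j + 1) * z`; a tree
window carries a harmonic sum over `[R^i, R^(i+1))`. -/
theorem windowMass_le (hR : 1 ≤ R) (q k : ℕ) :
    windowMass j R q k ≤
      ∑ x ∈ Finset.Ico (windowLo j R q k) (windowHi j R q k), vertexWeight j k x := by
  set z := (j + 1) ^ (q + 1) with hz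
  have hz0 : (0 : ℝ) < z := by positivity
  have hzc : ((j + 1 : ℕ) : ℝ) ^ (q + 1) = z := by rw [hz]; push_cast; rfl
  have hterm : ∀ k < j + 1, 0 < k → ∀ x ∈ Finset.Ico (k * z) ((k + 1) * z),
      (((j + 1 : ℕ) : ℝ) * z)⁻¹ ≤ (x : ℝ)⁻¹ := by
    intro k hk hk0 x hx
    rw [Finset.mem_Ico] at hx
    have h1 : 0 < x := lt_of_lt_of_le (by positivity) hx.1
    have h2 : x ≤ (j + 1) * z := hx.2.le.trans (Nat.mul_le_mul_right z (by omega))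
    have h1' : (0 : ℝ) < x := by exact_mod_cast h1
    gcongr
    exact_mod_cast h2
  have hcard : ∀ k, (Finset.Ico (k * z) ((k + 1) * z)).card = z := fun k => by
    rw [Nat.card_Ico, add_mul, one_mul, Nat.add_sub_cancel_left]
  unfold windowMass windowLo windowHi vertexWeight
  split_ifs with h1 h2 h3 h4 h5 h6 h7
  · subst h1
    rw [Finset.sum_const, nsmul_eq_mul, mul_one, ← hz, hcard, hzc]
  · omega
  · rw [← hz, hzc]
    calc (z * ((j + 1 : ℕ) : ℝ) ^ 2)⁻¹ = ∑ x ∈ Finset.Ico (k * z) ((k + 1) * z),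
          ((((j + 1 : ℕ) : ℝ) * z)⁻¹) ^ 2 := by
          rw [Finset.sum_const, hcard, nsmul_eq_mul]
          field_simp
      _ ≤ _ := by
          refine Finset.sum_le_sum fun x hx => ?_
          have := hterm k h4 (by omega) x hx
          gcongr
  · omega
  · rw [← hz]
    calc ((j + 1 : ℕ) : ℝ)⁻¹ = ∑ x ∈ Finset.Ico (k * z) ((k + 1) * z),
          (((j + 1 : ℕ) : ℝ) * z)⁻¹ := by
          rw [Finset.sum_const, hcard, nsmul_eq_mul]
          field_simp
      _ ≤ _ := Finset.sum_le_sum fun x hx => hterm k h6 (by omega) x hx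
  · omega
  · omega
  · refine le_trans ?_ (log_sub_log_le_sum (Nat.one_le_pow _ _ hR)
      (Nat.pow_le_pow_right hR (by omega)))
    push_cast
    rw [Real.log_pow, Real.log_pow]
    push_cast
    linarith

theorem vertexWeight_nonneg (j k x : ℕ) : 0 ≤ vertexWeight j k x := by
  unfold vertexWeight; split_ifs <;> positivity

/-- The scale cancels between the oldest cycle vertex, which is free, and the youngest, which
carries two edges. So each of the `Q` scales contributes the same mass. -/
theorem prod_windowMass (hj : 1 ≤ j) (R q t : ℕ) :
    ∏ k ∈ Finset.range (j + 1 + t), windowMass j R q k =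
      (((j + 1 : ℕ) : ℝ) ^ (j + 1))⁻¹ * Real.log R ^ t := by
  rw [Finset.prod_range_add]
  congr 1
  · obtain ⟨i, rfl⟩ := Nat.exists_eq_add_of_le' hj
    rw [Finset.prod_range_succ, Finset.prod_range_succ']
    have h1 : ∀ k ∈ Finset.range i, windowMass (i + 1) R q (k + 1) = ((i + 1 + 1 : ℕ) : ℝ)⁻¹ := by
      intro k hk
      have := Finset.mem_range.1 hk
      rw [windowMass, if_neg (by omega), if_neg (by omega), if_pos (by omega)]
    rw [Finset.prod_congr rfl h1, Finset.prod_const, Finset.card_range]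
    have h2 : windowMass (i + 1) R q 0 = ((i + 1 + 1 : ℕ) : ℝ) ^ (q + 1) := by simp [windowMass]
    have h3 : windowMass (i + 1) R q (i + 1) =
        (((i + 1 + 1 : ℕ) : ℝ) ^ (q + 1) * ((i + 1 + 1 : ℕ) : ℝ) ^ 2)⁻¹ := by simp [windowMass]
    rw [h2, h3]
    have : ((i + 1 + 1 : ℕ) : ℝ) ≠ 0 := by positivity
    generalize ((i + 1 + 1 : ℕ) : ℝ) = y at *
    rw [inv_pow]
    field_simp
    ring
  · have h1 : ∀ k ∈ Finset.range t, windowMass j R q (j + 1 + k) = Real.log R := by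
      intro k _
      rw [windowMass, if_neg (by omega), if_neg (by omega), if_neg (by omega)]
    rw [Finset.prod_congr rfl h1, Finset.prod_const, Finset.card_range]

/-- All sequences in windows at one of the first `Q` scales. -/
def scaledSeqs (j R Q N n : ℕ) : Finset (Fin N → Fin n) :=
  (Finset.range Q).biUnion fun q => windowSeqs j R q N n

theorem le_sum_windowSeqs (hj : 1 ≤ j) {t : ℕ} (hR : (j + 1) ^ (Q + 1) ≤ R)
    (hn : R ^ (t + 1) ≤ n) (hN : N = j + 1 + t) :
    (Q : ℝ) * ((((j + 1 : ℕ) : ℝ) ^ (j + 1))⁻¹ * Real.log R ^ t) ≤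
      ∑ φ ∈ scaledSeqs j R Q N n, ∏ k : Fin N, vertexWeight j k (φ k) := by
  have hR1 : 1 ≤ R := (Nat.one_le_pow _ _ (Nat.succ_pos j)).trans hR
  have hn' : R ^ (N - j) ≤ n := by
    rw [hN, show j + 1 + t - j = t + 1 by omega]; exact hn
  rw [scaledSeqs, Finset.sum_biUnion fun q _ q' _ h => disjoint_windowSeqs hj (by omega) h]
  have hconst : (Q : ℝ) * ((((j + 1 : ℕ) : ℝ) ^ (j + 1))⁻¹ * Real.log R ^ t) =
      ∑ _q ∈ Finset.range Q, (((j + 1 : ℕ) : ℝ) ^ (j + 1))⁻¹ * Real.log R ^ t := by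
    rw [Finset.sum_const, Finset.card_range, nsmul_eq_mul]
  rw [hconst]
  refine Finset.sum_le_sum fun q hq => ?_
  rw [windowSeqs, ← Finset.prod_univ_sum _ (fun (k : Fin N) (x : Fin n) => vertexWeight j k x),
    ← prod_windowMass hj R q t, ← hN,
    ← Fin.prod_univ_eq_prod_range]
  refine Finset.prod_le_prod (fun k _ => windowMass_nonneg _ _ _ _) fun k _ => ?_
  refine (windowMass_le hR1 q k).trans_eq ?_
  have hhi := windowHi_le hR hn' (by omega) (Finset.mem_range.1 hq) k.2
  rw [Finset.sum_filter, Fin.sum_univ_eq_sum_range (fun x =>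
    if windowLo j R q k ≤ x ∧ x < windowHi j R q k then vertexWeight j k x else 0),
    ← Finset.sum_filter]
  refine Finset.sum_congr ?_ fun _ _ => rfl
  ext x
  simp only [Finset.mem_Ico, Finset.mem_filter, Finset.mem_range]
  omega

theorem strictMono_of_mem_scaledSeqs (hR : (j + 1) ^ (Q + 1) ≤ R)
    {φ : Fin N → Fin n} (hφ : φ ∈ scaledSeqs j R Q N n) : StrictMono φ := by
  obtain ⟨q, hq, h⟩ := Finset.mem_biUnion.1 hφ
  exact strictMono_of_mem_windowSeqs hR (Finset.mem_range.1 hq) h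

theorem two_le_of_mem_scaledSeqs (hj : 1 ≤ j) (hN : j < N) {φ : Fin N → Fin n}
    (hφ : φ ∈ scaledSeqs j R Q N n) : 2 ≤ (φ ⟨j, hN⟩ : ℕ) := by
  obtain ⟨q, -, h⟩ := Finset.mem_biUnion.1 hφ
  exact two_le_of_mem_windowSeqs hj hN h

end Windows

/-! ### Copies whose vertices increase in the order of the shape -/

section IncreasingCopies

variable {j t m n : ℕ} {S : Shape j t}

/-- The labels of an increasing copy: only the edge closing the cycle has the label `1`. -/
def standardLabel (hm : 2 ≤ m) (j t : ℕ) (k : Fin (j + 1 + t)) : Fin m :=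
  if (k : ℕ) = 0 then ⟨1, hm⟩ else ⟨0, by omega⟩

theorem parent_lt (S : Shape j t) {k : Fin (j + 1 + t)} (hk : (k : ℕ) ≠ 0) : S.parent k < k := by
  revert hk
  refine Fin.addCases (fun k => ?_) (fun i => ?_) k
  · intro hk
    rw [S.parent_castAdd]
    have h0 : k ≠ 0 := fun h => hk (by rw [h]; rfl)
    rw [Fin.lt_def]
    simp only [Fin.val_castAdd]
    exact Fin.sub_one_lt_iff.2 (Fin.pos_iff_ne_zero.2 h0)
  · exact fun _ => S.parent_natAdd_lt i

theorem parent_zero (S : Shape j t) {k : Fin (j + 1 + t)} (hk : (k : ℕ) = 0) :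
    S.parent k = ⟨j, by omega⟩ := by
  have h0 : (0 : Fin (j + 1)) - 1 = Fin.last j := by
    rw [sub_eq_iff_eq_add, Fin.last_add_one]
  have : k = Fin.castAdd t 0 := Fin.ext (by simpa using hk)
  rw [this, S.parent_castAdd, h0]
  rfl

variable {φ : Fin (j + 1 + t) → Fin n} (hφ : StrictMono φ) (hm : 2 ≤ m)
include hφ

theorem edge_of_ne_zero (b : Fin (j + 1 + t) → Fin m) {k : Fin (j + 1 + t)} (hk : (k : ℕ) ≠ 0) :
    S.edge φ b k = (φ k, φ (S.parent k), b k) := by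
  have := (hφ (parent_lt S hk)).le
  simp [Shape.edge, this]

theorem edge_of_eq_zero (b : Fin (j + 1 + t) → Fin m) {k : Fin (j + 1 + t)} (hk : (k : ℕ) = 0) :
    S.edge φ b k = (φ ⟨j, by omega⟩, φ k, b k) := by
  have : φ k ≤ φ ⟨j, by omega⟩ := hφ.monotone (Fin.le_def.2 (by simp [hk]))
  simp [Shape.edge, parent_zero S hk, this]

/-- Along an increasing sequence every vertex but the oldest is the younger endpoint of the edge to
its parent, and the vertex `j` also of the edge closing the cycle. These two edges at `j` need
different labels: this is where `2 ≤ m` enters. -/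
theorem isPlacement_of_strictMono : S.IsPlacement φ (standardLabel hm j t) := by
  refine ⟨hφ.injective, fun k k' h => ?_⟩
  simp only [Prod.mk.injEq] at h
  obtain ⟨h1, h2⟩ := h
  have hl : standardLabel hm j t k = standardLabel hm j t k' := h2
  by_cases hk : (k : ℕ) = 0 <;> by_cases hk' : (k' : ℕ) = 0
  · exact Fin.ext (hk.trans hk'.symm)
  · simp [standardLabel, hk, hk'] at hl
  · simp [standardLabel, hk, hk'] at hl
  · rw [edge_of_ne_zero hφ _ hk, edge_of_ne_zero hφ _ hk'] at h1
    exact hφ.injective h1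

theorem edgeWeight_of_strictMono (hj : 1 ≤ j) :
    edgeWeight (S.edges φ (standardLabel hm j t)) =
      ∏ k : Fin (j + 1 + t), vertexWeight j k (φ k) := by
  have hpl := isPlacement_of_strictMono (S := S) hφ hm
  have hinj : Function.Injective (S.edge φ (standardLabel hm j t)) :=
    fun k k' hk => hpl.2 (by simp only [hk])
  rw [edgeWeight, Shape.edges, Finset.prod_image hinj.injOn]
  set k0 : Fin (j + 1 + t) := ⟨0, by omega⟩ with hk0
  set k1 : Fin (j + 1 + t) := ⟨j, by omega⟩ with hk1
  have hne : k1 ≠ k0 := fun h => by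
    have := congrArg Fin.val h
    simp [hk0, hk1] at this
    omega
  have hmem : k1 ∈ Finset.univ.erase k0 := Finset.mem_erase.2 ⟨hne, Finset.mem_univ _⟩
  rw [← Finset.mul_prod_erase _ _ (Finset.mem_univ k0),
    ← Finset.mul_prod_erase _ _ (Finset.mem_univ k0), ← Finset.mul_prod_erase _ _ hmem,
    ← Finset.mul_prod_erase _ _ hmem, edge_of_eq_zero hφ _ (k := k0) rfl,
    edge_of_ne_zero hφ _ (k := k1) (by simp [hk1]; omega)]
  have h1 : vertexWeight j k0 (φ k0) = 1 := by simp [vertexWeight, hk0]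
  have h2 : vertexWeight j k1 (φ k1) = ((φ k1 : ℕ) : ℝ)⁻¹ ^ 2 := by
    rw [vertexWeight, if_neg (by simp [hk1]; omega), if_pos (by simp [hk1])]
  rw [h1, h2, one_mul, ← mul_assoc, sq]
  congr 1
  refine Finset.prod_congr rfl fun k hk => ?_
  have h3 : (k : ℕ) ≠ 0 := fun h => Finset.ne_of_mem_erase (Finset.mem_of_mem_erase hk) (Fin.ext h)
  have h4 : (k : ℕ) ≠ j := fun h => Finset.ne_of_mem_erase hk (Fin.ext h)
  rw [edge_of_ne_zero hφ _ h3, vertexWeight, if_neg h3, if_neg h4]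

end IncreasingCopies

/-! ### Lower bounds for mean and variance; pairs of copies with a common cycle -/

section LowerBounds

variable {j t m n : ℕ} {S : Shape j t} {R Q : ℕ}

/-- The edges determine the vertex set, and a finite set has only one increasing enumeration. So
distinct increasing sequences give distinct copies. -/
theorem eq_of_edges_eq {φ φ' : Fin (j + 1 + t) → Fin n} (hφ : StrictMono φ) (hφ' : StrictMono φ')
    {b b' : Fin (j + 1 + t) → Fin m} (h : S.edges φ b = S.edges φ' b') : φ = φ' := by
  refine (StrictMono.range_inj hφ hφ').1 ?_
  ext x
  have h1 := mem_verts_edges (S := S) (φ := φ) (b := b) (z := x)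
  have h2 := mem_verts_edges (S := S) (φ := φ') (b := b') (z := x)
  rw [h] at h1
  have h3 := h1.symm.trans h2
  simpa only [Set.mem_range, Fin.val_inj] using h3

theorem le_mean (hj : 1 ≤ j) (hm : 2 ≤ m) (S : Shape j t) (hR : (j + 1) ^ (Q + 1) ≤ R)
    (hn : R ^ (t + 1) ≤ n) :
    (Q : ℝ) * ((((j + 1 : ℕ) : ℝ) ^ (j + 1))⁻¹ * Real.log R ^ t) ≤ S.mean m n := by
  classical
  refine (le_sum_windowSeqs hj hR hn rfl).trans ?_
  have hmono : ∀ φ ∈ scaledSeqs j R Q (j + 1 + t) n, StrictMono φ := fun φ hφ =>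
    strictMono_of_mem_scaledSeqs hR hφ
  calc _ = ∑ φ ∈ scaledSeqs j R Q (j + 1 + t) n,
        edgeWeight (S.edges φ (standardLabel hm j t)) :=
        Finset.sum_congr rfl fun φ hφ => (edgeWeight_of_strictMono (hmono φ hφ) hm hj).symm
    _ = ∑ A ∈ (scaledSeqs j R Q (j + 1 + t) n).image fun φ => S.edges φ (standardLabel hm j t),
        edgeWeight A := by
        rw [Finset.sum_image]
        exact fun φ hφ φ' hφ' h => eq_of_edges_eq (hmono φ hφ) (hmono φ' hφ') h
    _ ≤ _ := by
        refine Finset.sum_le_sum_of_subset_of_nonneg (fun A hA => ?_)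
          fun _ _ _ => edgeWeight_nonneg _
        obtain ⟨φ, hφ, rfl⟩ := Finset.mem_image.1 hA
        exact Shape.mem_copies.2 ⟨φ, _, isPlacement_of_strictMono (hmono φ hφ) hm, rfl⟩

/-- The embedding of the vertices which skips the first of two families of tree vertices. -/
def skipTrees (j t : ℕ) (k : Fin (j + 1 + t)) : Fin (j + 1 + t + t) :=
  if (k : ℕ) < j + 1 then Fin.castAdd t k else ⟨k + t, by omega⟩

theorem strictMono_skipTrees (j t : ℕ) : StrictMono (skipTrees j t) := by
  intro a b hab
  have := Fin.lt_def.1 hab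
  unfold skipTrees
  split_ifs <;> rw [Fin.lt_def] <;> simp <;> omega

variable {φ : Fin (j + 1 + t + t) → Fin n} (hφ : StrictMono φ) (hm : 2 ≤ m)

/-- The copy using the first family of tree vertices. -/
def firstCopy (S : Shape j t) (hm : 2 ≤ m) (φ : Fin (j + 1 + t + t) → Fin n) :
    Finset (EdgeName m n) :=
  S.edges (φ ∘ Fin.castAdd t) (standardLabel hm j t)

/-- The copy using the second family of tree vertices. -/
def secondCopy (S : Shape j t) (hm : 2 ≤ m) (φ : Fin (j + 1 + t + t) → Fin n) :
    Finset (EdgeName m n) :=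
  S.edges (φ ∘ skipTrees j t) (standardLabel hm j t)

theorem edge_cycle_eq (S : Shape j t) (φ : Fin (j + 1 + t + t) → Fin n) (b : Fin (j + 1 + t) → Fin m)
    {k : Fin (j + 1 + t)} (hk : (k : ℕ) < j + 1) :
    S.edge (φ ∘ skipTrees j t) b k = S.edge (φ ∘ Fin.castAdd t) b k := by
  have h1 : skipTrees j t k = Fin.castAdd t k := if_pos hk
  have h2 : skipTrees j t (S.parent k) = Fin.castAdd t (S.parent k) := by
    have : k = Fin.castAdd t ⟨k, hk⟩ := rfl
    rw [this, S.parent_castAdd]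
    rw [skipTrees, if_pos]
    exact Fin.is_lt ((⟨k, hk⟩ : Fin (j + 1)) - 1)
  simp only [Shape.edge, Function.comp_apply, h1, h2]

include hφ

theorem strictMono_first : StrictMono (φ ∘ Fin.castAdd t) :=
  hφ.comp (Fin.strictMono_castAdd t)

theorem strictMono_second : StrictMono (φ ∘ skipTrees j t) :=
  hφ.comp (strictMono_skipTrees j t)

/-- On the cycle the two copies have the same edges, and their tree edges have different younger
endpoints. -/
theorem not_conflict_copies : ¬ Conflict (firstCopy S hm φ) (secondCopy S hm φ) := by
  rw [Conflict, not_not]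
  have hf := strictMono_first hφ
  have hs := strictMono_second hφ
  have key : ∀ k k', (S.edge (φ ∘ Fin.castAdd t) (standardLabel hm j t) k).1 =
      (S.edge (φ ∘ skipTrees j t) (standardLabel hm j t) k').1 →
      standardLabel hm j t k = standardLabel hm j t k' →
      S.edge (φ ∘ Fin.castAdd t) (standardLabel hm j t) k =
      S.edge (φ ∘ skipTrees j t) (standardLabel hm j t) k' := by
    intro k k' h1 hl
    by_cases hk : (k : ℕ) = 0 <;> by_cases hk' : (k' : ℕ) = 0
    · obtain rfl : k = k' := Fin.ext (hk.trans hk'.symm)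
      exact (edge_cycle_eq S φ _ (by omega)).symm
    · simp [standardLabel, hk, hk'] at hl
    · simp [standardLabel, hk, hk'] at hl
    · rw [edge_of_ne_zero hf _ hk, edge_of_ne_zero hs _ hk'] at h1
      have h2 := congrArg Fin.val (hφ.injective h1)
      unfold skipTrees at h2
      split_ifs at h2 with hlt
      · obtain rfl : k = k' := Fin.ext h2
        exact (edge_cycle_eq S φ _ hlt).symm
      · simp at h2
        have := k.2
        omega
  have hA := injOn_slot_of_mem_copies (Shape.mem_copies.2
    ⟨_, _, isPlacement_of_strictMono (S := S) hf hm, rfl⟩)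
  have hB := injOn_slot_of_mem_copies (Shape.mem_copies.2
    ⟨_, _, isPlacement_of_strictMono (S := S) hs hm, rfl⟩)
  intro e he e' he' heq
  rcases Finset.mem_union.1 (Finset.mem_coe.1 he) with he | he <;>
    rcases Finset.mem_union.1 (Finset.mem_coe.1 he') with he' | he'
  · exact hA he he' heq
  · obtain ⟨k, -, rfl⟩ := Finset.mem_image.1 he
    obtain ⟨k', -, rfl⟩ := Finset.mem_image.1 he'
    exact key k k' (Prod.ext_iff.1 heq).1 (Prod.ext_iff.1 heq).2
  · obtain ⟨k, -, rfl⟩ := Finset.mem_image.1 he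
    obtain ⟨k', -, rfl⟩ := Finset.mem_image.1 he'
    exact (key k' k (Prod.ext_iff.1 heq).1.symm (Prod.ext_iff.1 heq).2.symm).symm
  · exact hB he he' heq

omit hφ in
theorem prod_inv_le_prod_inv {s u : Finset (EdgeName m n)} (h : s ⊆ u) :
    ∏ e ∈ u, ((e.1 : ℕ) : ℝ)⁻¹ ≤ ∏ e ∈ s, ((e.1 : ℕ) : ℝ)⁻¹ := by
  classical
  rw [← Finset.prod_sdiff h]
  exact mul_le_of_le_one_left (Finset.prod_nonneg fun _ _ => by positivity)
    (Finset.prod_le_one (fun _ _ => by positivity) fun _ _ => inv_natCast_le_one _)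

/-- Outside the first copy, the second one has at most its `t` tree edges, whose younger endpoints
are the last `t` values of `φ`; omitting factors at most `1` only enlarges a product. -/
theorem le_edgeWeight_union (hj : 1 ≤ j) :
    ∏ k : Fin (j + 1 + t + t), vertexWeight j k (φ k) ≤
      edgeWeight (firstCopy S hm φ ∪ secondCopy S hm φ) := by
  have hf := strictMono_first hφ
  have hs := strictMono_second hφ
  rw [edgeWeight_union, Fin.prod_univ_add, firstCopy, edgeWeight_of_strictMono hf hm hj]
  refine mul_le_mul_of_nonneg_left ?_ (Finset.prod_nonneg fun _ _ => vertexWeight_nonneg _ _ _)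
  set E : Fin t → EdgeName m n := fun i =>
    S.edge (φ ∘ skipTrees j t) (standardLabel hm j t) (Fin.natAdd (j + 1) i) with hE
  have hEval : ∀ i, (E i).1 = φ (Fin.natAdd (j + 1 + t) i) := fun i => by
    rw [hE]
    simp only
    rw [edge_of_ne_zero hs _ (by simp)]
    simp only [Function.comp_apply]
    congr 1
    rw [skipTrees, if_neg (by simp; try omega)]
    ext
    simp
    omega
  have hEinj : Function.Injective E := fun i i' h => by
    have := congrArg Prod.fst h
    rw [hEval, hEval] at this
    simpa using hφ.injective this
  calc _ = ∏ e ∈ Finset.univ.image E, ((e.1 : ℕ) : ℝ)⁻¹ := by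
        rw [Finset.prod_image hEinj.injOn]
        refine Finset.prod_congr rfl fun i _ => ?_
        rw [hEval, vertexWeight, if_neg (by simp), if_neg (by simp; omega)]
    _ ≤ _ := by
        rw [edgeWeight]
        refine prod_inv_le_prod_inv ?_
        intro e he
        rw [Finset.mem_sdiff] at he
        obtain ⟨k, -, rfl⟩ := Finset.mem_image.1 he.1
        by_cases hk : (k : ℕ) < j + 1
        · refine absurd ?_ he.2
          rw [edge_cycle_eq S φ _ hk]
          exact Finset.mem_image_of_mem _ (Finset.mem_univ k)
        · refine Finset.mem_image.2 ⟨⟨k - (j + 1), by omega⟩, Finset.mem_univ _, ?_⟩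
          simp only [hE]
          congr 1
          ext
          simp
          omega

/-- Both copies contain the edge closing the cycle, whose younger endpoint is the value of `φ` at
`j`. -/
theorem edgeWeight_inter_le (h2 : 2 ≤ (φ ⟨j, by omega⟩ : ℕ)) :
    edgeWeight (firstCopy S hm φ ∩ secondCopy S hm φ) ≤ 1 / 2 := by
  have hf := strictMono_first hφ
  set k0 : Fin (j + 1 + t) := ⟨0, by omega⟩ with hk0
  set e := S.edge (φ ∘ Fin.castAdd t) (standardLabel hm j t) k0 with he
  have hmem : e ∈ firstCopy S hm φ ∩ secondCopy S hm φ := by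
    refine Finset.mem_inter.2 ⟨Finset.mem_image_of_mem _ (Finset.mem_univ _), ?_⟩
    rw [he, ← edge_cycle_eq S φ _ (by simp [hk0])]
    exact Finset.mem_image_of_mem _ (Finset.mem_univ _)
  have he1 : e.1 = φ ⟨j, by omega⟩ := by
    rw [he, edge_of_eq_zero hf _ rfl]
    rfl
  rw [edgeWeight, ← Finset.mul_prod_erase _ _ hmem, he1]
  have h2' : (2 : ℝ) ≤ ((φ ⟨j, by omega⟩ : ℕ) : ℝ) := by exact_mod_cast h2
  have h3 : ∏ e ∈ (firstCopy S hm φ ∩ secondCopy S hm φ).erase e, ((e.1 : ℕ) : ℝ)⁻¹ ≤ 1 :=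
    Finset.prod_le_one (fun _ _ => by positivity) fun _ _ => inv_natCast_le_one _
  calc _ ≤ ((φ ⟨j, by omega⟩ : ℕ) : ℝ)⁻¹ * 1 := by gcongr
    _ ≤ 1 / 2 := by
        rw [mul_one, inv_eq_one_div]
        gcongr

omit hφ

/-- Adding `edgeWeight A * edgeWeight B` to the covariance of every conflicting pair makes all terms
`d` nonnegative, so their sum may be restricted to the pairs built from window sequences. For those
the covariance is at least half the weight of the union, because the product of the weights is the
weight of the union times that of the intersection. -/
theorem le_var (hj : 1 ≤ j) (hm : 2 ≤ m) (S : Shape j t) (hR : (j + 1) ^ (Q + 1) ≤ R)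
    (hn : R ^ (2 * t + 1) ≤ n) :
    1 / 2 * ((Q : ℝ) * ((((j + 1 : ℕ) : ℝ) ^ (j + 1))⁻¹ * Real.log R ^ (2 * t))) -
      18 * vertexConst j t m ^ 2 * logScale n ^ (2 * t) ≤ S.var m n := by
  classical
  have hmono : ∀ φ ∈ scaledSeqs j R Q (j + 1 + t + t) n, StrictMono φ := fun φ hφ =>
    strictMono_of_mem_scaledSeqs hR hφ
  set d : Finset (EdgeName m n) × Finset (EdgeName m n) → ℝ := fun x =>
    ∫ ω, occCentred x.1 ω * occCentred x.2 ω ∂law m n +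
      if Conflict x.1 x.2 then edgeWeight x.1 * edgeWeight x.2 else 0 with hd
  have hd0 : ∀ x ∈ S.copies m n ×ˢ S.copies m n, 0 ≤ d x := by
    rintro ⟨A, B⟩ hx
    obtain ⟨hA, hB⟩ := Finset.mem_product.1 hx
    simp only [hd]
    rw [integral_occCentred_mul_eq (integral_occInd_copy hj hA) (integral_occInd_copy hj hB)]
    split_ifs with hc
    · rw [sub_add_cancel]
      exact integral_nonneg fun ω => occInd_nonneg _ ω
    · rw [Conflict, not_not] at hc
      rw [integral_occInd_eq (proper_union (proper_of_mem_copies hj hA)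
        (proper_of_mem_copies hj hB)) hc]
      linarith [edgeWeight_mul_le A B]
  have hcopy : ∀ φ ∈ scaledSeqs j R Q (j + 1 + t + t) n,
      firstCopy S hm φ ∈ S.copies m n ∧ secondCopy S hm φ ∈ S.copies m n := fun φ hφ =>
    ⟨Shape.mem_copies.2 ⟨_, _, isPlacement_of_strictMono (strictMono_first (hmono φ hφ)) hm, rfl⟩,
      Shape.mem_copies.2 ⟨_, _, isPlacement_of_strictMono (strictMono_second (hmono φ hφ)) hm, rfl⟩⟩
  have hlow : ∀ φ ∈ scaledSeqs j R Q (j + 1 + t + t) n,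
      1 / 2 * ∏ k : Fin (j + 1 + t + t), vertexWeight j k (φ k) ≤
        d (firstCopy S hm φ, secondCopy S hm φ) := by
    intro φ hφ
    obtain ⟨hA, hB⟩ := hcopy φ hφ
    have hnc := not_conflict_copies (S := S) (hmono φ hφ) hm
    simp only [hd]
    rw [integral_occCentred_mul_eq (integral_occInd_copy hj hA) (integral_occInd_copy hj hB),
      if_neg hnc, add_zero]
    rw [Conflict, not_not] at hnc
    rw [integral_occInd_eq (proper_union (proper_of_mem_copies hj hA)
        (proper_of_mem_copies hj hB)) hnc, ← edgeWeight_union_mul_inter]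
    have h1 := le_edgeWeight_union (S := S) (hmono φ hφ) hm hj
    have h2 := edgeWeight_inter_le (S := S) (hmono φ hφ) hm
      (two_le_of_mem_scaledSeqs hj (by omega) hφ)
    have h3 := edgeWeight_nonneg (firstCopy S hm φ ∪ secondCopy S hm φ)
    nlinarith
  have hsum : S.var m n + ∑ A ∈ S.copies m n, ∑ B ∈ S.copies m n with Conflict A B,
      edgeWeight A * edgeWeight B = ∑ x ∈ S.copies m n ×ˢ S.copies m n, d x := by
    rw [var_eq_sum, Finset.sum_product]
    simp only [hd, Finset.sum_add_distrib, Finset.sum_filter]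
  have hinj : Set.InjOn (fun φ => (firstCopy S hm φ, secondCopy S hm φ))
      (scaledSeqs j R Q (j + 1 + t + t) n : Set (Fin (j + 1 + t + t) → Fin n)) := by
    intro φ hφ φ' hφ' h
    have hm1 := hmono φ hφ
    have hm2 := hmono φ' hφ'
    have h1 := eq_of_edges_eq (strictMono_first hm1) (strictMono_first hm2) (Prod.ext_iff.1 h).1
    have h2 := eq_of_edges_eq (strictMono_second hm1) (strictMono_second hm2) (Prod.ext_iff.1 h).2
    funext k
    refine Fin.addCases (fun k => congrFun h1 k) (fun i => ?_) k
    have h3 := congrFun h2 (Fin.natAdd (j + 1) i)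
    have h4 : skipTrees j t (Fin.natAdd (j + 1) i) = Fin.natAdd (j + 1 + t) i := by
      rw [skipTrees, if_neg (by simp; try omega)]
      ext
      simp
      omega
    simpa only [Function.comp_apply, h4] using h3
  have hmain : 1 / 2 * ((Q : ℝ) * ((((j + 1 : ℕ) : ℝ) ^ (j + 1))⁻¹ * Real.log R ^ (2 * t))) ≤
      ∑ x ∈ S.copies m n ×ˢ S.copies m n, d x := by
    calc _ ≤ 1 / 2 * ∑ φ ∈ scaledSeqs j R Q (j + 1 + t + t) n,
          ∏ k : Fin (j + 1 + t + t), vertexWeight j k (φ k) :=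
          mul_le_mul_of_nonneg_left (le_sum_windowSeqs hj hR hn (by ring)) (by norm_num)
      _ ≤ ∑ φ ∈ scaledSeqs j R Q (j + 1 + t + t) n,
          d (firstCopy S hm φ, secondCopy S hm φ) := by
          rw [Finset.mul_sum]
          exact Finset.sum_le_sum hlow
      _ = ∑ x ∈ (scaledSeqs j R Q (j + 1 + t + t) n).image
          fun φ => (firstCopy S hm φ, secondCopy S hm φ), d x := (Finset.sum_image hinj).symm
      _ ≤ _ := by
          refine Finset.sum_le_sum_of_subset_of_nonneg (fun x hx => ?_) fun x hx _ => hd0 x hx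
          obtain ⟨φ, hφ, rfl⟩ := Finset.mem_image.1 hx
          exact Finset.mem_product.2 (hcopy φ hφ)
  have hconf := sum_conflict_le hj S m n
  linarith

end LowerBounds


/-! ### Orders of magnitude -/

theorem log_natCast_pos {n : ℕ} (hn : 2 ≤ n) : 0 < Real.log n :=
  Real.log_pos (by exact_mod_cast hn)

/-- With `n = k + 1`, `logScale n` is `2 + harmonic k ≤ 3 + log n`, and `3 ≤ 5 log 2`. -/
theorem logScale_le {n : ℕ} (hn : 2 ≤ n) : logScale n ≤ 6 * Real.log n := by
  obtain ⟨k, rfl⟩ := Nat.exists_eq_add_of_le' (show 1 ≤ n by omega)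
  have h1 : logScale (k + 1) = 2 + (harmonic k : ℝ) := by
    rw [logScale, Finset.sum_range_succ', harmonic]
    have : ∀ i : ℕ, max (i + 1) 1 = i + 1 := fun i => by omega
    simp only [this]
    push_cast
    norm_num
    ring
  have h2 := harmonic_le_one_add_log k
  have h3 : Real.log k ≤ Real.log (k + 1 : ℕ) :=
    Real.log_le_log (by exact_mod_cast (by omega : 0 < k)) (by push_cast; linarith)
  have h4 : Real.log 2 ≤ Real.log (k + 1 : ℕ) :=
    Real.log_le_log (by norm_num) (by exact_mod_cast hn)
  have h5 := Real.log_two_gt_d9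
  rw [h1]
  linarith

theorem eventually_le_log (x : ℝ) : ∀ᶠ n : ℕ in atTop, x ≤ Real.log n :=
  (Real.tendsto_log_atTop.comp tendsto_natCast_atTop_atTop).eventually_ge_atTop x

/-- `R` is the integer part of `n^(1/D)` and `Q + 1` that of the base-`b` logarithm of `R`. The
small constant `1 / (4 D b)` absorbs the rounding. -/
theorem exists_scales {b D : ℕ} (hb : 2 ≤ b) (hD : 1 ≤ D) :
    ∃ c : ℝ, 0 < c ∧ ∀ᶠ n : ℕ in atTop, ∃ R Q : ℕ, b ^ (Q + 1) ≤ R ∧ R ^ D ≤ n ∧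
      c * Real.log n ≤ Q ∧ c * Real.log n ≤ Real.log R := by
  have hb' : (2 : ℝ) ≤ b := by exact_mod_cast hb
  have hD' : (1 : ℝ) ≤ D := by exact_mod_cast hD
  refine ⟨(4 * D * b)⁻¹, by positivity, ?_⟩
  filter_upwards [eventually_le_log (8 * D * b), eventually_ge_atTop 1] with n hL hn
  have hn0 : (0 : ℝ) < n := by exact_mod_cast hn
  set L := Real.log n with hLdef
  have hL0 : 0 < L := lt_of_lt_of_le (by positivity) hL
  set R := ⌊Real.exp (L / D)⌋₊ with hRdef
  have hR1 : (R : ℝ) ≤ Real.exp (L / D) := Nat.floor_le (Real.exp_pos _).le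
  have hR2 : Real.exp (L / D) < R + 1 := Nat.lt_floor_add_one _
  have hexp : 2 ≤ Real.exp (L / D) := by
    have h1 : 1 ≤ L / D := by
      rw [le_div_iff₀ (by positivity)]
      nlinarith
    linarith [Real.add_one_le_exp (L / D)]
  have hR0 : (0 : ℝ) < R := by linarith
  have hR3 : Real.exp (L / D) / 2 ≤ R := by linarith
  have hlogR : L / D - 1 ≤ Real.log R := by
    have h1 := Real.log_le_log (by positivity) hR3
    rw [Real.log_div (Real.exp_pos _).ne' (by norm_num), Real.log_exp] at h1
    linarith [Real.log_two_lt_d9]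
  have hLD : L / D = 4 * b * ((4 * D * b : ℝ)⁻¹ * L) := by field_simp
  have hcL : 2 ≤ (4 * D * b : ℝ)⁻¹ * L := by
    rw [inv_mul_eq_div, le_div_iff₀ (by positivity)]
    linarith
  generalize (4 * D * b : ℝ)⁻¹ * L = y at *
  have hlogR' : 3 * b * y ≤ Real.log R := by nlinarith
  have hNat : Real.log R ≤ (Nat.log b R + 1) * b := by
    have h1 : (R : ℝ) ≤ (b : ℝ) ^ (Nat.log b R + 1) := by
      exact_mod_cast (Nat.lt_pow_succ_log_self (by omega) R).le
    have h2 := Real.log_le_log hR0 h1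
    rw [Real.log_pow] at h2
    push_cast at h2
    refine h2.trans (mul_le_mul_of_nonneg_left ?_ (by positivity))
    linarith [Real.log_le_sub_one_of_pos (show (0 : ℝ) < b by linarith)]
  have hlog : 3 * y ≤ Nat.log b R + 1 := by
    have h3 : b * (3 * y) ≤ b * ((Nat.log b R : ℝ) + 1) := by linarith
    exact le_of_mul_le_mul_left h3 (by linarith)
  have hlog1 : 1 ≤ Nat.log b R := by
    have : (1 : ℝ) ≤ Nat.log b R := by linarith
    exact_mod_cast this
  refine ⟨R, Nat.log b R - 1, ?_, ?_, ?_, ?_⟩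
  · rw [Nat.sub_add_cancel hlog1]
    exact Nat.pow_log_le_self _ (by exact_mod_cast hR0.ne')
  · have : (R : ℝ) ^ D ≤ n := by
      calc (R : ℝ) ^ D ≤ Real.exp (L / D) ^ D := pow_le_pow_left₀ hR0.le hR1 _
        _ = n := by
          rw [← Real.exp_nat_mul, mul_div_cancel₀ _ (by positivity), hLdef, Real.exp_log hn0]
    exact_mod_cast this
  · rw [Nat.cast_sub hlog1]
    push_cast
    linarith
  · nlinarith

section Magnitude

variable {j t m : ℕ}

theorem exists_le_mean (hj : 1 ≤ j) (hm : 2 ≤ m) (t : ℕ) :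
    ∃ c : ℝ, 0 < c ∧ ∀ᶠ n : ℕ in atTop, ∀ S : Shape j t,
      c * Real.log n ^ (t + 1) ≤ S.mean m n := by
  obtain ⟨c, hc, h⟩ := exists_scales (b := j + 1) (D := t + 1) (by omega) (by omega)
  refine ⟨(((j + 1 : ℕ) : ℝ) ^ (j + 1))⁻¹ * c ^ (t + 1), by positivity, ?_⟩
  filter_upwards [h, eventually_ge_atTop 2] with n ⟨R, Q, hR, hn, hQ, hlog⟩ h2 S
  have hL := log_natCast_pos h2
  refine le_trans ?_ (le_mean hj hm S hR hn)
  calc _ = c * Real.log n *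
        ((((j + 1 : ℕ) : ℝ) ^ (j + 1))⁻¹ * (c * Real.log n) ^ t) := by ring
    _ ≤ _ := by gcongr

/-- The exponent `D = 2 * t + 1` leaves room for two families of tree windows. The threshold for `n`
is chosen before `S`, which later makes the constant in the distance bound uniform. -/
theorem exists_le_var (hj : 1 ≤ j) (hm : 2 ≤ m) (t : ℕ) :
    ∃ c : ℝ, 0 < c ∧ ∀ᶠ n : ℕ in atTop, ∀ S : Shape j t,
      c * Real.log n ^ (2 * t + 1) ≤ S.var m n := by
  obtain ⟨c, hc, h⟩ := exists_scales (b := j + 1) (D := 2 * t + 1) (by omega) (by omega)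
  set a : ℝ := 1 / 2 * ((((j + 1 : ℕ) : ℝ) ^ (j + 1))⁻¹ * c ^ (2 * t + 1)) with ha
  have ha0 : 0 < a := by positivity
  set d : ℝ := 18 * vertexConst j t m ^ 2 * 6 ^ (2 * t) with hd
  refine ⟨a / 2, by positivity, ?_⟩
  -- Beyond `2 * d / a` the conflict term, of order `log^(2t) n`, is at most half of the main term.
  filter_upwards [h, eventually_ge_atTop 2, eventually_le_log (2 * d / a)]
    with n ⟨R, Q, hR, hn, hQ, hlog⟩ h2 hlarge S
  have hL := log_natCast_pos h2
  refine le_trans ?_ (le_var hj hm S hR hn)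
  have h3 : a * Real.log n ^ (2 * t + 1) ≤
      1 / 2 * ((Q : ℝ) * ((((j + 1 : ℕ) : ℝ) ^ (j + 1))⁻¹ * Real.log R ^ (2 * t))) := by
    calc _ = 1 / 2 * (c * Real.log n *
          ((((j + 1 : ℕ) : ℝ) ^ (j + 1))⁻¹ * (c * Real.log n) ^ (2 * t))) := by rw [ha]; ring
      _ ≤ _ := by gcongr
  have h4 : 18 * vertexConst j t m ^ 2 * logScale n ^ (2 * t) ≤ d * Real.log n ^ (2 * t) := by
    rw [hd, mul_assoc _ ((6 : ℝ) ^ _), ← mul_pow]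
    have := one_le_logScale n
    have := logScale_le h2
    gcongr
  have h5 : d * Real.log n ^ (2 * t) ≤ a / 2 * Real.log n ^ (2 * t + 1) := by
    rw [pow_succ', ← mul_assoc]
    have : d ≤ a / 2 * Real.log n := by
      rw [div_le_iff₀ ha0] at hlarge
      linarith
    gcongr
  linarith

theorem mean_le_log (hj : 1 ≤ j) (S : Shape j t) {n : ℕ} (hn : 2 ≤ n) :
    S.mean m n ≤ meanConst j t m * 6 ^ (t + 1) * Real.log n ^ (t + 1) := by
  refine (mean_le hj S m n).trans ?_
  rw [mul_assoc, ← mul_pow]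
  have := one_le_logScale n
  have := logScale_le hn
  have := meanConst_nonneg j t m
  gcongr

theorem var_le_log (hj : 1 ≤ j) (S : Shape j t) {n : ℕ} (hn : 2 ≤ n) :
    S.var m n ≤ 4 * (meanConst j t m * meetConst j t m) * 6 ^ (2 * t + 1) *
      Real.log n ^ (2 * t + 1) := by
  refine (var_le hj S m n).trans ?_
  rw [mul_assoc _ ((6 : ℝ) ^ _), ← mul_pow]
  have := one_le_logScale n
  have := logScale_le hn
  have := meanConst_nonneg j t m
  have := meetConst_nonneg j t m
  gcongr

theorem isTheta_log_pow {u : ℕ → ℝ} {p : ℕ} {c C : ℝ} (hc : 0 < c)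
    (hl : ∀ᶠ n : ℕ in atTop, c * Real.log n ^ p ≤ u n)
    (hu : ∀ n : ℕ, 2 ≤ n → u n ≤ C * Real.log n ^ p) :
    u =Θ[atTop] fun n : ℕ => Real.log n ^ p := by
  constructor
  · refine IsBigO.of_bound C ?_
    filter_upwards [hl, eventually_ge_atTop 2] with n h h2
    have h3 : 0 < Real.log n ^ p := pow_pos (log_natCast_pos h2) p
    rw [Real.norm_of_nonneg h3.le, Real.norm_of_nonneg (le_trans (by positivity) h)]
    exact hu n h2
  · refine IsBigO.of_bound c⁻¹ ?_
    filter_upwards [hl, eventually_ge_atTop 2] with n h h2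
    have h3 : 0 < Real.log n ^ p := pow_pos (log_natCast_pos h2) p
    rw [Real.norm_of_nonneg h3.le, Real.norm_of_nonneg (le_trans (by positivity) h),
      inv_mul_eq_div, le_div_iff₀ hc, mul_comm]
    exact h

/-! ### The distance to the normal distribution -/

theorem integral_sq_standardized {n : ℕ} (S : Shape j t) (h : 0 < S.var m n) :
    ∫ ω, (∑ A ∈ S.copies m n, occCentred A ω / √(S.var m n)) ^ 2 ∂law m n = 1 := by
  simp only [← Finset.sum_div, div_pow, Real.sq_sqrt h.le, integral_div]
  exact div_self h.ne'

/-- Both means lie within `1` of `f 0`, by `|x| ≤ (1 + x²) / 2` and the unit second moments. This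
serves the finitely many small `n`. -/
theorem abs_integral_standardized_sub_le_two {n : ℕ} (S : Shape j t) (h : 0 < S.var m n)
    {f : ℝ → ℝ} (hf : ∀ x y, |f x - f y| ≤ |x - y|) :
    |∫ ω, f (∑ A ∈ S.copies m n, occCentred A ω / √(S.var m n)) ∂law m n -
      ∫ x, f x ∂gaussianReal 0 1| ≤ 2 := by
  set Y : Sample m n → ℝ := fun ω => ∑ A ∈ S.copies m n, occCentred A ω / √(S.var m n) with hY
  have h1 : |∫ ω, (f (Y ω) - f 0) ∂law m n| ≤ 1 := by
    calc _ ≤ ∫ ω, |f (Y ω) - f 0| ∂law m n := abs_integral_le_integral_abs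
      _ ≤ ∫ ω, (1 / 2 + Y ω ^ 2 / 2) ∂law m n := by
          refine integral_mono (integrable_law _) (integrable_law _) fun ω => ?_
          have h2 := hf (Y ω) 0
          rw [sub_zero] at h2
          have h3 := sq_abs (Y ω)
          simp only
          nlinarith [sq_nonneg (|Y ω| - 1)]
      _ = 1 := by
          rw [integral_add (integrable_law _) (integrable_law _), integral_div _ fun ω => Y ω ^ 2,
            integral_sq_standardized S h]
          simp
          norm_num
  rw [integral_sub (integrable_law _) (integrable_law _)] at h1
  simp only [integral_const, probReal_univ, one_smul] at h1
  have h2 := (abs_integral_gaussian_sub_le hf).2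
  rw [abs_le] at h1 h2 ⊢
  constructor <;> linarith [h1.1, h1.2, h2.1, h2.2]

/-- `480 = 2 * 15 * 16`: twice the Lipschitz constant of the Stein derivative, times `8 + 4 * 2`
from the absolute moments of a triple. -/
theorem abs_integral_standardized_sub_le {n : ℕ} (hj : 1 ≤ j) (S : Shape j t) (h : 0 < S.var m n)
    {f : ℝ → ℝ} (hf : ∀ x y, |f x - f y| ≤ |x - y|) :
    |∫ ω, f (∑ A ∈ S.copies m n, occCentred A ω / √(S.var m n)) ∂law m n -
      ∫ x, f x ∂gaussianReal 0 1| ≤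
      480 * (meanConst j t m * meetConst j t m ^ 2 * logScale n ^ (3 * t + 1)) /
        √(S.var m n) ^ 3 := by
  obtain ⟨g, g', hg, hgf, hc⟩ := exists_stein_solution hf
  set σ := √(S.var m n) with hσ
  have hσ0 : 0 < σ := Real.sqrt_pos.2 h
  have hstein := abs_integral_stein_le (fun e : Slot m n => uniformOn Set.univ) (S.copies m n)
    (fun A ω => occCentred A ω / σ) slots
    (fun A _ ω ω' hω => by simp only [dependsOn_occCentred A hω])
    (fun A hA => by
      rw [integral_div]
      exact div_eq_zero_iff.2 (Or.inl (integral_occCentred_copy hj hA)))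
    (integral_sq_standardized S h) hg hc
  change |∫ ω, _ ∂law m n| ≤ 2 * 15 * ∑ A ∈ S.copies m n,
    ∑ B ∈ S.copies m n with ¬ Disjoint (slots A) (slots B),
    ∑ D ∈ S.copies m n with ¬ Disjoint (slots A ∪ slots B) (slots D),
      ((∫ ω, |occCentred A ω / σ * (occCentred B ω / σ) * (occCentred D ω / σ)| ∂law m n) +
        (∫ ω, |occCentred A ω / σ * (occCentred B ω / σ)| ∂law m n) *
          ∫ ω, |occCentred D ω / σ| ∂law m n) at hstein
  have hleft : |∫ ω, f (∑ A ∈ S.copies m n, occCentred A ω / σ) ∂law m n -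
      ∫ x, f x ∂gaussianReal 0 1| =
      |∫ ω, ((∑ A ∈ S.copies m n, occCentred A ω / σ) *
        g (∑ A ∈ S.copies m n, occCentred A ω / σ) -
        g' (∑ A ∈ S.copies m n, occCentred A ω / σ)) ∂law m n| := by
    rw [← abs_neg (∫ ω, ((∑ A ∈ S.copies m n, occCentred A ω / σ) *
        g (∑ A ∈ S.copies m n, occCentred A ω / σ) -
        g' (∑ A ∈ S.copies m n, occCentred A ω / σ)) ∂law m n), ← integral_neg]
    congr 1
    calc _ = ∫ ω, (f (∑ A ∈ S.copies m n, occCentred A ω / σ) -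
          ∫ x, f x ∂gaussianReal 0 1) ∂law m n := by
          rw [integral_sub (integrable_law _) (integrable_law _)]
          simp
      _ = _ := by
          congr 1; ext ω
          rw [← hgf]
          ring
  rw [hleft]
  refine hstein.trans ?_
  have hterm : ∀ A ∈ S.copies m n, ∀ B ∈ S.copies m n, ∀ D ∈ S.copies m n,
      (∫ ω, |occCentred A ω / σ * (occCentred B ω / σ) * (occCentred D ω / σ)| ∂law m n) +
        (∫ ω, |occCentred A ω / σ * (occCentred B ω / σ)| ∂law m n) *
          ∫ ω, |occCentred D ω / σ| ∂law m n ≤ 16 / σ ^ 3 * edgeWeight (A ∪ B ∪ D) := by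
    intro A hA B hB D hD
    have pA := proper_of_mem_copies hj hA
    have pB := proper_of_mem_copies hj hB
    have pD := proper_of_mem_copies hj hD
    have e3 : ∀ ω, |occCentred A ω / σ * (occCentred B ω / σ) * (occCentred D ω / σ)| =
        |occCentred A ω * occCentred B ω * occCentred D ω| / σ ^ 3 := fun ω => by
      simp only [abs_mul, abs_div, abs_of_pos hσ0]
      field_simp
    have e2 : ∀ ω, |occCentred A ω / σ * (occCentred B ω / σ)| =
        |occCentred A ω * occCentred B ω| / σ ^ 2 := fun ω => by
      simp only [abs_mul, abs_div, abs_of_pos hσ0]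
      field_simp
    have e1 : ∀ ω, |occCentred D ω / σ| = |occCentred D ω| / σ := fun ω => by
      rw [abs_div, abs_of_pos hσ0]
    simp only [e1, e2, e3, integral_div]
    have i3 := integral_abs_occCentred_mul_mul_le pA pB pD
    have i2 := integral_abs_occCentred_mul_le pA pB
    have i1 := integral_abs_occCentred_le pD
    have iw := edgeWeight_mul_le (A ∪ B) D
    have w0 := edgeWeight_nonneg (A ∪ B)
    have hprod : (∫ ω, |occCentred A ω * occCentred B ω| ∂law m n) *
        ∫ ω, |occCentred D ω| ∂law m n ≤ 8 * edgeWeight (A ∪ B ∪ D) := by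
      calc _ ≤ 4 * edgeWeight (A ∪ B) * (2 * edgeWeight D) :=
            mul_le_mul i2 i1 (integral_nonneg fun _ => abs_nonneg _) (by positivity)
        _ ≤ _ := by linarith
    calc _ = ((∫ ω, |occCentred A ω * occCentred B ω * occCentred D ω| ∂law m n) +
          (∫ ω, |occCentred A ω * occCentred B ω| ∂law m n) *
            ∫ ω, |occCentred D ω| ∂law m n) / σ ^ 3 := by field_simp
      _ ≤ (16 * edgeWeight (A ∪ B ∪ D)) / σ ^ 3 := by
          gcongr
          linarith
      _ = _ := by ring
  calc _ ≤ 2 * 15 * ∑ A ∈ S.copies m n,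
        ∑ B ∈ S.copies m n with ¬ Disjoint (slots A) (slots B),
        ∑ D ∈ S.copies m n with ¬ Disjoint (slots A ∪ slots B) (slots D),
          16 / σ ^ 3 * edgeWeight (A ∪ B ∪ D) := by
        refine mul_le_mul_of_nonneg_left ?_ (by norm_num)
        refine Finset.sum_le_sum fun A hA => Finset.sum_le_sum fun B hB =>
          Finset.sum_le_sum fun D hD => ?_
        exact hterm A hA B (Finset.mem_filter.1 hB).1 D (Finset.mem_filter.1 hD).1
    _ = 480 / σ ^ 3 * ∑ A ∈ S.copies m n,
        ∑ B ∈ S.copies m n with ¬ Disjoint (slots A) (slots B),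
        ∑ D ∈ S.copies m n with ¬ Disjoint (slots A ∪ slots B) (slots D),
          edgeWeight (A ∪ B ∪ D) := by
        simp only [← Finset.mul_sum]
        ring
    _ ≤ 480 / σ ^ 3 * (meanConst j t m * meetConst j t m ^ 2 * logScale n ^ (3 * t + 1)) :=
        mul_le_mul_of_nonneg_left (sum_triples_le hj S m n) (by positivity)
    _ = _ := by ring

theorem exists_abs_integral_standardized_sub_le (hj : 1 ≤ j) (hm : 2 ≤ m) (t : ℕ) :
    ∃ C : ℝ, 0 < C ∧ ∀ (S : Shape j t) (n : ℕ), 2 ≤ n → 0 < S.var m n →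
      ∀ f : ℝ → ℝ, (∀ x y, |f x - f y| ≤ |x - y|) →
        |∫ ω, f (∑ A ∈ S.copies m n, occCentred A ω / √(S.var m n)) ∂law m n -
          ∫ x, f x ∂gaussianReal 0 1| ≤ C * Real.log n ^ (-(1 / 2) : ℝ) := by
  obtain ⟨c, hc, hev⟩ := exists_le_var hj hm t
  obtain ⟨n₀, hn₀⟩ := eventually_atTop.1 hev
  set K : ℝ := 480 * (meanConst j t m * meetConst j t m ^ 2 * 6 ^ (3 * t + 1)) with hK
  have hK0 : 0 ≤ K := by
    have := meanConst_nonneg j t m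
    positivity
  have hsc : 0 < √c := Real.sqrt_pos.2 hc
  -- The first summand serves `n₀ ≤ n`, the second smaller `n` through the trivial bound `2`; the
  -- `1` only ensures positivity.
  refine ⟨K / √c ^ 3 + 2 * √(Real.log n₀) + 1, by positivity, fun S n hn hvar f hf => ?_⟩
  have hL := log_natCast_pos hn
  have hsL : 0 < √(Real.log n) := Real.sqrt_pos.2 hL
  rw [Real.rpow_neg hL.le, ← Real.sqrt_eq_rpow, ← div_eq_mul_inv, le_div_iff₀ hsL]
  rcases le_or_gt n₀ n with hle | hlt
  · have h1 := abs_integral_standardized_sub_le hj S hvar hf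
    have h2 : 480 * (meanConst j t m * meetConst j t m ^ 2 * logScale n ^ (3 * t + 1)) ≤
        K * Real.log n ^ (3 * t + 1) := by
      rw [hK, mul_assoc 480, mul_assoc _ ((6 : ℝ) ^ _), ← mul_pow]
      have := one_le_logScale n
      have := logScale_le hn
      have := meanConst_nonneg j t m
      gcongr
    have h3 : √c * √(Real.log n) ^ (2 * t + 1) ≤ √(S.var m n) := by
      refine Real.le_sqrt_of_sq_le ?_
      calc _ = √c ^ 2 * (√(Real.log n) ^ 2) ^ (2 * t + 1) := by ring
        _ = c * Real.log n ^ (2 * t + 1) := by rw [Real.sq_sqrt hc.le, Real.sq_sqrt hL.le]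
        _ ≤ _ := hn₀ n hle S
    have h4 : 480 * (meanConst j t m * meetConst j t m ^ 2 * logScale n ^ (3 * t + 1)) /
        √(S.var m n) ^ 3 ≤
        K * Real.log n ^ (3 * t + 1) / (√c * √(Real.log n) ^ (2 * t + 1)) ^ 3 := by
      gcongr
    have h5 : K * Real.log n ^ (3 * t + 1) / (√c * √(Real.log n) ^ (2 * t + 1)) ^ 3 *
        √(Real.log n) = K / √c ^ 3 := by
      have e : Real.log n = √(Real.log n) ^ 2 := (Real.sq_sqrt hL.le).symm
      generalize √(Real.log n) = y at *
      rw [e]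
      field_simp
      ring
    have h6 := mul_le_mul_of_nonneg_right (h1.trans h4) hsL.le
    have h7 := Real.sqrt_nonneg (Real.log n₀)
    linarith
  · have h1 := abs_integral_standardized_sub_le_two S hvar hf
    have h2 : √(Real.log n) ≤ √(Real.log n₀) := by
      refine Real.sqrt_le_sqrt (Real.log_le_log ?_ ?_)
      · exact_mod_cast (by omega : 0 < n)
      · exact_mod_cast hlt.le
    have h3 := mul_le_mul h1 h2 hsL.le (by norm_num)
    have h4 : 0 ≤ K / √c ^ 3 := by positivity
    linarith

end Magnitude

/-! ### Counts of copies of a unicyclic graph -/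

theorem wassersteinDist_le {μ ν : Measure ℝ} {x : ℝ}
    (h : ∀ f : ℝ → ℝ, (∀ x y, |f x - f y| ≤ |x - y|) → |∫ x, f x ∂μ - ∫ x, f x ∂ν| ≤ x) :
    wassersteinDist μ ν ≤ ENNReal.ofReal x :=
  iSup₂_le fun f hf => ENNReal.ofReal_le_ofReal (h f hf)

section Count

variable {V E : Type*} {H : Graph V E} {j t m n : ℕ} {S : Shape j t}

theorem copyMean_eq_mean (hj : 1 ≤ j)
    (h : ∀ ω : Sample m n, copyCount m n H ω = ∑ A ∈ S.copies m n, occInd A ω) :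
    copyMean m n H = S.mean m n := by
  simp only [copyMean, h]
  exact integral_sum_occInd hj S

theorem copyVar_eq_var (hj : 1 ≤ j)
    (h : ∀ ω : Sample m n, copyCount m n H ω = ∑ A ∈ S.copies m n, occInd A ω) :
    copyVar m n H = S.var m n := by
  rw [copyVar, ← variance_sum_occInd hj S]
  congr 1
  exact funext h

theorem integral_standardizedLaw (hj : 1 ≤ j)
    (h : ∀ ω : Sample m n, copyCount m n H ω = ∑ A ∈ S.copies m n, occInd A ω)
    {f : ℝ → ℝ} (hf : Continuous f) :
    ∫ x, f x ∂standardizedLaw m n H =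
      ∫ ω, f (∑ A ∈ S.copies m n, occCentred A ω / √(S.var m n)) ∂law m n := by
  rw [standardizedLaw, integral_map (measurable_of_finite _).aemeasurable
    hf.aestronglyMeasurable, copyMean_eq_mean hj h, copyVar_eq_var hj h]
  congr 1; ext ω
  rw [h, sum_occInd_sub_mean, Finset.sum_div]

end Count

end UniformAttachment
end

open UniformAttachment in
theorem theorem3p4 (m ℓ t : ℕ) (hm : 2 ≤ m) (hℓ : 2 ≤ ℓ) :
    ∃ C : ℝ, 0 < C ∧
      ∀ (s : ℕ) (τ : Fin s → ℕ) (_ : ∀ i, 1 ≤ τ i) (_ : ∑ i, τ i = t)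
        (T : ∀ i, UniformAttachment.RootedTree (τ i)) (a : Fin s → Fin ℓ),
        ((fun n : ℕ => UniformAttachment.copyMean m n (UniformAttachment.unicyclicGraph T a))
            =Θ[atTop] fun n : ℕ => Real.log n ^ (t + 1)) ∧
        ((fun n : ℕ => UniformAttachment.copyVar m n (UniformAttachment.unicyclicGraph T a))
            =Θ[atTop] fun n : ℕ => Real.log n ^ (2 * t + 1)) ∧
        ∀ n : ℕ, 2 ≤ n →
          0 < UniformAttachment.copyVar m n (UniformAttachment.unicyclicGraph T a) →
          UniformAttachment.wassersteinDist
              (UniformAttachment.standardizedLaw m n (UniformAttachment.unicyclicGraph T a))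
              (gaussianReal 0 1)
            ≤ ENNReal.ofReal (C * Real.log n ^ (-(1 / 2) : ℝ)) := by
  obtain ⟨j, rfl⟩ := Nat.exists_eq_add_of_le' (show 1 ≤ ℓ by omega)
  have hj : 1 ≤ j := by omega
  -- The constant is fixed before the trees and their attachment points, so it depends only on `m`,
  -- `ℓ = j + 1` and `t`.
  obtain ⟨C, hC, hdist⟩ := exists_abs_integral_standardized_sub_le hj hm t
  refine ⟨C, hC, fun s τ _ hτ T a => ?_⟩
  obtain ⟨S, hS⟩ := exists_shape_copyCount_eq hj hτ T a
  have hcount : ∀ (n : ℕ) (ω : Sample m n), copyCount m n (unicyclicGraph T a) ω =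
      ∑ A ∈ S.copies m n, occInd A ω := hS m
  simp only [fun n => copyMean_eq_mean hj (hcount n), fun n => copyVar_eq_var hj (hcount n)]
  obtain ⟨c, hc, hmean⟩ := exists_le_mean hj hm t
  obtain ⟨c', hc', hvar⟩ := exists_le_var hj hm t
  refine ⟨isTheta_log_pow hc (hmean.mono fun n h => h S) fun n hn => mean_le_log hj S hn,
    isTheta_log_pow hc' (hvar.mono fun n h => h S) fun n hn => var_le_log hj S hn,
    fun n hn hpos => wassersteinDist_le fun f hf => ?_⟩
  rw [integral_standardizedLaw hj (hcount n) (continuous_of_abs_sub_le hf)]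
  exact hdist S n hn hpos f hf
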